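/- **Setting.** Let $\mathcal E_l,\mathcal E_f$ be disjoint finite sets, $\mathcal E_f\neq\emptyset$, $n=|\mathcal E_l\cup\mathcal E_f|$, $b\in\{0,\dots,n\}$, let $c:\mathcal E_l\cup\mathcal E_f\to\mathbb R$ be leader's costs (for instance rational ones), and let $d^-,d^+:\mathcal E_f\to\mathbb R$ with $d^-\le d^+$ define the interval uncertainty set $\mathcal U=\prod_{e\in\mathcal E_f}[d^-(e),d^+(e)]$. Assume that there are no one-point intersections: $d^-(e_1)\ne d^+(e_2)$ for all $e_1,e_2\in\mathcal E_f$. The *Robust Continuous Bilevel Selection Problem* is $$\min_{x\in[0,1]^{\mathcal E_l}}\ \max_{d\in\mathcal U}\ \sum_{e\in\mathcal E_l}c(e)x_e+\sum_{e\in\mathcal E_f}c(e)y_e ,$$ where $y$ minimizes $\sum_{e\in\mathcal E_f}d(e)y'_e$ over all $y'\in[0,1]^{\mathcal E_f}$ with $\sum_{e\in\mathcal E_l}x_e+\sum_{e\in\mathcal E_f}y'_e=b$; among several such minimizers the follower takes one that minimizes (optimistic setting) or maximizes (pessimistic setting) $\sum_{e\in\mathcal E_f}c(e)y'_e$. The leader's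 solution $x$ is feasible if the follower has a feasible solution. The *adversary's problem* for a fixed feasible $x$ is to find $d\in\mathcal U$ attaining the maximum. The *continuous selection problem* $\mathrm{CSP}(A,\beta,w)$ is to find $y\in[0,1]^A$ with $\sum_{e\in A}y_e=\beta$ and minimal $\sum_{e\in A}w(e)y_e$. For $h\in\mathcal E_f$ (a *head*) put $$E_h^-=\{e\in\mathcal E_f: d^+(e)<d^-(h)\},\qquad E_h^0=\{e\in\mathcal E_f: d^-(e)\le d^-(h)\le d^+(e)\}.$$ **Algorithm 3a (adversary, for a feasible $x$).** Let $b_f=b-\sum_{e\in\mathcal E_l}x_e$. For every $h\in\mathcal E_f$ with $|E_h^-|\le b_f$ and $|E_h^0|\ge b_f-|E_h^-|$, let $y^h$ be $1$ on $E_h^-$, a solution of $\mathrm{CSP}(E_h^0,b_f-|E_h^-|,-c)$ with at most one nonbinary value on $E_h^0$, and $0$ elsewhere. Among these heads select one, $h$, maximizing $\sum_{e\in\mathcal E_f}c(e)y^h_e$, arbitrarily. Let $\varepsilon=\frac12\min\{d^+(e)-d^-(h): e\in\mathcal E_f\setminus E_h^-\}$. Return $d$ with $d(e)=d^-(e)$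 if $y^h_e=1$, $d(e)=d^+(e)$ if $y^h_e=0$, and $d(e)=d^-(h)+\varepsilon$ if $0<y^h_e<1$. **Algorithm 3 (leader).** Let $b_l^-=\max\{0,b-|\mathcal E_f|\}$, $b_l^+=\min\{b,|\mathcal E_l|\}$, $b_f^+=b-b_l^-$, $b_f^-=b-b_l^+$. For a finite set $A$ of items let $P_A$ (respectively $Q_A$) be the continuous piecewise linear function on $[0,|A|]$ with value $0$ at $0$ whose slopes on $[0,1],[1,2],\dots$ are the costs $c(e)$, $e\in A$, in nondecreasing (respectively nonincreasing) order. Let $g_l=P_{\mathcal E_l}$ on $[b_l^-,b_l^+]$. For every $h\in\mathcal E_f$ with $|E_h^-|\le b_f^+$ and $|E_h^0|\ge b_f^--|E_h^-|$, let $\beta_h^-=\max\{0,b_f^--|E_h^-|\}$, $\beta_h^+=\min\{b_f^+-|E_h^-|,|E_h^0|\}$, and let $g_f^h$ be the function $t\mapsto Q_{E_h^0}(b-t)$ on $[b-\beta_h^+,b-\beta_h^-]$, shifted by $-|E_h^-|$ horizontally and by $\sum_{e\in E_h^-}c(e)$ vertically. Let $g_f$ be the pointwise maximum of the functions $g_f^h$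 (at each point, over those defined there), and $g=g_l+g_f$. Choose any minimizer $b_l^*$ of $g$ on $[b_l^-,b_l^+]$ and return a solution of $\mathrm{CSP}(\mathcal E_l,b_l^*,c)$. **Theorem.** Both in the optimistic and in the pessimistic setting: 1. For every $t\in[b_l^-,b_l^+]$ the maximum defining $g_f(t)$ exists, and $g(t)$ is the least worst-case objective value of a feasible leader's solution $x$ with $\sum_{e\in\mathcal E_l}x_e=t$. 2. Every possible return value of Algorithm 3 is an optimal leader's solution. Algorithm 3 can be implemented in time $O(n^2\log n)$ (for $n\ge2$). 3. For every feasible leader's solution $x$, every possible return value of Algorithm 3a is an optimal solution of the adversary's problem, and it is rational-valued if $d^-$ and $d^+$ are. Algorithm 3a can be implemented in time $O(n^2)$. Time is counted in unit-cost steps (arithmetic operations and comparisons of numbers, lookups of the data of an item, calls of the functions that process lists cell by cell). The constants in the bounds are universal. -/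

import Mathlib

/-!
The robust continuous bilevel selection problem with disjoint item sets and interval uncertainty,
the algorithms for the leader and for the adversary as pseudocode (with their arbitrary choices),
and implementations of both with a step count.
-/

namespace RCBSP

/-! ### Instances -/

/-- The input data. The item sets `E_l` and `E_f` are given by listings of their elements,
the uncertainty set is the product of the intervals `[lo e, hi e]` over the follower's items. -/
structure Inst (E K : Type) where
  leaderItems : List E
  followerItems : List E
  b : ℕ
  c : E → K
  lo : E → K
  hi : E → K

namespace Inst

section Problem

variable {E : Type} [DecidableEq E] (I : Inst E ℝ)

/-- The leader's item set. -/
def El : Finset E := I.leaderItems.toFinset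

/-- The follower's item set. -/
def Ef : Finset E := I.followerItems.toFinset

/-- The total number of items. -/
def n : ℕ := (I.El ∪ I.Ef).card

/-- Admissible inputs: proper listings, disjoint item sets, at least one follower's item,
`b ∈ {0, …, n}`, nonempty intervals, and no one-point intersections between intervals. -/
structure Valid : Prop where
  nodup_leader : I.leaderItems.Nodup
  nodup_follower : I.followerItems.Nodup
  disjoint : Disjoint I.El I.Ef
  follower_nonempty : I.Ef.Nonempty
  b_le : I.b ≤ I.n
  lo_le_hi : ∀ e ∈ I.Ef, I.lo e ≤ I.hi e
  no_one_point : ∀ e₁ ∈ I.Ef, ∀ e₂ ∈ I.Ef, I.lo e₁ ≠ I.hi e₂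

/-! ### The three-level problem

Vectors are functions on all of `E`; a leader's vector is only ever read on `E_l`, a follower's
vector and a scenario only on `E_f`. -/

/-- The uncertainty set. -/
def uncertaintySet : Set (E → ℝ) := {d | ∀ e ∈ I.Ef, I.lo e ≤ d e ∧ d e ≤ I.hi e}

/-- The leader's costs of the follower's selection `y`. -/
def followerPart (y : E → ℝ) : ℝ := ∑ e ∈ I.Ef, I.c e * y e

/-- The leader's objective value of the selections `x` and `y`. -/
def leaderCost (x y : E → ℝ) : ℝ := ∑ e ∈ I.El, I.c e * x e + I.followerPart y

/-- `y` is feasible for the follower's problem, given the leader's solution `x`. -/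
def FollowerFeasible (x y : E → ℝ) : Prop :=
  (∀ e ∈ I.El ∩ I.Ef, x e + y e ≤ 1) ∧
  ∑ e ∈ I.El, x e + ∑ e ∈ I.Ef, y e = I.b ∧
  ∀ e ∈ I.Ef, 0 ≤ y e ∧ y e ≤ 1

/-- `y` is optimal for the follower's problem under the follower's costs `d`. -/
def FollowerOptimal (x d y : E → ℝ) : Prop :=
  I.FollowerFeasible x y ∧
  ∀ y', I.FollowerFeasible x y' → ∑ e ∈ I.Ef, d e * y e ≤ ∑ e ∈ I.Ef, d e * y' e

end Problem

end Inst

/-- How the follower decides among his optimal solutions: in favour of the leader or against. -/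
inductive Setting where
  | optimistic
  | pessimistic

namespace Inst

section Problem

variable {E : Type} [DecidableEq E] (I : Inst E ℝ)

/-- `y` is a follower's reaction to the leader's solution `x` and the scenario `d`. -/
def Response (s : Setting) (x d y : E → ℝ) : Prop :=
  I.FollowerOptimal x d y ∧
  match s with
  | Setting.optimistic => ∀ y', I.FollowerOptimal x d y' → I.followerPart y ≤ I.followerPart y'
  | Setting.pessimistic => ∀ y', I.FollowerOptimal x d y' → I.followerPart y' ≤ I.followerPart y

/-- `x ∈ [0,1]^{E_l}` admits a feasible follower's solution. -/
def LeaderFeasible (x : E → ℝ) : Prop :=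
  (∀ e ∈ I.El, 0 ≤ x e ∧ x e ≤ 1) ∧ ∃ y, I.FollowerFeasible x y

/-- The leader's robust objective: the worst case over all scenarios. -/
noncomputable def worstCost (s : Setting) (x : E → ℝ) : ℝ :=
  sSup {v | ∃ d ∈ I.uncertaintySet, ∃ y, I.Response s x d y ∧ v = I.leaderCost x y}

/-- `x` is an optimal leader's solution. -/
def OptimalLeader (s : Setting) (x : E → ℝ) : Prop :=
  I.LeaderFeasible x ∧ ∀ x', I.LeaderFeasible x' → I.worstCost s x ≤ I.worstCost s x'

/-- `d` is an optimal adversary's solution for the fixed leader's solution `x`. -/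
def OptimalAdversary (s : Setting) (x d : E → ℝ) : Prop :=
  d ∈ I.uncertaintySet ∧
  ∃ y, I.Response s x d y ∧
    ∀ d' ∈ I.uncertaintySet, ∀ y', I.Response s x d' y' → I.leaderCost x y' ≤ I.leaderCost x y

end Problem

end Inst

/-! ### The continuous selection problem -/

section Selection

variable {E : Type}

/-- `y` solves the continuous selection problem: choose `y ∈ [0,1]^A` of total size `β` and
minimal cost with respect to `w`. -/
def SolvesSelection (A : Finset E) (β : ℝ) (w y : E → ℝ) : Prop :=
  ((∀ e ∈ A, 0 ≤ y e ∧ y e ≤ 1) ∧ ∑ e ∈ A, y e = β) ∧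
  ∀ y' : E → ℝ, (∀ e ∈ A, 0 ≤ y' e ∧ y' e ≤ 1) → ∑ e ∈ A, y' e = β →
    ∑ e ∈ A, w e * y e ≤ ∑ e ∈ A, w e * y' e

/-- At most one value of `y` on `A` is not binary. -/
def AtMostOneFractional (A : Finset E) (y : E → ℝ) : Prop :=
  ∀ e₁ ∈ A, ∀ e₂ ∈ A, 0 < y e₁ → y e₁ < 1 → 0 < y e₂ → y e₂ < 1 → e₁ = e₂

/-- The continuous piecewise linear function on `[0, k]` that vanishes at `0` and whose slopes on
`[0,1], [1,2], …, [k-1,k]` are the entries of the given list of length `k`. -/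
noncomputable def pieces : List ℝ → ℝ → ℝ
  | [], _ => 0
  | s :: ss, t => s * max 0 (min 1 t) + pieces ss (t - 1)

/-- `PLF(A, w)`: the items are sorted by nondecreasing `w`, which also gives the slopes. -/
noncomputable def plf (A : Finset E) (w : E → ℝ) (t : ℝ) : ℝ :=
  pieces ((A.val.map w).sort (fun r s => r ≤ s)) t

/-- The mirrored function `PLF(A, -w, w, b')`: the items are sorted by nondecreasing `-w`, the
slopes are given by `w`, and the argument `t` stands for the capacity `b' - t`. -/
noncomputable def plfBar (A : Finset E) (w : E → ℝ) (b' t : ℝ) : ℝ :=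
  pieces ((A.val.map w).sort (fun r s => s ≤ r)) (b' - t)

end Selection

/-! ### The two algorithms as pseudocode

The predicates `AdversaryAlgorithm` and `LeaderAlgorithm` say that a vector is a possible return
value, for some admissible outcome of every choice that the pseudocode leaves open. -/

namespace Inst

section Pseudocode

variable {E : Type} [DecidableEq E] (I : Inst E ℝ)

/-- The items that precede the head `h` in every scenario. -/
noncomputable def pred (h : E) : Finset E := I.Ef.filter fun e => I.hi e < I.lo h

/-- The items whose intervals contain the left endpoint of the head `h`. -/
noncomputable def inc (h : E) : Finset E := I.Ef.filter fun e => I.lo e ≤ I.lo h ∧ I.lo h ≤ I.hi e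

/-- The heads that pass the test of the adversary's algorithm for the capacity `β`. -/
noncomputable def adversaryHeads (β : ℝ) : Finset E :=
  I.Ef.filter fun h => ((I.pred h).card : ℝ) ≤ β ∧ β - (I.pred h).card ≤ ((I.inc h).card : ℝ)

/-- `y` is the follower's selection built in the iteration of the head `h`. -/
def HeadSelection (β : ℝ) (h : E) (y : E → ℝ) : Prop :=
  (∀ e ∈ I.pred h, y e = 1) ∧
  (SolvesSelection (I.inc h) (β - (I.pred h).card) (fun e => -I.c e) y ∧
    AtMostOneFractional (I.inc h) y) ∧
  ∀ e ∈ I.Ef \ (I.pred h ∪ I.inc h), y e = 0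

/-- `d` is a possible return value of the adversary's algorithm for the leader's solution `x`. -/
def AdversaryAlgorithm (x d : E → ℝ) : Prop :=
  ∃ β : ℝ, β = I.b - ∑ e ∈ I.El, x e ∧
  ∃ y : E → E → ℝ, (∀ h ∈ I.adversaryHeads β, I.HeadSelection β h (y h)) ∧
  ∃ h ∈ I.adversaryHeads β,
    (∀ h' ∈ I.adversaryHeads β, I.followerPart (y h') ≤ I.followerPart (y h)) ∧
    ∃ m ε : ℝ, IsLeast {r | ∃ e ∈ I.Ef \ I.pred h, r = I.hi e - I.lo h} m ∧ ε = 1 / 2 * m ∧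
      ∀ e ∈ I.Ef, (y h e = 1 → d e = I.lo e) ∧ (y h e = 0 → d e = I.hi e) ∧
        (0 < y h e → y h e < 1 → d e = I.lo h + ε)

/-- Smallest possible capacity of the leader. -/
noncomputable def blMin : ℝ := max 0 (I.b - I.Ef.card)

/-- Largest possible capacity of the leader. -/
noncomputable def blMax : ℝ := min I.b I.El.card

/-- Largest possible capacity of the follower. -/
noncomputable def bfMax : ℝ := I.b - I.blMin

/-- Smallest possible capacity of the follower. -/
noncomputable def bfMin : ℝ := I.b - I.blMax

/-- The leader's costs of her own items, depending on her capacity. -/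
noncomputable def gl (t : ℝ) : ℝ := plf I.El I.c t

/-- The heads that pass the test of the leader's algorithm. -/
noncomputable def leaderHeads : Finset E :=
  I.Ef.filter fun h => ((I.pred h).card : ℝ) ≤ I.bfMax ∧
    I.bfMin - (I.pred h).card ≤ ((I.inc h).card : ℝ)

/-- Lower end of the capacity range of the items `inc h`. -/
noncomputable def capMin (h : E) : ℝ := max 0 (I.bfMin - (I.pred h).card)

/-- Upper end of the capacity range of the items `inc h`. -/
noncomputable def capMax (h : E) : ℝ := min (I.bfMax - (I.pred h).card) ((I.inc h).card : ℝ)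

/-- The domain of the function of the head `h`: the interval `[b - capMax h, b - capMin h]`,
shifted by `-|pred h|`. -/
def headDomain (h : E) : Set ℝ :=
  {t | t + (I.pred h).card ∈ Set.Icc (I.b - I.capMax h) (I.b - I.capMin h)}

/-- The function of the head `h`: the mirrored piecewise linear function of `inc h`, shifted by
`-|pred h|` horizontally and by the leader's costs of `pred h` vertically. -/
noncomputable def headFun (h : E) (t : ℝ) : ℝ :=
  plfBar (I.inc h) I.c I.b (t + (I.pred h).card) + ∑ e ∈ I.pred h, I.c e

/-- The values at `t` of those head functions whose domain contains `t`. -/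
def headValues (t : ℝ) : Set ℝ :=
  {v | ∃ h ∈ I.leaderHeads, t ∈ I.headDomain h ∧ v = I.headFun h t}

/-- The pointwise maximum of the head functions. -/
noncomputable def gf (t : ℝ) : ℝ := sSup (I.headValues t)

/-- The leader's objective function, depending on her capacity. -/
noncomputable def g (t : ℝ) : ℝ := I.gl t + I.gf t

/-- `x` is a possible return value of the leader's algorithm. -/
def LeaderAlgorithm (x : E → ℝ) : Prop :=
  ∃ t ∈ Set.Icc I.blMin I.blMax, (∀ t' ∈ Set.Icc I.blMin I.blMax, I.g t ≤ I.g t') ∧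
    SolvesSelection I.El t I.c x

end Pseudocode

end Inst

/-! ### Step-counting programs

A program returns a value together with the number of steps that it takes. A step is a function
call, an arithmetic operation or a comparison of two numbers, or the lookup of a number that
belongs to an item. Lists are only ever processed by the recursive functions below, each of which
is charged at every call; a single call inspects and creates a constant number of list cells. -/

/-- A value with the number of steps spent on computing it. -/
structure Timed (α : Type) where
  val : α
  steps : ℕ

instance : Monad Timed where
  pure a := ⟨a, 0⟩
  bind m f := ⟨(f m.val).val, m.steps + (f m.val).steps⟩

namespace Prog

/-- One step, charged for a function call. -/
def tick : Timed Unit := ⟨(), 1⟩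

section Lists

variable {α β : Type}

/-- Keep the elements that pass a test. -/
def filter (p : α → Timed Bool) : List α → Timed (List α)
  | [] => do
      tick
      return []
  | a :: l => do
      tick
      let keep ← p a
      let r ← filter p l
      if keep then return a :: r else return r

/-- Apply a program to all elements. -/
def map (f : α → Timed β) : List α → Timed (List β)
  | [] => do
      tick
      return []
  | a :: l => do
      tick
      let x ← f a
      let r ← map f l
      return x :: r

/-- Concatenate two lists. -/
def append : List α → List α → Timed (List α)
  | [], k => do
      tick
      return k
  | a :: l, k => do
      tick
      let r ← append l k
      return a :: r

/-- Prepend the reversal of the first list to the second list. -/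
def revOnto : List α → List α → Timed (List α)
  | [], acc => do
      tick
      return acc
  | a :: l, acc => do
      tick
      revOnto l (a :: acc)

/-- Length of a list. -/
def length : List α → Timed ℕ
  | [] => do
      tick
      return 0
  | _ :: l => do
      tick
      let k ← length l
      return k + 1

/-- Distribute a list alternately to two lists. -/
def split : List α → Timed (List α × List α)
  | [] => do
      tick
      return ([], [])
  | [a] => do
      tick
      return ([a], [])
  | a :: a' :: l => do
      tick
      let r ← split l
      return (a :: r.1, a' :: r.2)

/-- Merge two sorted lists. -/
def merge (le : α → α → Timed Bool) : List α → List α → Timed (List α)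
  | [], k => do
      tick
      return k
  | a :: l, [] => do
      tick
      return a :: l
  | a :: l, a' :: k => do
      tick
      let first ← le a a'
      if first then
        let r ← merge le l (a' :: k)
        return a :: r
      else
        let r ← merge le (a :: l) k
        return a' :: r
  termination_by l k => l.length + k.length

/-- Merge sort with recursion depth at most the first argument. -/
def sortAux (le : α → α → Timed Bool) : ℕ → List α → Timed (List α)
  | 0, l => do
      tick
      return l
  | _ + 1, [] => do
      tick
      return []
  | _ + 1, [a] => do
      tick
      return [a]
  | k + 1, a :: a' :: l => do
      tick
      let r ← split (a :: a' :: l)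
      let l₁ ← sortAux le k r.1
      let l₂ ← sortAux le k r.2
      merge le l₁ l₂

/-- Merge sort. -/
def sort (le : α → α → Timed Bool) (l : List α) : Timed (List α) := do
  tick
  let k ← length l
  sortAux le k l

end Lists

section Numbers

variable {K : Type} [Field K] [LinearOrder K]

def add (r s : K) : Timed K := ⟨r + s, 1⟩

def sub (r s : K) : Timed K := ⟨r - s, 1⟩

def mul (r s : K) : Timed K := ⟨r * s, 1⟩

def div (r s : K) : Timed K := ⟨r / s, 1⟩

def lt (r s : K) : Timed Bool := ⟨decide (r < s), 1⟩

def le (r s : K) : Timed Bool := ⟨decide (r ≤ s), 1⟩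

def maxNum (r s : K) : Timed K := ⟨max r s, 1⟩

def minNum (r s : K) : Timed K := ⟨min r s, 1⟩

/-- Look up the number that the table `f` holds for an item. -/
def read {E : Type} (f : E → K) (e : E) : Timed K := ⟨f e, 1⟩

/-- The number of entries of a list, as a number. -/
def count {α : Type} : List α → Timed K
  | [] => do
      tick
      return 0
  | _ :: l => do
      tick
      let r ← count l
      add r 1

/-- The sum of the table entries of the listed items. -/
def sumOver {E : Type} (f : E → K) : List E → Timed K
  | [] => do
      tick
      return 0
  | e :: l => do
      tick
      let r ← sumOver f l
      let v ← read f e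
      add r v

/-- Compare two items by their table entries. -/
def leBy {E : Type} (f : E → K) (e e' : E) : Timed Bool := do
  tick
  let v ← read f e
  let v' ← read f e'
  le v v'

/-- Compare two items by their table entries, in reverse order. -/
def geBy {E : Type} (f : E → K) (e e' : E) : Timed Bool := do
  tick
  let v ← read f e
  let v' ← read f e'
  le v' v

/-- The greedy algorithm: fill the capacity `r` with the items in the given order. -/
def greedy {E : Type} : K → List E → Timed (List (E × K))
  | _, [] => do
      tick
      return []
  | r, e :: l => do
      tick
      let y ← minNum 1 r
      let r' ← sub r y
      let k ← greedy r' l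
      return (e, y) :: k

/-- The leader's costs of a selection that is given as a list of items with their values. -/
def costOf {E : Type} (c : E → K) : List (E × K) → Timed K
  | [] => do
      tick
      return 0
  | (e, y) :: l => do
      tick
      let r ← costOf c l
      let v ← read c e
      let p ← mul v y
      add r p

end Numbers

/-! #### The adversary -/

section Adversary

variable {E K : Type} [Field K] [LinearOrder K] (I : Inst E K)

/-- Does `e` belong to `pred h`? -/
def isPred (h e : E) : Timed Bool := do
  tick
  let a ← read I.hi e
  let a' ← read I.lo h
  lt a a'

/-- Does `e` belong to `inc h`? -/
def isInc (h e : E) : Timed Bool := do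
  tick
  let a ← read I.lo e
  let z ← read I.lo h
  let a' ← read I.hi e
  let t ← le a z
  let t' ← le z a'
  return t && t'

/-- Does `e` belong neither to `pred h` nor to `inc h`? -/
def isRest (h e : E) : Timed Bool := do
  tick
  let t ← isPred I h e
  let t' ← isInc I h e
  return !t && !t'

/-- The iteration of the head `h`: its selection and the leader's costs of this selection, if the
head passes the test. The follower's items are listed by nonincreasing leader's costs. -/
def tryHead (cap : K) (items : List E) (h : E) : Timed (Option (K × List (E × K))) := do
  tick
  let before ← filter (isPred I h) items
  let mid ← filter (isInc I h) items
  let p ← (count before : Timed K)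
  let q ← (count mid : Timed K)
  let r ← sub cap p
  let t ← le p cap
  let t' ← le r q
  if t && t' then
    let after ← filter (isRest I h) items
    let y₁ ← map (fun e => (pure (e, 1) : Timed (E × K))) before
    let y₂ ← greedy r mid
    let y₃ ← map (fun e => (pure (e, 0) : Timed (E × K))) after
    let y₁₂ ← append y₁ y₂
    let y ← append y₁₂ y₃
    let v ← costOf I.c y
    return some (v, y)
  else
    return none

/-- The loop over the heads, keeping a best head together with its value and its selection. -/
def bestHead (cap : K) (items : List E) :
    List E → Option (E × K × List (E × K)) → Timed (Option (E × K × List (E × K)))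
  | [], best => do
      tick
      return best
  | h :: hs, best => do
      tick
      let cand ← tryHead I cap items h
      match cand, best with
      | none, _ => bestHead cap items hs best
      | some (v, y), none => bestHead cap items hs (some (h, v, y))
      | some (v, y), some (h', v', y') => do
          let better ← lt v' v
          if better then bestHead cap items hs (some (h, v, y))
          else bestHead cap items hs (some (h', v', y'))

/-- The minimum of `z` and of `hi e - a` over the listed items `e` with `a ≤ hi e`. -/
def minGap (a : K) : K → List E → Timed K
  | z, [] => do
      tick
      return z
  | z, e :: l => do
      tick
      let u ← read I.hi e
      let t ← le a u
      if t then
        let w ← sub u a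
        let z' ← minNum z w
        minGap a z' l
      else
        minGap a z l

/-- The costs that the adversary assigns to the items of a selection; `a` is the cost of a
fractional item. -/
def scenario (a : K) : List (E × K) → Timed (List (E × K))
  | [] => do
      tick
      return []
  | (e, y) :: l => do
      tick
      let k ← scenario a l
      let full ← le 1 y
      let pos ← lt 0 y
      if full then
        let v ← read I.lo e
        return (e, v) :: k
      else if pos then
        return (e, a) :: k
      else
        let v ← read I.hi e
        return (e, v) :: k

/-- The adversary's algorithm. The follower's items are sorted once by nonincreasing leader's
costs, so that the greedy algorithm solves each continuous selection problem in linear time. -/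
def adversary (x : E → K) : Timed (List (E × K)) := do
  tick
  let bl ← sumOver x I.leaderItems
  let cap ← sub (I.b : K) bl
  let items ← sort (geBy I.c) I.followerItems
  let best ← bestHead I cap items I.followerItems none
  match best with
  | none => return []
  | some (h, _, y) => do
      let a ← read I.lo h
      let u ← read I.hi h
      let z ← sub u a
      let m ← minGap I a z I.followerItems
      let ε ← div m 2
      let v ← add a ε
      scenario I v y

end Adversary

/-! #### The leader

A piecewise linear function is stored as the list of its vertices, by increasing abscissas. -/

section Leader

variable {E K : Type} [Field K] [LinearOrder K]

/-- The vertices of the function with value `v` at `t` and the given slopes, on pieces of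
length one. -/
def vertices : K → K → List K → Timed (List (K × K))
  | t, v, [] => do
      tick
      return [(t, v)]
  | t, v, s :: ss => do
      tick
      let t' ← add t 1
      let v' ← add v s
      let k ← vertices t' v' ss
      return (t, v) :: k

/-- Does the abscissa of the vertex lie between `a` and `a'`? -/
def inRange (a a' : K) (p : K × K) : Timed Bool := do
  tick
  let t ← le a p.1
  let t' ← le p.1 a'
  return t && t'

/-- The vertices over `[a, a']` of the piecewise linear function that starts in the origin and
whose slopes are the costs of the items in the given order. -/
def plfVertices (c : E → K) (items : List E) (a a' : K) : Timed (List (K × K)) := do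
  tick
  let ss ← map (read c) items
  let k ← vertices 0 0 ss
  filter (inRange a a') k

/-- Replace the abscissa `t` of a vertex by `b' - t`. -/
def mirror (b' : K) (p : K × K) : Timed (K × K) := do
  tick
  let t ← sub b' p.1
  return (t, p.2)

/-- Translate a vertex. -/
def shift (a r : K) (p : K × K) : Timed (K × K) := do
  tick
  let t ← add p.1 a
  let v ← add p.2 r
  return (t, v)

/-- The function of the head `h`, if the head passes the test; `fMin` and `fMax` bound the
follower's capacity. -/
def headVertices (I : Inst E K) (fMin fMax : K) (h : E) : Timed (Option (List (K × K))) := do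
  tick
  let before ← filter (isPred I h) I.followerItems
  let mid ← filter (isInc I h) I.followerItems
  let p ← (count before : Timed K)
  let q ← (count mid : Timed K)
  let r ← sub fMin p
  let r' ← sub fMax p
  let t ← le p fMax
  let t' ← le r q
  if t && t' then
    let a ← maxNum 0 r
    let a' ← minNum r' q
    let sorted ← sort (geBy I.c) mid
    let k ← plfVertices I.c sorted a a'
    let k₁ ← map (mirror (I.b : K)) k
    let k₂ ← revOnto k₁ []
    let z ← sumOver I.c before
    let p' ← sub 0 p
    let k₃ ← map (shift p' z) k₂
    return some k₃
  else
    return none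

/-- The loop over the heads. -/
def allHeads (I : Inst E K) (fMin fMax : K) : List E → Timed (List (List (K × K)))
  | [] => do
      tick
      return []
  | h :: hs => do
      tick
      let f ← headVertices I fMin fMax h
      let r ← allHeads I fMin fMax hs
      match f with
      | none => return r
      | some k => return k :: r

/-- The linear pieces over `[t, t + 1]` of those functions that are defined there, where no vertex
lies to the left of `t`; a piece is stored as the pair of its values at `t` and `t + 1`. -/
def segments (t : K) : List (List (K × K)) → Timed (List (K × K))
  | [] => do
      tick
      return []
  | f :: fs => do
      tick
      let r ← segments t fs
      match f with
      | (a, u) :: (_, u') :: _ => do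
          let starts ← le a t
          if starts then return (u, u') :: r else return r
      | _ => return r

/-- Remove the vertices at `t`, where no vertex lies to the left of `t`. -/
def advance (t : K) : List (List (K × K)) → Timed (List (List (K × K)))
  | [] => do
      tick
      return []
  | f :: fs => do
      tick
      let r ← advance t fs
      match f with
      | [] => return r
      | (a, u) :: k => do
          let starts ← le a t
          if starts then return k :: r else return ((a, u) :: k) :: r

/-- The maximum at `t` of those functions that are defined there, where no vertex lies to the left
of `t`; the result is a list with at most one vertex. -/
def maxAt (t : K) : List (List (K × K)) → Timed (List (K × K))
  | [] => do
      tick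
      return []
  | f :: fs => do
      tick
      let r ← maxAt t fs
      match f with
      | [] => return r
      | (a, u) :: _ => do
          let starts ← le a t
          if starts then
            match r with
            | [] => return [(t, u)]
            | (_, v) :: _ => do
                let w ← maxNum u v
                return [(t, w)]
          else return r

/-- Compare two linear pieces over `[0, 1]` by their slopes. -/
def leSlope (p p' : K × K) : Timed Bool := do
  tick
  let s ← sub p.2 p.1
  let s' ← sub p'.2 p'.1
  le s s'

/-- The value at `s` of the linear piece over `[0, 1]` with end values `p`. -/
def evalPiece (p : K × K) (s : K) : Timed K := do
  tick
  let d ← sub p.2 p.1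
  let r ← mul s d
  add p.1 r

/-- Update an upper envelope over `[0, 1]`, whose vertices are listed from right to left, by a
linear piece `p` that is at least as steep: vertices below `p` are removed from the right, where
`last` is the vertex that was removed most recently, and the intersection point is inserted. -/
def pushPiece (p : K × K) : Option (K × K) → List (K × K) → Timed (List (K × K))
  | _, [] => do
      tick
      return [(1, p.2), (0, p.1)]
  | last, (s, v) :: k => do
      tick
      let w ← evalPiece p s
      let below ← lt v w
      if below then pushPiece p (some (s, v)) k
      else
        match last with
        | none => return (s, v) :: k
        | some (s₁, v₁) => do
            let w₁ ← evalPiece p s₁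
            let δ ← sub v w
            let δ₁ ← sub w₁ v₁
            let den ← add δ δ₁
            let ds ← sub s₁ s
            let num ← mul ds δ
            let q ← div num den
            let s' ← add s q
            let v' ← evalPiece p s'
            return (1, p.2) :: (s', v') :: (s, v) :: k

/-- Insert linear pieces one after the other, by nondecreasing slopes. -/
def pushAll : List (K × K) → List (K × K) → Timed (List (K × K))
  | [], k => do
      tick
      return k
  | p :: ps, k => do
      tick
      let k' ← pushPiece p none k
      pushAll ps k'

/-- The vertices of the pointwise maximum of linear pieces over `[0, 1]`. -/
def envelope (ps : List (K × K)) : Timed (List (K × K)) := do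
  tick
  let sorted ← sort leSlope ps
  let k ← pushAll sorted []
  revOnto k []

/-- The vertices of the pointwise maximum of the functions `fs`, one section between consecutive
abscissas in the given list after the other. -/
def pointwiseMax : List (K × K) → List (List (K × K)) → Timed (List (K × K))
  | [], _ => do
      tick
      return []
  | [(t, _)], fs => do
      tick
      maxAt t fs
  | (t, _) :: q :: l, fs => do
      tick
      let ps ← segments t fs
      let k ← envelope ps
      let k' ← map (shift t 0) k
      let fs' ← advance t fs
      let r ← pointwiseMax (q :: l) fs'
      append k' r

/-- The sum of two functions, at the vertices of the second one; the vertices of the first one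
have distance one. -/
def addFun : List (K × K) → List (K × K) → Timed (List (K × K))
  | [], _ => do
      tick
      return []
  | _ :: _, [] => do
      tick
      return []
  | [(a, u)], (t, v) :: k => do
      tick
      let w ← add u v
      let r ← addFun [(a, u)] k
      return (t, w) :: r
  | (a, u) :: (a', u') :: l, (t, v) :: k => do
      tick
      let inside ← le t a'
      if inside then
        let s ← sub t a
        let z ← evalPiece (u, u') s
        let w ← add z v
        let r ← addFun ((a, u) :: (a', u') :: l) k
        return (t, w) :: r
      else
        addFun ((a', u') :: l) ((t, v) :: k)
  termination_by l k => l.length + k.length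

/-- A vertex with minimal value, among the first argument and the list. -/
def argmin : K × K → List (K × K) → Timed (K × K)
  | p, [] => do
      tick
      return p
  | p, q :: l => do
      tick
      let better ← lt q.2 p.2
      if better then argmin q l else argmin p l

/-- The leader's algorithm. -/
def leader (I : Inst E K) : Timed (List (E × K)) := do
  tick
  let nl ← (count I.leaderItems : Timed K)
  let nf ← (count I.followerItems : Timed K)
  let r ← sub (I.b : K) nf
  let lMin ← maxNum 0 r
  let fMax ← sub (I.b : K) lMin
  let lMax ← minNum (I.b : K) nl
  let fMin ← sub (I.b : K) lMax
  let items ← sort (leBy I.c) I.leaderItems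
  let gl ← plfVertices I.c items lMin lMax
  let fs ← allHeads I fMin fMax I.followerItems
  let gf ← pointwiseMax gl fs
  let g ← addFun gl gf
  match g with
  | [] => return []
  | p :: l => do
      let best ← argmin p l
      greedy best.1 items

end Leader

/-- The vector that a list of items with values stands for. -/
def toVec {E K : Type} [DecidableEq E] [Zero K] (l : List (E × K)) (e : E) : K :=
  (l.lookup e).getD 0

end Prog

end RCBSP

/-! For a fixed leader's solution the follower solves a selection problem of capacity `β = b - ∑ x`.
Linear optimality turns this into a threshold statement (`solvesSelection_of_threshold`,
`exists_threshold`): a selection is optimal for `d` iff, for some number `a`, items cheaper than `a`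
are taken completely and items dearer than `a` not at all.

Upper bound on the adversary. Given any scenario and any optimal response, let the head `h` be an
item whose left endpoint is the largest one not exceeding the threshold. Every interval ending
before `lo h` lies below the threshold, and every interval starting after `lo h` lies above it. So
the response is `1` on `pred h`, `0` outside `pred h ∪ inc h`, and its leader's cost is at most the
best value attainable for this head (`Valid.exists_head_of_solves`).

Lower bound. Conversely, a head selection with at most one fractional value can be forced: put its
full items at their left endpoints, its empty items at their right endpoints, and the fractional
item slightly above `lo h`. Since no interval ends exactly where another begins, there is room for
this, full items lie strictly below and empty items strictly above the threshold. The only freedom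
left is the value of the fractional item, which the capacity fixes (`Valid.scenario_forces`). The
response is unique, so the optimistic and the pessimistic settings coincide. Hence the worst case of
`x` is `∑ c x + gf (∑ x)` (`Valid.worstCost_eq`). It depends on `x` only through its cost and its
total size `t`, and the cheapest `x` of size `t` costs `gl t`. Minimizing `g = gl + gf` is therefore
the leader's problem.

Implementation of the leader's algorithm. All break points of `gl` and of the head functions are
integers, so over each `[i, i+1]` the function `gf` is an upper envelope of linear pieces. One point
needs an argument: a head may be defined at `i` but on no segment next to it. At integral capacities
a head selection is a set of items, and a different head can be chosen that admits this set and is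
defined on the whole section (`Valid.exists_head_right`, `Valid.exists_head_left`). Each envelope is
built by inserting pieces in the order of their slopes (`pushPiece_some`). Together with a linear
function it is minimized at a vertex (`IsEnvelope.exists_vertex_le`), so comparing finitely many
vertices suffices (`pointwiseMax_spec`, `leader_spec`).

Running times. There are at most `n` heads and at most `n` sections, each dominated by sorting at
most `n` objects; insertion into an envelope is linear by amortization (`pushPiece_bound`). The
adversary sorts once and then spends linear time per head. -/

namespace RCBSP

/-! ### Continuous selection: thresholds and the greedy algorithm. -/

section Selection

variable {E : Type}

/-- The threshold `a` acts as a Lagrange multiplier for the capacity constraint: after replacing `w`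
by `w - a`, no competitor improves on `y` in any single coordinate, and between vectors of equal
size the subtraction of `a` does not matter. -/
theorem solvesSelection_of_threshold {A : Finset E} {β : ℝ} {w y : E → ℝ} (a : ℝ)
    (h01 : ∀ e ∈ A, 0 ≤ y e ∧ y e ≤ 1) (hs : ∑ e ∈ A, y e = β)
    (h1 : ∀ e ∈ A, w e < a → y e = 1) (h0 : ∀ e ∈ A, a < w e → y e = 0) :
    SolvesSelection A β w y := by
  refine ⟨⟨h01, hs⟩, fun y' h01' hs' => ?_⟩
  have key : 0 ≤ ∑ e ∈ A, (w e - a) * (y' e - y e) := by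
    refine Finset.sum_nonneg fun e he => ?_
    obtain ⟨h0', h1'⟩ := h01' e he
    rcases lt_trichotomy (w e) a with h | h | h
    · rw [h1 e he h]; nlinarith
    · rw [h]; simp
    · rw [h0 e he h]; nlinarith
  have : ∑ e ∈ A, (w e - a) * (y' e - y e)
      = (∑ e ∈ A, w e * y' e - ∑ e ∈ A, w e * y e) - a * (∑ e ∈ A, y' e - ∑ e ∈ A, y e) := by
    rw [← Finset.sum_sub_distrib, ← Finset.sum_sub_distrib, Finset.mul_sum,
      ← Finset.sum_sub_distrib]
    exact Finset.sum_congr rfl fun e _ => by ring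
  rw [this, hs, hs'] at key
  linarith

/-- A solution of no larger cost than one given by a threshold agrees with it off the threshold. -/
theorem eq_of_threshold {A : Finset E} {w y y' : E → ℝ} (a : ℝ)
    (hs : ∑ e ∈ A, y' e = ∑ e ∈ A, y e)
    (h1 : ∀ e ∈ A, w e < a → y e = 1) (h0 : ∀ e ∈ A, a < w e → y e = 0)
    (h01' : ∀ e ∈ A, 0 ≤ y' e ∧ y' e ≤ 1)
    (hle : ∑ e ∈ A, w e * y' e ≤ ∑ e ∈ A, w e * y e) :
    ∀ e ∈ A, w e ≠ a → y' e = y e := by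
  have hnn : ∀ e ∈ A, 0 ≤ (w e - a) * (y' e - y e) := by
    intro e he
    obtain ⟨h0', h1'⟩ := h01' e he
    rcases lt_trichotomy (w e) a with h | h | h
    · rw [h1 e he h]; nlinarith
    · rw [h]; simp
    · rw [h0 e he h]; nlinarith
  have : ∑ e ∈ A, (w e - a) * (y' e - y e)
      = (∑ e ∈ A, w e * y' e - ∑ e ∈ A, w e * y e) - a * (∑ e ∈ A, y' e - ∑ e ∈ A, y e) := by
    rw [← Finset.sum_sub_distrib, ← Finset.sum_sub_distrib, Finset.mul_sum,
      ← Finset.sum_sub_distrib]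
    exact Finset.sum_congr rfl fun e _ => by ring
  -- Complementary slackness: the terms are nonnegative and their sum is at most zero, so each of
  -- them vanishes.
  have hz : ∑ e ∈ A, (w e - a) * (y' e - y e) = 0 := by
    refine le_antisymm ?_ (Finset.sum_nonneg hnn)
    rw [this, hs]; linarith
  intro e he hne
  have := (Finset.sum_eq_zero_iff_of_nonneg hnn).1 hz e he
  rcases mul_eq_zero.1 this with h | h
  · exact absurd (sub_eq_zero.1 h) hne
  · exact sub_eq_zero.1 h

theorem pieces_of_nonpos : ∀ (l : List ℝ) {t : ℝ}, t ≤ 0 → pieces l t = 0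
  | [], _, _ => rfl
  | s :: ss, t, h => by
    rw [pieces, pieces_of_nonpos ss (by linarith), max_eq_left (min_le_of_right_le h)]
    simp

/-- Filling the capacity `r` with units, in the given order. -/
noncomputable def fill : ℝ → List E → List (E × ℝ)
  | _, [] => []
  | r, e :: l => (e, min 1 r) :: fill (r - min 1 r) l

theorem greedy_val : ∀ (r : ℝ) (l : List E), (Prog.greedy r l).val = fill r l
  | _, [] => rfl
  | r, e :: l => by
    have := greedy_val (r - min 1 r) l
    rw [fill, ← this]; rfl

theorem fill_fst : ∀ (r : ℝ) (l : List E), (fill r l).map Prod.fst = l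
  | _, [] => rfl
  | r, e :: l => by rw [fill, List.map_cons, fill_fst]

theorem fill_zero : ∀ (l : List E), ∀ p ∈ fill 0 l, p.2 = 0
  | [], p, hp => by simp [fill] at hp
  | e :: l, p, hp => by
    rw [fill, List.mem_cons] at hp
    rcases hp with rfl | hp
    · simp
    · exact fill_zero l p (by simpa using hp)

theorem fill_mem_Icc : ∀ {r : ℝ} (l : List E), 0 ≤ r → ∀ p ∈ fill r l, 0 ≤ p.2 ∧ p.2 ≤ 1
  | r, [], _, p, hp => by simp [fill] at hp
  | r, e :: l, hr, p, hp => by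
    rw [fill, List.mem_cons] at hp
    rcases hp with rfl | hp
    · exact ⟨le_min zero_le_one hr, min_le_left _ _⟩
    · exact fill_mem_Icc l (sub_nonneg.2 (min_le_right _ _)) p hp

theorem fill_sum : ∀ {r : ℝ} (l : List E), 0 ≤ r → r ≤ l.length →
    ((fill r l).map Prod.snd).sum = r
  | r, [], h0, h => by
    have : r = 0 := le_antisymm (by simpa using h) h0
    simp [fill, this]
  | r, e :: l, h0, h => by
    push_cast [List.length] at h
    rw [fill, List.map_cons, List.sum_cons, fill_sum l (sub_nonneg.2 (min_le_right _ _))]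
    · ring
    · rcases le_total 1 r with h1 | h1
      · rw [min_eq_left h1]; linarith
      · rw [min_eq_right h1, sub_self]; positivity

theorem fill_cost (c : E → ℝ) : ∀ {r : ℝ} (l : List E), 0 ≤ r →
    ((fill r l).map fun p => c p.1 * p.2).sum = pieces (l.map c) r
  | r, [], h0 => by simp [fill, pieces]
  | r, e :: l, h0 => by
    rw [fill, List.map_cons, List.sum_cons, fill_cost c l (sub_nonneg.2 (min_le_right _ _)),
      List.map_cons, pieces, max_eq_right (le_min zero_le_one h0)]
    congr 1
    -- If `r ≤ 1`, the remaining capacity is `0` in `fill` but `r - 1 ≤ 0` in `pieces`; both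
    -- contribute nothing.
    rcases le_total 1 r with h1 | h1
    · rw [min_eq_left h1]
    · rw [min_eq_right h1, pieces_of_nonpos _ (by linarith), pieces_of_nonpos _ (by linarith)]

theorem fill_fractional : ∀ {r : ℝ} (l : List E), 0 ≤ r → ∀ p ∈ fill r l, ∀ q ∈ fill r l,
    0 < p.2 → p.2 < 1 → 0 < q.2 → q.2 < 1 → p.1 = q.1
  | r, [], _, p, hp => by simp [fill] at hp
  | r, e :: l, hr, p, hp => by
    intro q hq hp0 hp1 hq0 hq1
    rw [fill, List.mem_cons] at hp hq
    rcases le_total 1 r with h1 | h1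
    · rw [min_eq_left h1] at hp hq
      rcases hp with rfl | hp
      · exact absurd hp1 (lt_irrefl _)
      rcases hq with rfl | hq
      · exact absurd hq1 (lt_irrefl _)
      exact fill_fractional l (by linarith) p hp q hq hp0 hp1 hq0 hq1
    · rw [min_eq_right h1, sub_self] at hp hq
      rcases hp with rfl | hp
      · rcases hq with rfl | hq
        · rfl
        · exact absurd (fill_zero l q hq) hq0.ne'
      · exact absurd (fill_zero l p hp) hp0.ne'

/-- The threshold item `e₀` is the one during which the capacity runs out: everything before it is
full, everything after it is empty, and by the sorting this covers all strictly cheaper and all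
strictly dearer items. -/
theorem fill_threshold (w : E → ℝ) : ∀ {r : ℝ} (l : List E), l ≠ [] → 0 ≤ r → r ≤ l.length →
    l.Pairwise (fun a b => w a ≤ w b) →
    ∃ e₀ ∈ l, ∀ p ∈ fill r l, (w p.1 < w e₀ → p.2 = 1) ∧ (w e₀ < w p.1 → p.2 = 0)
  | r, [], h, _, _, _ => absurd rfl h
  | r, e :: l, _, h0, h, hl => by
    rw [List.pairwise_cons] at hl
    push_cast [List.length] at h
    rcases le_or_gt r 1 with h1 | h1
    · refine ⟨e, by simp, fun p hp => ?_⟩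
      rw [fill, List.mem_cons, min_eq_right h1, sub_self] at hp
      rcases hp with rfl | hp
      · exact ⟨fun h => absurd h (lt_irrefl _), fun h => absurd h (lt_irrefl _)⟩
      · refine ⟨fun h => absurd h (not_lt.2 (hl.1 _ ?_)), fun _ => fill_zero l p hp⟩
        have := List.mem_map_of_mem (f := Prod.fst) hp
        rwa [fill_fst] at this
    · have hne : l ≠ [] := by
        rintro rfl
        simp at h; linarith
      obtain ⟨e₀, he₀, hth⟩ := fill_threshold w (r := r - 1) l hne (by linarith) (by linarith) hl.2
      refine ⟨e₀, by simp [he₀], fun p hp => ?_⟩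
      rw [fill, List.mem_cons, min_eq_left h1.le] at hp
      rcases hp with rfl | hp
      · exact ⟨fun _ => rfl, fun h => absurd h (not_lt.2 (hl.1 _ he₀))⟩
      · exact hth p hp

theorem exists_sorted_list (A : Finset E) (w : E → ℝ) :
    ∃ l : List E, (l : Multiset E) = A.val ∧ l.Nodup ∧ l.Pairwise (fun a b => w a ≤ w b) := by
  classical
  have : Std.Total (fun a b : E => w a ≤ w b) := ⟨fun a b => le_total _ _⟩
  have : IsTrans E (fun a b : E => w a ≤ w b) := ⟨fun a b c => le_trans⟩
  refine ⟨A.toList.insertionSort (fun a b => w a ≤ w b), ?_, ?_, ?_⟩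
  · rw [← Finset.coe_toList A, Multiset.coe_eq_coe]
    exact List.perm_insertionSort _ _
  · exact (List.perm_insertionSort _ _).nodup_iff.2 A.nodup_toList
  · exact List.pairwise_insertionSort _ _

theorem SolvesSelection.cost_eq {A : Finset E} {β : ℝ} {w y y' : E → ℝ}
    (h : SolvesSelection A β w y) (h' : SolvesSelection A β w y') :
    ∑ e ∈ A, w e * y e = ∑ e ∈ A, w e * y' e :=
  le_antisymm (h.2 _ h'.1.1 h'.1.2) (h'.2 _ h.1.1 h.1.2)

theorem SolvesSelection.nonneg {A : Finset E} {β : ℝ} {w y : E → ℝ}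
    (h : SolvesSelection A β w y) : 0 ≤ β := by
  rw [← h.1.2]; exact Finset.sum_nonneg fun e he => (h.1.1 e he).1

theorem SolvesSelection.le_card {A : Finset E} {β : ℝ} {w y : E → ℝ}
    (h : SolvesSelection A β w y) : β ≤ A.card := by
  rw [← h.1.2]
  calc ∑ e ∈ A, y e ≤ ∑ e ∈ A, (1 : ℝ) := Finset.sum_le_sum fun e he => (h.1.1 e he).2
    _ = A.card := by simp

theorem map_eq_sort_le {l : List E} {A : Finset E} (hl : (l : Multiset E) = A.val) {w : E → ℝ}
    (hw : l.Pairwise (fun a b => w a ≤ w b)) :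
    (A.val.map w).sort (fun r s => r ≤ s) = l.map w := by
  refine List.Perm.eq_of_pairwise' (r := (· ≤ ·)) (Multiset.pairwise_sort _ _)
    (List.pairwise_map.2 hw) ?_
  rw [← Multiset.coe_eq_coe, Multiset.sort_eq, ← hl, Multiset.map_coe]

theorem map_eq_sort_ge {l : List E} {A : Finset E} (hl : (l : Multiset E) = A.val) {w : E → ℝ}
    (hw : l.Pairwise (fun a b => w b ≤ w a)) :
    (A.val.map w).sort (fun r s => s ≤ r) = l.map w := by
  refine List.Perm.eq_of_pairwise' (r := fun r s : ℝ => s ≤ r) (Multiset.pairwise_sort _ _)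
    (List.pairwise_map.2 hw) ?_
  rw [← Multiset.coe_eq_coe, Multiset.sort_eq, ← hl, Multiset.map_coe]

variable [DecidableEq E]

theorem toVec_of_mem {K : Type} [Zero K] : ∀ {l : List (E × K)}, (l.map Prod.fst).Nodup →
    ∀ p ∈ l, Prog.toVec l p.1 = p.2
  | [], _, p, hp => by simp at hp
  | (e, z) :: l, hl, p, hp => by
    rw [List.map_cons, List.nodup_cons] at hl
    rw [List.mem_cons] at hp
    rcases hp with rfl | hp
    · simp [Prog.toVec]
    · have hne : p.1 ≠ e := fun h =>
        hl.1 (List.mem_map.2 ⟨p, hp, h⟩)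
      have := toVec_of_mem hl.2 p hp
      rw [Prog.toVec, List.lookup_cons, beq_false_of_ne hne]
      exact this

theorem exists_mem_of_toVec {K : Type} [Zero K] {l : List (E × K)} (hl : (l.map Prod.fst).Nodup)
    {e : E} (he : e ∈ l.map Prod.fst) : (e, Prog.toVec l e) ∈ l := by
  obtain ⟨p, hp, rfl⟩ := List.mem_map.1 he
  rw [toVec_of_mem hl p hp]
  exact hp

theorem sum_toVec {l : List (E × ℝ)} (hl : (l.map Prod.fst).Nodup) (f : E → ℝ → ℝ) :
    ∑ e ∈ (l.map Prod.fst).toFinset, f e (Prog.toVec l e) = (l.map fun p => f p.1 p.2).sum := by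
  rw [List.sum_toFinset _ hl, List.map_map]
  congr 1
  refine List.map_congr_left fun p hp => ?_
  simp only [Function.comp]
  rw [toVec_of_mem hl p hp]

theorem toVec_fill_sum {l : List E} (hl : l.Nodup) {r : ℝ} (h0 : 0 ≤ r) (h : r ≤ l.length) :
    ∑ e ∈ l.toFinset, Prog.toVec (fill r l) e = r := by
  have := sum_toVec (l := fill r l) (by rwa [fill_fst]) (fun _ y => y)
  rw [fill_fst] at this
  rw [this]
  exact fill_sum l h0 h

theorem toVec_fill_cost {l : List E} (hl : l.Nodup) {r : ℝ} (h0 : 0 ≤ r) (c : E → ℝ) :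
    ∑ e ∈ l.toFinset, c e * Prog.toVec (fill r l) e = pieces (l.map c) r := by
  have := sum_toVec (l := fill r l) (by rwa [fill_fst]) (fun e y => c e * y)
  rw [fill_fst] at this
  rw [this]
  exact fill_cost c l h0

theorem mem_fill {l : List E} (hl : l.Nodup) (r : ℝ) {e : E} (he : e ∈ l) :
    (e, Prog.toVec (fill r l) e) ∈ fill r l :=
  exists_mem_of_toVec (by rwa [fill_fst]) (by rwa [fill_fst])

theorem toVec_fill_mem_Icc {l : List E} (hl : l.Nodup) {r : ℝ} (h0 : 0 ≤ r) :
    ∀ e ∈ l.toFinset, 0 ≤ Prog.toVec (fill r l) e ∧ Prog.toVec (fill r l) e ≤ 1 :=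
  fun _ he => fill_mem_Icc l h0 _ (mem_fill hl r (List.mem_toFinset.1 he))

theorem toVec_fill_fractional {l : List E} (hl : l.Nodup) {r : ℝ} (h0 : 0 ≤ r) :
    AtMostOneFractional l.toFinset (Prog.toVec (fill r l)) := fun _ he₁ _ he₂ =>
  fill_fractional l h0 _ (mem_fill hl r (List.mem_toFinset.1 he₁)) _
    (mem_fill hl r (List.mem_toFinset.1 he₂))

theorem toVec_fill_solves {l : List E} (hl : l.Nodup) {r : ℝ} (h0 : 0 ≤ r) (h : r ≤ l.length)
    {w : E → ℝ} (hw : l.Pairwise (fun a b => w a ≤ w b)) :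
    SolvesSelection l.toFinset r w (Prog.toVec (fill r l)) := by
  rcases eq_or_ne l [] with rfl | hne
  · exact solvesSelection_of_threshold 0 (toVec_fill_mem_Icc hl h0) (toVec_fill_sum hl h0 h)
      (by simp) (by simp)
  obtain ⟨e₀, -, hth⟩ := fill_threshold w l hne h0 h hw
  exact solvesSelection_of_threshold (w e₀) (toVec_fill_mem_Icc hl h0) (toVec_fill_sum hl h0 h)
    (fun e he => (hth _ (mem_fill hl r (List.mem_toFinset.1 he))).1)
    (fun e he => (hth _ (mem_fill hl r (List.mem_toFinset.1 he))).2)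

theorem toFinset_of_coe_eq {l : List E} {A : Finset E} (h : (l : Multiset E) = A.val) :
    l.toFinset = A := by
  ext e
  rw [List.mem_toFinset, ← Multiset.mem_coe, h, Finset.mem_val]

theorem exists_solvesSelection (A : Finset E) (w : E → ℝ) {β : ℝ} (h0 : 0 ≤ β)
    (h : β ≤ A.card) : ∃ y, SolvesSelection A β w y ∧ AtMostOneFractional A y := by
  obtain ⟨l, hl, hn, hw⟩ := exists_sorted_list A w
  have hA := toFinset_of_coe_eq hl
  have hc : A.card = l.length := by rw [Finset.card_def, ← hl, Multiset.coe_card]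
  rw [hc] at h
  have h1 := toVec_fill_solves hn h0 h hw
  have h2 := toVec_fill_fractional hn h0
  rw [hA] at h1 h2
  exact ⟨_, h1, h2⟩

/-- The greedy solution has a threshold, and any other solution agrees with it off the threshold by
`eq_of_threshold`. Thus the property carries over to every solution, not only to greedy ones. -/
theorem exists_threshold {A : Finset E} (hA : A.Nonempty) {β : ℝ} {w y : E → ℝ}
    (hy : SolvesSelection A β w y) :
    ∃ e₀ ∈ A, (∀ e ∈ A, w e < w e₀ → y e = 1) ∧ ∀ e ∈ A, w e₀ < w e → y e = 0 := by
  obtain ⟨l, hl, hn, hw⟩ := exists_sorted_list A w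
  have hA' := toFinset_of_coe_eq hl
  have hc : A.card = l.length := by rw [Finset.card_def, ← hl, Multiset.coe_card]
  have h0 : 0 ≤ β := by
    rw [← hy.1.2]; exact Finset.sum_nonneg fun e he => (hy.1.1 e he).1
  have h1 : β ≤ l.length := by
    rw [← hy.1.2, ← hc]
    calc ∑ e ∈ A, y e ≤ ∑ e ∈ A, (1 : ℝ) := Finset.sum_le_sum fun e he => (hy.1.1 e he).2
      _ = A.card := by simp
  have hne : l ≠ [] := by
    rintro rfl
    simp at hA'
    exact hA.ne_empty hA'.symm
  obtain ⟨e₀, he₀, hth⟩ := fill_threshold w l hne h0 h1 hw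
  have hsol := toVec_fill_solves hn h0 h1 hw
  rw [hA'] at hsol
  have hmem : ∀ e ∈ A, e ∈ l := fun e he => by rw [← hA'] at he; exact List.mem_toFinset.1 he
  have t1 : ∀ e ∈ A, w e < w e₀ → Prog.toVec (fill β l) e = 1 :=
    fun e he => (hth _ (mem_fill hn β (hmem e he))).1
  have t0 : ∀ e ∈ A, w e₀ < w e → Prog.toVec (fill β l) e = 0 :=
    fun e he => (hth _ (mem_fill hn β (hmem e he))).2
  have heq := eq_of_threshold (w e₀) (hy.1.2.trans hsol.1.2.symm) t1 t0 hy.1.1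
    (hy.2 _ hsol.1.1 hsol.1.2)
  refine ⟨e₀, by rw [← hA']; simpa using he₀, fun e he h => ?_, fun e he h => ?_⟩
  · rw [heq e he h.ne, t1 e he h]
  · rw [heq e he h.ne', t0 e he h]

theorem SolvesSelection.cost_eq_plf {A : Finset E} {β : ℝ} {w y : E → ℝ}
    (h : SolvesSelection A β w y) : ∑ e ∈ A, w e * y e = plf A w β := by
  obtain ⟨l, hl, hn, hw⟩ := exists_sorted_list A w
  have hA := toFinset_of_coe_eq hl
  have hc : A.card = l.length := by rw [Finset.card_def, ← hl, Multiset.coe_card]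
  have hsol := toVec_fill_solves hn h.nonneg (hc ▸ h.le_card) hw
  have hcost := toVec_fill_cost hn h.nonneg w
  rw [hA] at hsol hcost
  rw [h.cost_eq hsol, hcost, plf, map_eq_sort_le hl hw]

theorem SolvesSelection.cost_eq_pieces_ge {A : Finset E} {β : ℝ} {w y : E → ℝ}
    (h : SolvesSelection A β (fun e => -w e) y) :
    ∑ e ∈ A, w e * y e = pieces ((A.val.map w).sort (fun r s => s ≤ r)) β := by
  obtain ⟨l, hl, hn, hw⟩ := exists_sorted_list A (fun e => -w e)
  have hA := toFinset_of_coe_eq hl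
  have hc : A.card = l.length := by rw [Finset.card_def, ← hl, Multiset.coe_card]
  have hsol := toVec_fill_solves hn h.nonneg (hc ▸ h.le_card) hw
  have hcost := toVec_fill_cost hn h.nonneg w
  rw [hA] at hsol hcost
  have := h.cost_eq hsol
  simp only [neg_mul, Finset.sum_neg_distrib, neg_inj] at this
  rw [this, hcost, map_eq_sort_ge hl]
  exact hw.imp fun {a b} (h : -w a ≤ -w b) => neg_le_neg_iff.1 h

end Selection

end RCBSP

namespace RCBSP

namespace Inst

/-! ### The adversary's problem: heads, forcing scenarios, worst-case values. -/

section Problem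

variable {E : Type} [DecidableEq E] {I : Inst E ℝ}

theorem mem_pred {h e : E} : e ∈ I.pred h ↔ e ∈ I.Ef ∧ I.hi e < I.lo h := by
  simp [pred]

theorem mem_inc {h e : E} : e ∈ I.inc h ↔ e ∈ I.Ef ∧ I.lo e ≤ I.lo h ∧ I.lo h ≤ I.hi e := by
  simp [inc]

theorem disjoint_pred_inc (h : E) : Disjoint (I.pred h) (I.inc h) := by
  rw [Finset.disjoint_left]
  intro e h1 h2
  exact absurd (mem_pred.1 h1).2 (not_lt.2 (mem_inc.1 h2).2.2)

theorem pred_union_inc_subset (h : E) : I.pred h ∪ I.inc h ⊆ I.Ef :=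
  Finset.union_subset (Finset.filter_subset _ _) (Finset.filter_subset _ _)

theorem Valid.mem_pred_union_inc (hV : I.Valid) {h e : E} :
    e ∈ I.pred h ∪ I.inc h ↔ e ∈ I.Ef ∧ I.lo e ≤ I.lo h := by
  rw [Finset.mem_union, mem_pred, mem_inc]
  constructor
  · rintro (⟨h1, h2⟩ | ⟨h1, h2, -⟩)
    · exact ⟨h1, (hV.lo_le_hi e h1).trans h2.le⟩
    · exact ⟨h1, h2⟩
  · rintro ⟨h1, h2⟩
    rcases lt_or_ge (I.hi e) (I.lo h) with h3 | h3
    · exact Or.inl ⟨h1, h3⟩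
    · exact Or.inr ⟨h1, h2, h3⟩

theorem Valid.mem_rest (hV : I.Valid) {h e : E} :
    e ∈ I.Ef \ (I.pred h ∪ I.inc h) ↔ e ∈ I.Ef ∧ I.lo h < I.lo e := by
  rw [Finset.mem_sdiff, hV.mem_pred_union_inc]
  constructor
  · rintro ⟨h1, h2⟩
    exact ⟨h1, not_le.1 fun h3 => h2 ⟨h1, h3⟩⟩
  · rintro ⟨h1, h2⟩
    exact ⟨h1, fun h3 => absurd h3.2 (not_le.2 h2)⟩

theorem sum_split (h : E) (f : E → ℝ) :
    ∑ e ∈ I.Ef, f e =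
      ∑ e ∈ I.pred h, f e + ∑ e ∈ I.inc h, f e + ∑ e ∈ I.Ef \ (I.pred h ∪ I.inc h), f e := by
  rw [← Finset.sum_union (disjoint_pred_inc h), add_comm,
    Finset.sum_sdiff (pred_union_inc_subset h)]

theorem Valid.followerFeasible_iff (hV : I.Valid) {x y : E → ℝ} :
    I.FollowerFeasible x y ↔
      (∀ e ∈ I.Ef, 0 ≤ y e ∧ y e ≤ 1) ∧ ∑ e ∈ I.Ef, y e = I.b - ∑ e ∈ I.El, x e := by
  unfold FollowerFeasible
  rw [Finset.disjoint_iff_inter_eq_empty.1 hV.disjoint]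
  constructor
  · rintro ⟨-, h1, h2⟩
    exact ⟨h2, by linarith⟩
  · rintro ⟨h1, h2⟩
    exact ⟨by simp, by linarith, h1⟩

theorem Valid.followerOptimal_iff (hV : I.Valid) {x d y : E → ℝ} :
    I.FollowerOptimal x d y ↔ SolvesSelection I.Ef (I.b - ∑ e ∈ I.El, x e) d y := by
  unfold FollowerOptimal SolvesSelection
  simp only [hV.followerFeasible_iff, and_imp]

theorem Valid.leaderFeasible_iff (hV : I.Valid) {x : E → ℝ} :
    I.LeaderFeasible x ↔ (∀ e ∈ I.El, 0 ≤ x e ∧ x e ≤ 1) ∧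
      0 ≤ I.b - ∑ e ∈ I.El, x e ∧ I.b - ∑ e ∈ I.El, x e ≤ I.Ef.card := by
  unfold LeaderFeasible
  simp only [hV.followerFeasible_iff]
  refine and_congr_right fun _ => ⟨?_, ?_⟩
  · rintro ⟨y, h1, h2⟩
    rw [← h2]
    refine ⟨Finset.sum_nonneg fun e he => (h1 e he).1, ?_⟩
    calc ∑ e ∈ I.Ef, y e ≤ ∑ e ∈ I.Ef, (1 : ℝ) := Finset.sum_le_sum fun e he => (h1 e he).2
      _ = I.Ef.card := by simp
  · rintro ⟨h1, h2⟩
    obtain ⟨y, hy, -⟩ := exists_solvesSelection I.Ef (fun _ => 0) h1 h2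
    exact ⟨y, hy.1⟩

theorem mem_adversaryHeads {β : ℝ} {h : E} :
    h ∈ I.adversaryHeads β ↔ h ∈ I.Ef ∧ ((I.pred h).card : ℝ) ≤ β ∧
      β - (I.pred h).card ≤ ((I.inc h).card : ℝ) := by
  simp [adversaryHeads]

theorem exists_headSelection {β : ℝ} {h : E} (hh : h ∈ I.adversaryHeads β) :
    ∃ y, I.HeadSelection β h y := by
  obtain ⟨-, h1, h2⟩ := mem_adversaryHeads.1 hh
  obtain ⟨z, hz, hz'⟩ := exists_solvesSelection (I.inc h) (fun e => -I.c e) (sub_nonneg.2 h1) h2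
  have hne : ∀ e ∈ I.inc h, e ∉ I.pred h := fun e h3 h4 =>
    Finset.disjoint_left.1 (disjoint_pred_inc h) h4 h3
  let y : E → ℝ := fun e => if e ∈ I.pred h then 1 else if e ∈ I.inc h then z e else 0
  have hy : ∀ e ∈ I.inc h, y e = z e := fun e he => by
    simp [y, hne e he, he]
  refine ⟨y, fun e he => if_pos he, ⟨⟨⟨fun e he => ?_, ?_⟩, fun y' h3 h4 => ?_⟩, ?_⟩, fun e he => ?_⟩
  · rw [hy e he]; exact hz.1.1 e he
  · rw [Finset.sum_congr rfl hy]; exact hz.1.2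
  · rw [Finset.sum_congr rfl fun e he => by rw [hy e he]]
    exact hz.2 y' h3 h4
  · intro e₁ he₁ e₂ he₂
    rw [hy e₁ he₁, hy e₂ he₂]
    exact hz' e₁ he₁ e₂ he₂
  · rw [Finset.mem_sdiff, Finset.mem_union, not_or] at he
    simp [y, he.2.1, he.2.2]

theorem headFun_eq (h : E) (β : ℝ) {y : E → ℝ}
    (hy : SolvesSelection (I.inc h) (β - (I.pred h).card) (fun e => -I.c e) y) :
    I.headFun h (I.b - β) = ∑ e ∈ I.inc h, I.c e * y e + ∑ e ∈ I.pred h, I.c e := by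
  rw [headFun, plfBar, hy.cost_eq_pieces_ge]
  congr 2
  ring

theorem HeadSelection.sum_mul {β : ℝ} {h : E} {y : E → ℝ} (hy : I.HeadSelection β h y)
    (f : E → ℝ) :
    ∑ e ∈ I.Ef, f e * y e = ∑ e ∈ I.inc h, f e * y e + ∑ e ∈ I.pred h, f e := by
  rw [sum_split h, Finset.sum_eq_zero (s := I.Ef \ _) fun e he => by rw [hy.2.2 e he, mul_zero],
    Finset.sum_congr (s₁ := I.pred h) rfl fun e he => by rw [hy.1 e he, mul_one]]
  ring

theorem HeadSelection.followerPart_eq {β : ℝ} {h : E} {y : E → ℝ} (hy : I.HeadSelection β h y) :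
    I.followerPart y = I.headFun h (I.b - β) := by
  rw [headFun_eq h β hy.2.1.1, followerPart, hy.sum_mul]

theorem HeadSelection.sum_eq {β : ℝ} {h : E} {y : E → ℝ} (hy : I.HeadSelection β h y) :
    ∑ e ∈ I.Ef, y e = β := by
  have := hy.sum_mul fun _ => 1
  simp only [one_mul] at this
  rw [this, hy.2.1.1.1.2]
  simp

theorem HeadSelection.mem_Icc {β : ℝ} {h : E} {y : E → ℝ} (hy : I.HeadSelection β h y) :
    ∀ e ∈ I.Ef, 0 ≤ y e ∧ y e ≤ 1 := by
  intro e he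
  by_cases h1 : e ∈ I.pred h
  · rw [hy.1 e h1]; norm_num
  by_cases h2 : e ∈ I.inc h
  · exact hy.2.1.1.1.1 e h2
  · rw [hy.2.2 e (by simp [he, h1, h2])]; norm_num

/-- A follower's selection that respects the head `h` is at most as expensive as the selection
computed for `h`. -/
theorem followerPart_le_headFun {β : ℝ} {h : E} {y : E → ℝ} (hh : h ∈ I.Ef)
    (h01 : ∀ e ∈ I.Ef, 0 ≤ y e ∧ y e ≤ 1) (hs : ∑ e ∈ I.Ef, y e = β)
    (h1 : ∀ e ∈ I.pred h, y e = 1) (h0 : ∀ e ∈ I.Ef \ (I.pred h ∪ I.inc h), y e = 0) :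
    h ∈ I.adversaryHeads β ∧ I.followerPart y ≤ I.headFun h (I.b - β) := by
  have hinc : ∀ e ∈ I.inc h, 0 ≤ y e ∧ y e ≤ 1 := fun e he => h01 e (mem_inc.1 he).1
  have hsum : ∑ e ∈ I.inc h, y e = β - (I.pred h).card := by
    rw [sum_split h, Finset.sum_eq_zero h0, Finset.sum_congr (s₁ := I.pred h) rfl h1] at hs
    simp at hs
    linarith
  have h2 : 0 ≤ β - (I.pred h).card := by
    rw [← hsum]; exact Finset.sum_nonneg fun e he => (hinc e he).1
  have h3 : β - (I.pred h).card ≤ (I.inc h).card := by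
    rw [← hsum]
    calc ∑ e ∈ I.inc h, y e ≤ ∑ e ∈ I.inc h, (1 : ℝ) :=
          Finset.sum_le_sum fun e he => (hinc e he).2
      _ = (I.inc h).card := by simp
  refine ⟨mem_adversaryHeads.2 ⟨hh, by linarith, h3⟩, ?_⟩
  -- The value of the head function is the value of any optimal selection `z` on `inc h`, and `y`
  -- restricted to `inc h` competes with `z`.
  obtain ⟨z, hz, -⟩ := exists_solvesSelection (I.inc h) (fun e => -I.c e) h2 h3
  rw [headFun_eq h β hz, followerPart, sum_split h,
    Finset.sum_eq_zero (s := I.Ef \ _) fun e he => by rw [h0 e he, mul_zero],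
    Finset.sum_congr (s₁ := I.pred h) rfl fun e he => by rw [h1 e he, mul_one]]
  have := hz.2 y hinc hsum
  simp only [neg_mul, Finset.sum_neg_distrib, neg_le_neg_iff] at this
  linarith

theorem exists_head {a : ℝ} (ha : ∃ e ∈ I.Ef, I.lo e ≤ a) :
    ∃ h ∈ I.Ef, I.lo h ≤ a ∧ ∀ e ∈ I.Ef, I.lo e ≤ a → I.lo e ≤ I.lo h := by
  classical
  obtain ⟨e, he, hea⟩ := ha
  obtain ⟨h, hh, hmax⟩ := Finset.exists_max_image (I.Ef.filter fun e => I.lo e ≤ a) I.lo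
    ⟨e, by simp [he, hea]⟩
  rw [Finset.mem_filter] at hh
  exact ⟨h, hh.1, hh.2, fun e h1 h2 => hmax e (by simp [h1, h2])⟩

/-- The head has the largest left endpoint not exceeding the follower's threshold `d e₀`. Then `hi e
< lo h` forces `d e < d e₀`, and `lo e > lo h` forces `d e > d e₀`, whatever the scenario is. -/
theorem Valid.exists_head_of_solves (hV : I.Valid) {β : ℝ} {d y : E → ℝ}
    (hd : d ∈ I.uncertaintySet) (hy : SolvesSelection I.Ef β d y) :
    ∃ h ∈ I.adversaryHeads β, I.followerPart y ≤ I.headFun h (I.b - β) := by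
  obtain ⟨e₀, he₀, h1, h0⟩ := exists_threshold hV.follower_nonempty hy
  obtain ⟨h, hh, hle, hmax⟩ := exists_head ⟨e₀, he₀, (hd e₀ he₀).1⟩
  refine ⟨h, followerPart_le_headFun hh hy.1.1 hy.1.2 (fun e he => ?_) (fun e he => ?_)⟩
  · rw [mem_pred] at he
    exact h1 e he.1 (by linarith [(hd e he.1).2])
  · rw [hV.mem_rest] at he
    refine h0 e he.1 (lt_of_lt_of_le ?_ (hd e he.1).1)
    by_contra h2
    exact absurd (hmax e he.1 (not_lt.1 h2)) (not_le.2 he.2)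

theorem Valid.adversaryHeads_nonempty (hV : I.Valid) {β : ℝ} (h0 : 0 ≤ β) (h1 : β ≤ I.Ef.card) :
    (I.adversaryHeads β).Nonempty := by
  obtain ⟨y, hy, -⟩ := exists_solvesSelection I.Ef I.lo h0 h1
  obtain ⟨h, hh, -⟩ := hV.exists_head_of_solves (d := I.lo)
    (fun e he => ⟨le_rfl, hV.lo_le_hi e he⟩) hy
  exact ⟨h, hh⟩

/-- The scenario built from a selection of the head `h`. -/
def IsScenario (I : Inst E ℝ) (h : E) (y d : E → ℝ) : Prop :=
  ∃ m ε : ℝ, IsLeast {r | ∃ e ∈ I.Ef \ I.pred h, r = I.hi e - I.lo h} m ∧ ε = 1 / 2 * m ∧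
    ∀ e ∈ I.Ef, (y e = 1 → d e = I.lo e) ∧ (y e = 0 → d e = I.hi e) ∧
      (0 < y e → y e < 1 → d e = I.lo h + ε)

/-- The scenario built from the selection of the head `h` forces the follower to choose this
selection. -/
theorem Valid.scenario_forces (hV : I.Valid) {β : ℝ} {h : E} (hh : h ∈ I.Ef) {y d : E → ℝ}
    (hy : I.HeadSelection β h y) (hd : I.IsScenario h y d) :
    d ∈ I.uncertaintySet ∧ SolvesSelection I.Ef β d y ∧
      ∀ y', SolvesSelection I.Ef β d y' → ∀ e ∈ I.Ef, y' e = y e := by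
  obtain ⟨m, ε, ⟨hm, hmin⟩, hε, hd⟩ := hd
  have hgap : ∀ e ∈ I.Ef, e ∉ I.pred h → I.lo h + m ≤ I.hi e := by
    intro e he hn
    have := hmin ⟨e, by simp [he, hn], rfl⟩
    linarith
  -- The absence of one-point intersections enters here: an item outside `pred h` has `lo h ≤ hi e`,
  -- and equality is excluded.
  have hm0 : 0 < m := by
    obtain ⟨e, he, rfl⟩ := hm
    rw [Finset.mem_sdiff, mem_pred, not_and, not_lt] at he
    rw [sub_pos]
    exact lt_of_le_of_ne (he.2 he.1) (hV.no_one_point h hh e he.1)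
  have h01 := hy.mem_Icc
  have hfrac : ∀ e ∈ I.Ef, 0 < y e → y e < 1 → e ∈ I.inc h := by
    intro e he h0 h1
    by_contra h2
    by_cases h3 : e ∈ I.pred h
    · exact h1.ne (hy.1 e h3)
    · exact h0.ne' (hy.2.2 e (by simp [he, h2, h3]))
  -- Full items sit at a left endpoint, which is at most `lo h`. Empty items sit at a right
  -- endpoint, which is at least `lo h + m = lo h + 2 * ε`. The threshold `lo h + ε` separates them
  -- strictly.
  have hone : ∀ e ∈ I.Ef, y e = 1 → d e < I.lo h + ε := by
    intro e he h1
    rw [(hd e he).1 h1]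
    have : e ∈ I.pred h ∪ I.inc h := by
      by_contra h2
      rw [hy.2.2 e (by simp only [Finset.mem_sdiff]; exact ⟨he, h2⟩)] at h1
      exact zero_ne_one h1
    have := (hV.mem_pred_union_inc.1 this).2
    linarith
  have hzero : ∀ e ∈ I.Ef, y e = 0 → I.lo h + ε < d e := by
    intro e he h0
    rw [(hd e he).2.1 h0]
    have := hgap e he fun h2 => by rw [hy.1 e h2] at h0; exact one_ne_zero h0
    linarith
  have hcase : ∀ e ∈ I.Ef, y e = 1 ∨ y e = 0 ∨ (0 < y e ∧ y e < 1) := by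
    intro e he
    rcases (h01 e he).1.eq_or_lt with h1 | h1
    · exact Or.inr (Or.inl h1.symm)
    rcases (h01 e he).2.eq_or_lt with h2 | h2
    · exact Or.inl h2
    · exact Or.inr (Or.inr ⟨h1, h2⟩)
  have t1 : ∀ e ∈ I.Ef, d e < I.lo h + ε → y e = 1 := by
    intro e he h1
    rcases hcase e he with h2 | h2 | h2
    · exact h2
    · exact absurd h1 (hzero e he h2).not_gt
    · rw [(hd e he).2.2 h2.1 h2.2] at h1
      exact absurd h1 (lt_irrefl _)
  have t0 : ∀ e ∈ I.Ef, I.lo h + ε < d e → y e = 0 := by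
    intro e he h1
    rcases hcase e he with h2 | h2 | h2
    · exact absurd h1 (hone e he h2).not_gt
    · exact h2
    · rw [(hd e he).2.2 h2.1 h2.2] at h1
      exact absurd h1 (lt_irrefl _)
  have hsol := solvesSelection_of_threshold (I.lo h + ε) h01 hy.sum_eq t1 t0
  refine ⟨fun e he => ?_, hsol, fun y' hy' => ?_⟩
  · rcases hcase e he with h2 | h2 | h2
    · rw [(hd e he).1 h2]; exact ⟨le_rfl, hV.lo_le_hi e he⟩
    · rw [(hd e he).2.1 h2]; exact ⟨hV.lo_le_hi e he, le_rfl⟩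
    · rw [(hd e he).2.2 h2.1 h2.2]
      have h3 := hfrac e he h2.1 h2.2
      have h4 := hgap e he fun h5 => Finset.disjoint_left.1 (disjoint_pred_inc h) h5 h3
      have h5 := (mem_inc.1 h3).2.1
      constructor <;> linarith
  -- Uniqueness: a second solution can differ from `y` only on items of cost exactly `lo h + ε`,
  -- that is, on fractional items. There is at most one of them, and its value is then determined by
  -- the total size.
  · have hoff := eq_of_threshold (I.lo h + ε) (hy'.1.2.trans hy.sum_eq.symm) t1 t0 hy'.1.1
      (hy'.2 y h01 hy.sum_eq)
    have hoff' : ∀ e ∈ I.Ef, ¬(0 < y e ∧ y e < 1) → y' e = y e := by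
      intro e he hne
      refine hoff e he ?_
      rcases hcase e he with h2 | h2 | h2
      · exact (hone e he h2).ne
      · exact (hzero e he h2).ne'
      · exact absurd h2 hne
    intro e he
    by_cases hfe : 0 < y e ∧ y e < 1
    · have hsum : ∑ e' ∈ I.Ef, (y' e' - y e') = 0 := by
        rw [Finset.sum_sub_distrib, hy'.1.2, hy.sum_eq, sub_self]
      rw [Finset.sum_eq_single e] at hsum
      · linarith
      · intro e' he' hne
        rw [hoff' e' he', sub_self]
        intro hf'
        exact hne (hy.2.1.2 e' (hfrac e' he' hf'.1 hf'.2) e (hfrac e he hfe.1 hfe.2)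
          hf'.1 hf'.2 hfe.1 hfe.2)
      · exact fun h => absurd he h
    · exact hoff' e he hfe

theorem followerPart_congr {y y' : E → ℝ} (h : ∀ e ∈ I.Ef, y' e = y e) :
    I.followerPart y' = I.followerPart y :=
  Finset.sum_congr rfl fun e he => by rw [h e he]

/-- With a unique optimal solution the follower's tie-breaking is vacuous, so both settings are
treated alike. -/
theorem Valid.scenario_response (hV : I.Valid) (s : Setting) {x : E → ℝ} {h : E} (hh : h ∈ I.Ef)
    {y d : E → ℝ} (hy : I.HeadSelection (I.b - ∑ e ∈ I.El, x e) h y) (hd : I.IsScenario h y d) :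
    d ∈ I.uncertaintySet ∧ I.Response s x d y := by
  obtain ⟨h1, h2, h3⟩ := hV.scenario_forces hh hy hd
  refine ⟨h1, hV.followerOptimal_iff.2 h2, ?_⟩
  have h4 : ∀ y', I.FollowerOptimal x d y' → I.followerPart y' = I.followerPart y :=
    fun y' hy' => followerPart_congr (h3 y' (hV.followerOptimal_iff.1 hy'))
  cases s
  · exact fun y' hy' => (h4 y' hy').ge
  · exact fun y' hy' => (h4 y' hy').le

theorem exists_isScenario {h : E} (hh : h ∈ I.Ef) (hhi : I.lo h ≤ I.hi h) (y : E → ℝ) :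
    ∃ d, I.IsScenario h y d := by
  classical
  have hne : (I.Ef \ I.pred h).Nonempty :=
    ⟨h, Finset.mem_sdiff.2 ⟨hh, fun h1 => absurd (mem_pred.1 h1).2 (not_lt.2 hhi)⟩⟩
  obtain ⟨e, he, hmin⟩ := Finset.exists_min_image (I.Ef \ I.pred h) (fun e => I.hi e - I.lo h) hne
  refine ⟨fun e' => if y e' = 1 then I.lo e' else if y e' = 0 then I.hi e' else
    I.lo h + 1 / 2 * (I.hi e - I.lo h), _, _, ⟨⟨e, he, rfl⟩, ?_⟩, rfl, fun e' _ => ⟨?_, ?_, ?_⟩⟩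
  · rintro r ⟨e', he', rfl⟩
    exact hmin e' he'
  · intro h1; simp [h1]
  · intro h1; simp [h1]
  · intro h1 h2; simp [h1.ne', h2.ne]

/-! ### The leader's objective function -/

theorem Valid.mem_Icc_iff {t : ℝ} :
    t ∈ Set.Icc I.blMin I.blMax ↔ (0 ≤ t ∧ t ≤ I.El.card) ∧ 0 ≤ I.b - t ∧ I.b - t ≤ I.Ef.card := by
  rw [Set.mem_Icc, blMin, blMax, max_le_iff, le_min_iff]
  constructor
  · rintro ⟨⟨h1, h2⟩, h3, h4⟩
    exact ⟨⟨h1, h4⟩, by linarith, by linarith⟩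
  · rintro ⟨⟨h1, h4⟩, h2, h3⟩
    exact ⟨⟨h1, by linarith⟩, by linarith, h4⟩

/-- For admissible `t` the capacity `b - t` lies between `bfMin` and `bfMax`. The leader's coarser
test together with membership in the domain therefore amounts to the adversary's test at this
capacity. -/
theorem mem_leaderHeads_iff {t : ℝ} (ht : t ∈ Set.Icc I.blMin I.blMax) {h : E} :
    h ∈ I.leaderHeads ∧ t ∈ I.headDomain h ↔ h ∈ I.adversaryHeads (I.b - t) := by
  rw [mem_adversaryHeads, leaderHeads, Finset.mem_filter, headDomain, Set.mem_ofPred_eq,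
    Set.mem_Icc, capMin, capMax, bfMax, bfMin]
  obtain ⟨h1, h2⟩ := ht
  constructor
  · rintro ⟨⟨hh, -, -⟩, h3, h4⟩
    have h5 := min_le_right (I.b - I.blMin - (I.pred h).card) ((I.inc h).card : ℝ)
    have h6 := le_max_left 0 (I.b - I.blMax - (I.pred h).card)
    exact ⟨hh, by linarith, by linarith⟩
  · rintro ⟨hh, h3, h4⟩
    refine ⟨⟨hh, by linarith, by linarith⟩, ?_, ?_⟩
    · have : I.b - t - (I.pred h).card ≤
          min (I.b - I.blMin - (I.pred h).card) ((I.inc h).card : ℝ) :=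
        le_min (by linarith) h4
      linarith
    · have : max 0 (I.b - I.blMax - (I.pred h).card) ≤ I.b - t - (I.pred h).card :=
        max_le (by linarith) (by linarith)
      linarith

theorem headValues_eq {t : ℝ} (ht : t ∈ Set.Icc I.blMin I.blMax) :
    I.headValues t = {v | ∃ h ∈ I.adversaryHeads (I.b - t), v = I.headFun h t} := by
  ext v
  simp only [headValues, Set.mem_ofPred_eq, ← mem_leaderHeads_iff ht, and_assoc]

/-- The supremum is over a finite nonempty set; nonempty because the response to the scenario `lo`,
say, respects some head. -/
theorem Valid.isGreatest_gf (hV : I.Valid) {t : ℝ} (ht : t ∈ Set.Icc I.blMin I.blMax) :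
    IsGreatest (I.headValues t) (I.gf t) := by
  have hne : (I.headValues t).Nonempty := by
    obtain ⟨-, h0, h1⟩ := Valid.mem_Icc_iff.1 ht
    obtain ⟨h, hh⟩ := hV.adversaryHeads_nonempty h0 h1
    rw [headValues_eq ht]
    exact ⟨_, h, hh, rfl⟩
  have hfin : (I.headValues t).Finite := by
    refine (I.leaderHeads.finite_toSet.image fun h => I.headFun h t).subset ?_
    rintro v ⟨h, hh, -, rfl⟩
    exact ⟨h, hh, rfl⟩
  exact ⟨hne.csSup_mem hfin, fun v hv => le_csSup hfin.bddAbove hv⟩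

theorem Valid.sum_mem_Icc (hV : I.Valid) {x : E → ℝ} (hx : I.LeaderFeasible x) :
    ∑ e ∈ I.El, x e ∈ Set.Icc I.blMin I.blMax := by
  obtain ⟨h1, h2⟩ := hV.leaderFeasible_iff.1 hx
  refine Valid.mem_Icc_iff.2 ⟨⟨Finset.sum_nonneg fun e he => (h1 e he).1, ?_⟩, h2⟩
  calc ∑ e ∈ I.El, x e ≤ ∑ e ∈ I.El, (1 : ℝ) := Finset.sum_le_sum fun e he => (h1 e he).2
    _ = I.El.card := by simp

theorem Valid.followerPart_le_gf (hV : I.Valid) {x : E → ℝ} (hx : I.LeaderFeasible x)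
    {d y : E → ℝ} (hd : d ∈ I.uncertaintySet) (hy : I.FollowerOptimal x d y) :
    I.followerPart y ≤ I.gf (∑ e ∈ I.El, x e) := by
  obtain ⟨h, hh, hle⟩ := hV.exists_head_of_solves hd (hV.followerOptimal_iff.1 hy)
  have ht := hV.sum_mem_Icc hx
  rw [sub_sub_cancel] at hle
  refine hle.trans ((hV.isGreatest_gf ht).2 ?_)
  rw [headValues_eq ht]
  exact ⟨h, hh, rfl⟩

/-- The supremum is attained: a maximizing head is turned into a scenario that forces its selection,
and no response in any scenario exceeds `gf`. -/
theorem Valid.worstCost_eq (hV : I.Valid) (s : Setting) {x : E → ℝ} (hx : I.LeaderFeasible x) :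
    I.worstCost s x = ∑ e ∈ I.El, I.c e * x e + I.gf (∑ e ∈ I.El, x e) := by
  refine IsGreatest.csSup_eq ⟨?_, ?_⟩
  · have ht := hV.sum_mem_Icc hx
    have h1 := (hV.isGreatest_gf ht).1
    rw [headValues_eq ht] at h1
    obtain ⟨h, hh, hv⟩ := h1
    obtain ⟨y, hy⟩ := exists_headSelection hh
    have hhf := (mem_adversaryHeads.1 hh).1
    obtain ⟨d, hd⟩ := exists_isScenario hhf (hV.lo_le_hi h hhf) y
    obtain ⟨h2, h3⟩ := hV.scenario_response s hhf hy hd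
    refine ⟨d, h2, y, h3, ?_⟩
    rw [leaderCost, hv, hy.followerPart_eq, sub_sub_cancel]
  · rintro v ⟨d, hd, y, hy, rfl⟩
    rw [leaderCost]
    have := hV.followerPart_le_gf hx hd hy.1
    linarith

theorem gl_le {x : E → ℝ} (hx : ∀ e ∈ I.El, 0 ≤ x e ∧ x e ≤ 1) :
    I.gl (∑ e ∈ I.El, x e) ≤ ∑ e ∈ I.El, I.c e * x e := by
  obtain ⟨z, hz, -⟩ := exists_solvesSelection I.El I.c
    (Finset.sum_nonneg fun e he => (hx e he).1)
    (calc ∑ e ∈ I.El, x e ≤ ∑ e ∈ I.El, (1 : ℝ) := Finset.sum_le_sum fun e he => (hx e he).2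
      _ = I.El.card := by simp)
  rw [gl, ← hz.cost_eq_plf]
  exact hz.2 x hx rfl

theorem Valid.leaderFeasible_of_solves (hV : I.Valid) {x : E → ℝ} {t : ℝ}
    (ht : t ∈ Set.Icc I.blMin I.blMax) (hx : SolvesSelection I.El t I.c x) :
    I.LeaderFeasible x := by
  rw [hV.leaderFeasible_iff, hx.1.2]
  exact ⟨hx.1.1, (Valid.mem_Icc_iff.1 ht).2⟩

theorem Valid.worstCost_of_solves (hV : I.Valid) (s : Setting) {x : E → ℝ} {t : ℝ}
    (ht : t ∈ Set.Icc I.blMin I.blMax) (hx : SolvesSelection I.El t I.c x) :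
    I.worstCost s x = I.g t := by
  rw [hV.worstCost_eq s (hV.leaderFeasible_of_solves ht hx), hx.1.2, hx.cost_eq_plf]
  rfl

theorem Valid.g_le_worstCost (hV : I.Valid) (s : Setting) {x : E → ℝ} (hx : I.LeaderFeasible x) :
    I.g (∑ e ∈ I.El, x e) ≤ I.worstCost s x := by
  rw [hV.worstCost_eq s hx, g]
  have := gl_le hx.1
  linarith

theorem Valid.isLeast_g (hV : I.Valid) (s : Setting) {t : ℝ} (ht : t ∈ Set.Icc I.blMin I.blMax) :
    IsLeast {v | ∃ x : E → ℝ, I.LeaderFeasible x ∧ ∑ e ∈ I.El, x e = t ∧ v = I.worstCost s x}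
      (I.gl t + I.gf t) := by
  constructor
  · obtain ⟨h0, h1⟩ := (Valid.mem_Icc_iff.1 ht).1
    obtain ⟨x, hx, -⟩ := exists_solvesSelection I.El I.c h0 h1
    exact ⟨x, hV.leaderFeasible_of_solves ht hx, hx.1.2, (hV.worstCost_of_solves s ht hx).symm⟩
  · rintro v ⟨x, hx, rfl, rfl⟩
    exact hV.g_le_worstCost s hx

theorem Valid.optimalLeader (hV : I.Valid) (s : Setting) {x : E → ℝ} (hx : I.LeaderAlgorithm x) :
    I.OptimalLeader s x := by
  obtain ⟨t, ht, hmin, hsol⟩ := hx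
  refine ⟨hV.leaderFeasible_of_solves ht hsol, fun x' hx' => ?_⟩
  rw [hV.worstCost_of_solves s ht hsol]
  exact (hmin _ (hV.sum_mem_Icc hx')).trans (hV.g_le_worstCost s hx')

theorem Valid.optimalAdversary (hV : I.Valid) (s : Setting) {x d : E → ℝ}
    (hd : I.AdversaryAlgorithm x d) : I.OptimalAdversary s x d := by
  obtain ⟨β, rfl, y, hy, h, hh, hmax, hsc⟩ := hd
  have hhf := (mem_adversaryHeads.1 hh).1
  obtain ⟨h1, h2⟩ := hV.scenario_response s hhf (hy h hh) hsc
  refine ⟨h1, y h, h2, fun d' hd' y' hy' => ?_⟩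
  rw [leaderCost, leaderCost]
  obtain ⟨h', hh', hle⟩ := hV.exists_head_of_solves hd' (hV.followerOptimal_iff.1 hy'.1)
  have := hmax h' hh'
  rw [(hy h' hh').followerPart_eq] at this
  linarith

theorem AdversaryAlgorithm.mem_range_ratCast
    (hq : ∀ e ∈ I.Ef, I.lo e ∈ Set.range ((↑) : ℚ → ℝ) ∧ I.hi e ∈ Set.range ((↑) : ℚ → ℝ))
    {x d : E → ℝ} (hd : I.AdversaryAlgorithm x d) :
    ∀ e ∈ I.Ef, d e ∈ Set.range ((↑) : ℚ → ℝ) := by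
  obtain ⟨β, rfl, y, hy, h, hh, -, m, ε, ⟨⟨e', he', rfl⟩, -⟩, rfl, hd⟩ := hd
  intro e he
  have h01 := (hy h hh).mem_Icc e he
  rcases h01.1.eq_or_lt with h0 | h0
  · rw [(hd e he).2.1 h0.symm]; exact (hq e he).2
  rcases h01.2.eq_or_lt with h1 | h1
  · rw [(hd e he).1 h1]; exact (hq e he).1
  rw [(hd e he).2.2 h0 h1]
  obtain ⟨q, hq1⟩ := (hq h (mem_adversaryHeads.1 hh).1).1
  obtain ⟨r, hr⟩ := (hq e' (Finset.mem_sdiff.1 he').1).2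
  exact ⟨q + 1 / 2 * (r - q), by push_cast [hq1, hr]; ring⟩

end Problem

end Inst

end RCBSP

namespace RCBSP

namespace Prog

/-! ### Values and step counts of the list and number programs. -/

section Basic

variable {α β : Type}

@[simp] theorem bind_val (m : Timed α) (f : α → Timed β) : (m >>= f).val = (f m.val).val := rfl

@[simp] theorem bind_steps (m : Timed α) (f : α → Timed β) :
    (m >>= f).steps = m.steps + (f m.val).steps := rfl

@[simp] theorem pure_val (a : α) : (pure a : Timed α).val = a := rfl

@[simp] theorem pure_steps (a : α) : (pure a : Timed α).steps = 0 := rfl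

@[simp] theorem tick_steps : tick.steps = 1 := rfl

theorem filter_val (p : α → Timed Bool) : ∀ l : List α,
    (filter p l).val = l.filter fun a => (p a).val
  | [] => rfl
  | a :: l => by
    simp only [filter, bind_val, filter_val p l, List.filter_cons]
    split <;> rfl

theorem filter_steps (p : α → Timed Bool) {k : ℕ} (hk : ∀ a, (p a).steps ≤ k) : ∀ l : List α,
    (filter p l).steps ≤ (k + 1) * l.length + 1
  | [] => by simp [filter]
  | a :: l => by
    have h1 := filter_steps p hk l
    have h2 := hk a
    simp only [filter, bind_steps, tick_steps, List.length_cons]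
    split <;> simp only [pure_steps] <;> nlinarith

theorem map_val (f : α → Timed β) : ∀ l : List α, (map f l).val = l.map fun a => (f a).val
  | [] => rfl
  | a :: l => by simp [map, map_val f l]

theorem map_steps (f : α → Timed β) {k : ℕ} (hk : ∀ a, (f a).steps ≤ k) : ∀ l : List α,
    (map f l).steps ≤ (k + 1) * l.length + 1
  | [] => by simp [map]
  | a :: l => by
    have h1 := map_steps f hk l
    have h2 := hk a
    simp only [map, bind_steps, tick_steps, List.length_cons, pure_steps]
    nlinarith

theorem append_val : ∀ l k : List α, (append l k).val = l ++ k
  | [], _ => rfl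
  | a :: l, k => by simp [append, append_val l k]

theorem append_steps : ∀ l k : List α, (append l k).steps = l.length + 1
  | [], _ => rfl
  | a :: l, k => by simp [append, append_steps l k]; omega

theorem revOnto_val : ∀ l acc : List α, (revOnto l acc).val = l.reverse ++ acc
  | [], _ => rfl
  | a :: l, acc => by simp [revOnto, revOnto_val l]

theorem revOnto_steps : ∀ l acc : List α, (revOnto l acc).steps = l.length + 1
  | [], _ => rfl
  | a :: l, acc => by simp [revOnto, revOnto_steps l]; omega

theorem length_val : ∀ l : List α, (length l).val = l.length
  | [] => rfl
  | a :: l => by simp [length, length_val l]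

theorem length_steps : ∀ l : List α, (length l).steps = l.length + 1
  | [] => rfl
  | a :: l => by simp [length, length_steps l]; omega

theorem split_perm : ∀ l : List α, ((split l).val.1 ++ (split l).val.2).Perm l
  | [] => by simp [split]
  | [a] => by simp [split]
  | a :: a' :: l => by
    have h := split_perm l
    simp only [split, bind_val, pure_val, List.cons_append]
    exact (List.perm_middle.trans (h.cons a')).cons a

theorem split_length : ∀ l : List α, (split l).val.1.length = (l.length + 1) / 2 ∧
    (split l).val.2.length = l.length / 2
  | [] => by simp [split]
  | [a] => by simp [split]
  | a :: a' :: l => by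
    have h := split_length l
    simp only [split, bind_val, pure_val, List.length_cons]
    omega

theorem split_steps : ∀ l : List α, 2 * (split l).steps ≤ l.length + 2
  | [] => by simp [split]
  | [a] => by simp [split]
  | a :: a' :: l => by
    have h := split_steps l
    simp only [split, bind_steps, pure_steps, tick_steps, List.length_cons]
    omega

theorem merge_val (le : α → α → Timed Bool) : ∀ l k : List α,
    (merge le l k).val = List.merge l k fun a b => (le a b).val
  | [], k => by simp [merge]
  | a :: l, [] => by simp [merge]
  | a :: l, a' :: k => by
    rw [merge, List.cons_merge_cons]
    simp only [bind_val]
    split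
    · simp only [bind_val, merge_val le l (a' :: k), pure_val]
    · simp only [bind_val, merge_val le (a :: l) k, pure_val]
  termination_by l k => l.length + k.length

theorem merge_steps (le : α → α → Timed Bool) {c : ℕ} (hc : ∀ a b, (le a b).steps ≤ c) :
    ∀ l k : List α, (merge le l k).steps ≤ (c + 1) * (l.length + k.length) + 1
  | [], k => by simp [merge]
  | a :: l, [] => by simp [merge]
  | a :: l, a' :: k => by
    have h := hc a a'
    rw [merge]
    simp only [bind_steps, tick_steps]
    split
    · have h1 := merge_steps le hc l (a' :: k)
      simp only [bind_steps, pure_steps, List.length_cons] at h1 ⊢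
      nlinarith
    · have h1 := merge_steps le hc (a :: l) k
      simp only [bind_steps, pure_steps, List.length_cons] at h1 ⊢
      nlinarith
  termination_by l k => l.length + k.length

theorem sortAux_perm (le : α → α → Timed Bool) : ∀ (k : ℕ) (l : List α),
    ((sortAux le k l).val).Perm l
  | 0, l => by simp [sortAux]
  | _ + 1, [] => by simp [sortAux]
  | _ + 1, [a] => by simp [sortAux]
  | k + 1, a :: a' :: l => by
    simp only [sortAux, bind_val, merge_val]
    exact (List.merge_perm_append _).trans
      (((sortAux_perm le k _).append (sortAux_perm le k _)).trans (split_perm _))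

/-- The length of the list is enough recursion depth, since halving a list with at least two entries
makes both parts strictly shorter. -/
theorem sortAux_pairwise (le : α → α → Timed Bool) (r : α → α → Prop)
    (hr : ∀ a b, (le a b).val = true ↔ r a b) (ht : ∀ a b c, r a b → r b c → r a c)
    (htot : ∀ a b, r a b ∨ r b a) : ∀ (k : ℕ) (l : List α), l.length ≤ k →
    ((sortAux le k l).val).Pairwise r
  | 0, l, h => by
    have : l = [] := List.length_eq_zero_iff.1 (by omega)
    simp [sortAux, this]
  | _ + 1, [], _ => by simp [sortAux]
  | _ + 1, [a], _ => by simp [sortAux]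
  | k + 1, a :: a' :: l, h => by
    simp only [sortAux, bind_val, merge_val]
    have hl := split_length (a :: a' :: l)
    simp only [List.length_cons] at hl h
    have h1 := sortAux_pairwise le r hr ht htot k (split (a :: a' :: l)).val.1 (by omega)
    have h2 := sortAux_pairwise le r hr ht htot k (split (a :: a' :: l)).val.2 (by omega)
    refine (List.pairwise_merge (le := fun a b => (le a b).val) ?_ ?_ _ _
      (h1.imp fun h => (hr _ _).2 h) (h2.imp fun h => (hr _ _).2 h)).imp fun h => (hr _ _).1 h
    · intro a b c h1 h2
      exact (hr _ _).2 (ht _ _ _ ((hr _ _).1 h1) ((hr _ _).1 h2))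
    · intro a b
      rw [Bool.or_eq_true, hr, hr]
      exact htot a b

/-- The number of levels is `Nat.clog 2` of the length. Merging at one level costs `c + 1` per
entry; the further `3` per entry pay for splitting and for all additive constants, which suffices
because the length is at least two. The bound does not depend on the allowed depth `k`. -/
theorem sortAux_steps (le : α → α → Timed Bool) {c : ℕ} (hc : ∀ a b, (le a b).steps ≤ c) :
    ∀ (k : ℕ) (l : List α),
      (sortAux le k l).steps ≤ (c + 4) * (l.length * Nat.clog 2 l.length) + 1
  | 0, l => by simp [sortAux]
  | _ + 1, [] => by simp [sortAux]
  | _ + 1, [a] => by simp [sortAux]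
  | k + 1, a :: a' :: l => by
    have hs := split_steps (a :: a' :: l)
    obtain ⟨hl1, hl2⟩ := split_length (a :: a' :: l)
    have h1 := sortAux_steps le hc k (split (a :: a' :: l)).val.1
    have h2 := sortAux_steps le hc k (split (a :: a' :: l)).val.2
    have h3 := merge_steps le hc (sortAux le k (split (a :: a' :: l)).val.1).val
      (sortAux le k (split (a :: a' :: l)).val.2).val
    rw [(sortAux_perm le k _).length_eq, (sortAux_perm le k _).length_eq] at h3
    simp only [sortAux, bind_steps, tick_steps]
    set L := (a :: a' :: l).length with hL
    have hL2 : 2 ≤ L := by simp [hL]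
    obtain ⟨g, hg⟩ : ∃ g, Nat.clog 2 L = g + 1 :=
      Nat.exists_eq_add_one.2 (Nat.clog_pos one_lt_two hL2)
    -- Rounding up is harmless: the larger half has exactly one level less.
    have hg' : Nat.clog 2 ((L + 1) / 2) = g := by
      have := Nat.clog_of_two_le (b := 2) one_lt_two hL2
      rw [show L + 2 - 1 = L + 1 by omega] at this
      omega
    have hg'' : Nat.clog 2 (L / 2) ≤ g := by
      rw [← hg']; exact Nat.clog_mono_right 2 (by omega)
    rw [hl1, hg'] at h1
    rw [hl2] at h2
    have h2' : (c + 4) * (L / 2 * Nat.clog 2 (L / 2)) ≤ (c + 4) * (L / 2 * g) := by gcongr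
    rw [hl1, hl2] at h3
    have hsum : (L + 1) / 2 + L / 2 = L := by omega
    rw [hsum] at h3
    rw [hg]
    have h12 : (c + 4) * ((L + 1) / 2 * g) + (c + 4) * (L / 2 * g) = (c + 4) * (L * g) := by
      rw [← Nat.mul_add, ← Nat.add_mul, hsum]
    have h5 : (c + 4) * (L * (g + 1)) = (c + 4) * (L * g) + (c + 1) * L + 3 * L := by ring
    omega

theorem sort_perm (le : α → α → Timed Bool) (l : List α) : ((sort le l).val).Perm l :=
  sortAux_perm le _ l

theorem sort_pairwise (le : α → α → Timed Bool) (r : α → α → Prop)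
    (hr : ∀ a b, (le a b).val = true ↔ r a b) (ht : ∀ a b c, r a b → r b c → r a c)
    (htot : ∀ a b, r a b ∨ r b a) (l : List α) : ((sort le l).val).Pairwise r :=
  sortAux_pairwise le r hr ht htot _ l (length_val l).ge

theorem sort_steps (le : α → α → Timed Bool) {c : ℕ} (hc : ∀ a b, (le a b).steps ≤ c)
    (l : List α) :
    (sort le l).steps ≤ (c + 4) * (l.length * Nat.clog 2 l.length) + l.length + 3 := by
  have h := sortAux_steps le hc (length l).val l
  simp only [sort, bind_steps, tick_steps, length_steps]
  omega

theorem count_val : ∀ l : List α, (count l : Timed ℝ).val = l.length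
  | [] => by simp [count]
  | a :: l => by
    simp only [count, bind_val, count_val l, add, List.length_cons]
    push_cast; rfl

theorem count_steps : ∀ l : List α, (count l : Timed ℝ).steps = 2 * l.length + 1
  | [] => by simp [count]
  | a :: l => by
    simp only [count, bind_steps, count_steps l, add, List.length_cons, tick_steps]
    omega

theorem sumOver_val (f : α → ℝ) : ∀ l : List α, (sumOver f l).val = (l.map f).sum
  | [] => rfl
  | e :: l => by
    simp only [sumOver, bind_val, sumOver_val f l, add, read, List.map_cons, List.sum_cons]
    ring

theorem sumOver_steps (f : α → ℝ) : ∀ l : List α, (sumOver f l).steps = 3 * l.length + 1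
  | [] => rfl
  | e :: l => by
    simp only [sumOver, bind_steps, sumOver_steps f l, add, read, tick_steps, List.length_cons]
    omega

theorem greedy_steps : ∀ (r : ℝ) (l : List α), (greedy r l).steps = 3 * l.length + 1
  | _, [] => rfl
  | r, e :: l => by
    simp only [greedy, bind_steps, greedy_steps, minNum, sub, tick_steps, pure_steps,
      List.length_cons]
    omega

theorem costOf_val (c : α → ℝ) : ∀ l : List (α × ℝ),
    (costOf c l).val = (l.map fun p => c p.1 * p.2).sum
  | [] => rfl
  | (e, y) :: l => by
    simp only [costOf, bind_val, costOf_val c l, add, mul, read, List.map_cons, List.sum_cons]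
    ring

theorem costOf_steps (c : α → ℝ) : ∀ l : List (α × ℝ), (costOf c l).steps = 4 * l.length + 1
  | [] => rfl
  | (e, y) :: l => by
    simp only [costOf, bind_steps, costOf_steps c l, add, mul, read, tick_steps, List.length_cons]
    omega

theorem leBy_val (f : α → ℝ) (a b : α) : (leBy f a b).val = true ↔ f a ≤ f b := by
  simp [leBy, le, read]

theorem geBy_val (f : α → ℝ) (a b : α) : (geBy f a b).val = true ↔ f b ≤ f a := by
  simp [geBy, le, read]

theorem leBy_steps (f : α → ℝ) (a b : α) : (leBy f a b).steps ≤ 4 := by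
  simp [leBy, le, read]

theorem geBy_steps (f : α → ℝ) (a b : α) : (geBy f a b).steps ≤ 4 := by
  simp [geBy, le, read]

theorem sort_leBy_pairwise (f : α → ℝ) (l : List α) :
    (sort (leBy f) l).val.Pairwise fun a b => f a ≤ f b :=
  sort_pairwise _ _ (leBy_val f) (fun _ _ _ => le_trans) (fun _ _ => le_total _ _) l

theorem sort_geBy_pairwise (f : α → ℝ) (l : List α) :
    (sort (geBy f) l).val.Pairwise fun a b => f b ≤ f a :=
  sort_pairwise _ _ (geBy_val f) (fun _ _ _ h h' => le_trans h' h) (fun _ _ => le_total _ _) l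

end Basic

end Prog

end RCBSP

namespace RCBSP

namespace Prog

/-! ### The implementation of the adversary's algorithm. -/

section Adversary

variable {E : Type} (I : Inst E ℝ)

theorem isPred_val (h e : E) : (isPred I h e).val = true ↔ I.hi e < I.lo h := by
  simp [isPred, lt, read]

theorem isInc_val (h e : E) : (isInc I h e).val = true ↔ I.lo e ≤ I.lo h ∧ I.lo h ≤ I.hi e := by
  simp [isInc, le, read]

theorem isRest_val (h e : E) : (isRest I h e).val = true ↔
    ¬I.hi e < I.lo h ∧ ¬(I.lo e ≤ I.lo h ∧ I.lo h ≤ I.hi e) := by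
  rw [← isInc_val, ← isPred_val]
  simp [isRest]

theorem isPred_steps (h e : E) : (isPred I h e).steps ≤ 4 := by simp [isPred, lt, read]

theorem isInc_steps (h e : E) : (isInc I h e).steps ≤ 6 := by simp [isInc, le, read]

theorem isRest_steps (h e : E) : (isRest I h e).steps ≤ 11 := by
  simp [isRest, isPred, isInc, lt, le, read]

/-- The listed items that precede the head `h`. -/
noncomputable def predList (items : List E) (h : E) : List E :=
  items.filter fun e => (isPred I h e).val

/-- The listed items whose intervals contain the left endpoint of the head `h`. -/
noncomputable def incList (items : List E) (h : E) : List E :=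
  items.filter fun e => (isInc I h e).val

/-- The listed items that follow the left endpoint of the head `h`. -/
noncomputable def restList (items : List E) (h : E) : List E :=
  items.filter fun e => (isRest I h e).val

/-- The selection that is computed for the head `h`. -/
noncomputable def headList (cap : ℝ) (items : List E) (h : E) : List (E × ℝ) :=
  ((predList I items h).map fun e => (e, 1)) ++
    fill (cap - (predList I items h).length) (incList I items h) ++
    (restList I items h).map fun e => (e, 0)

theorem tryHead_val (cap : ℝ) (items : List E) (h : E) :
    (tryHead I cap items h).val =
      if ((predList I items h).length : ℝ) ≤ cap ∧
          cap - (predList I items h).length ≤ ((incList I items h).length : ℝ) then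
        some (((headList I cap items h).map fun p => I.c p.1 * p.2).sum, headList I cap items h)
      else none := by
  simp only [tryHead, bind_val, filter_val, count_val, le, sub]
  rw [← predList, ← incList]
  by_cases h1 : ((predList I items h).length : ℝ) ≤ cap ∧
    cap - (predList I items h).length ≤ ((incList I items h).length : ℝ)
  · rw [if_pos h1, if_pos (by simpa using h1)]
    simp only [bind_val, filter_val, map_val, greedy_val, append_val, costOf_val, pure_val]
    rfl
  · rw [if_neg h1, if_neg (by simpa using h1)]
    rfl

theorem tryHead_steps (cap : ℝ) (items : List E) (h : E) :
    (tryHead I cap items h).steps ≤ 60 * items.length + 20 := by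
  simp only [tryHead, bind_steps, filter_val, count_val, count_steps, le, sub,
    tick_steps]
  rw [← predList, ← incList]
  have f1 := filter_steps (isPred I h) (isPred_steps I h) items
  have f2 := filter_steps (isInc I h) (isInc_steps I h) items
  have f3 := filter_steps (isRest I h) (isRest_steps I h) items
  have l1 : (predList I items h).length ≤ items.length := List.length_filter_le _ _
  have l2 : (incList I items h).length ≤ items.length := List.length_filter_le _ _
  have l3 : (restList I items h).length ≤ items.length := List.length_filter_le _ _
  split
  · simp only [bind_steps, filter_val, map_val, greedy_val, append_val, costOf_steps,
      append_steps, greedy_steps, pure_steps]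
    rw [← restList]
    have m1 := map_steps (fun e : E => (pure (e, 1) : Timed (E × ℝ))) (k := 0)
      (fun _ => le_rfl) (predList I items h)
    have m3 := map_steps (fun e : E => (pure (e, 0) : Timed (E × ℝ))) (k := 0)
      (fun _ => le_rfl) (restList I items h)
    have l4 : (fill (cap - (predList I items h).length) (incList I items h)).length
        = (incList I items h).length := by
      conv_rhs => rw [← fill_fst (cap - (predList I items h).length) (incList I items h)]
      rw [List.length_map]
    simp only [List.length_append, List.length_map, l4]
    generalize (map (fun e : E => (pure (e, 1) : Timed (E × ℝ))) (predList I items h)).steps = s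
      at m1 ⊢
    generalize (map (fun e : E => (pure (e, 0) : Timed (E × ℝ))) (restList I items h)).steps = s'
      at m3 ⊢
    generalize (filter (isPred I h) items).steps = s₁ at f1 ⊢
    generalize (filter (isInc I h) items).steps = s₂ at f2 ⊢
    generalize (filter (isRest I h) items).steps = s₃ at f3 ⊢
    linarith
  · simp only [pure_steps]
    generalize (filter (isPred I h) items).steps = s₁ at f1 ⊢
    generalize (filter (isInc I h) items).steps = s₂ at f2 ⊢
    omega

theorem headList_fst (cap : ℝ) (items : List E) (h : E) :
    (headList I cap items h).map Prod.fst =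
      predList I items h ++ incList I items h ++ restList I items h := by
  simp [headList, fill_fst, Function.comp_def]

/-- The loop invariant for an arbitrary current best: the final entry comes from the start value or
from a listed head, and it dominates both. -/
theorem bestHead_spec (cap : ℝ) (items : List E) : ∀ (hs : List E) best,
    ((bestHead I cap items hs best).val = none →
      best = none ∧ ∀ h ∈ hs, (tryHead I cap items h).val = none) ∧
    ∀ h v y, (bestHead I cap items hs best).val = some (h, v, y) →
      (best = some (h, v, y) ∨ h ∈ hs ∧ (tryHead I cap items h).val = some (v, y)) ∧
      (∀ h' ∈ hs, ∀ v' y', (tryHead I cap items h').val = some (v', y') → v' ≤ v) ∧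
      ∀ b, best = some b → b.2.1 ≤ v
  | [], best => by
    refine ⟨fun h => ⟨h, by simp⟩, fun h v y hb => ⟨Or.inl hb, by simp, ?_⟩⟩
    rintro b rfl
    rw [bestHead] at hb
    simp only [bind_val, pure_val, Option.some.injEq] at hb
    rw [hb]
  | h₀ :: hs, best => by
    -- All branches continue with some `best'`; the induction step only needs that `best'` stems
    -- from the old best or from `h₀`, and is at least as good as either.
    have key : ∀ best', ((bestHead I cap items (h₀ :: hs) best).val
          = (bestHead I cap items hs best').val) →
        (best' = none → best = none ∧ (tryHead I cap items h₀).val = none) →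
        (∀ b, best' = some b → best = some b ∨
          b.1 = h₀ ∧ (tryHead I cap items h₀).val = some b.2) →
        (∀ v' y', (tryHead I cap items h₀).val = some (v', y') → ∃ b, best' = some b ∧ v' ≤ b.2.1) →
        (∀ b, best = some b → ∃ b', best' = some b' ∧ b.2.1 ≤ b'.2.1) →
        ((bestHead I cap items (h₀ :: hs) best).val = none →
          best = none ∧ ∀ h ∈ h₀ :: hs, (tryHead I cap items h).val = none) ∧
        ∀ h v y, (bestHead I cap items (h₀ :: hs) best).val = some (h, v, y) →
          (best = some (h, v, y) ∨ h ∈ h₀ :: hs ∧ (tryHead I cap items h).val = some (v, y)) ∧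
          (∀ h' ∈ h₀ :: hs, ∀ v' y', (tryHead I cap items h').val = some (v', y') → v' ≤ v) ∧
          ∀ b, best = some b → b.2.1 ≤ v := by
      intro best' heq k1 k2 k3 k4
      obtain ⟨i1, i2⟩ := bestHead_spec cap items hs best'
      rw [heq]
      refine ⟨fun hn => ?_, fun h v y hb => ?_⟩
      · obtain ⟨j1, j2⟩ := i1 hn
        obtain ⟨j3, j4⟩ := k1 j1
        refine ⟨j3, fun h hh => ?_⟩
        rcases List.mem_cons.1 hh with rfl | hh
        · exact j4
        · exact j2 h hh
      · obtain ⟨j1, j2, j3⟩ := i2 h v y hb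
        refine ⟨?_, fun h' hh' v' y' ht => ?_, fun b hb' => ?_⟩
        · rcases j1 with j1 | j1
          · rcases k2 _ j1 with j4 | ⟨j4, j5⟩
            · exact Or.inl j4
            · simp only at j4 j5
              exact Or.inr ⟨by simp [j4], by rw [j4]; exact j5⟩
          · exact Or.inr ⟨by simp [j1.1], j1.2⟩
        · rcases List.mem_cons.1 hh' with rfl | hh'
          · obtain ⟨b, hb1, hb2⟩ := k3 v' y' ht
            exact hb2.trans (j3 b hb1)
          · exact j2 h' hh' v' y' ht
        · obtain ⟨b', hb1, hb2⟩ := k4 b hb'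
          exact hb2.trans (j3 b' hb1)
    rcases hT : (tryHead I cap items h₀).val with _ | ⟨v, y⟩
    · refine key best ?_ ?_ ?_ ?_ ?_
      · simp [bestHead, hT]
      · exact fun h => ⟨h, hT⟩
      · exact fun b hb => Or.inl hb
      · simp [hT]
      · exact fun b hb => ⟨b, hb, le_rfl⟩
    · rcases best with _ | ⟨h', v', y'⟩
      · refine key (some (h₀, v, y)) ?_ ?_ ?_ ?_ ?_
        · simp [bestHead, hT]
        · simp
        · rintro b ⟨⟩; exact Or.inr ⟨rfl, hT⟩
        · intro v' y' h
          rw [hT] at h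
          cases h
          exact ⟨_, rfl, le_rfl⟩
        · simp
      · by_cases hlt : v' < v
        · refine key (some (h₀, v, y)) ?_ ?_ ?_ ?_ ?_
          · simp [bestHead, hT, lt, hlt]
          · simp
          · rintro b ⟨⟩; exact Or.inr ⟨rfl, hT⟩
          · intro v' y' h
            rw [hT] at h
            cases h
            exact ⟨_, rfl, le_rfl⟩
          · rintro b ⟨⟩
            exact ⟨_, rfl, hlt.le⟩
        · refine key (some (h', v', y')) ?_ ?_ ?_ ?_ ?_
          · simp [bestHead, hT, lt, hlt]
          · simp
          · rintro b ⟨⟩; exact Or.inl rfl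
          · intro v'' y'' h
            rw [hT] at h
            cases h
            exact ⟨_, rfl, not_lt.1 hlt⟩
          · rintro b ⟨⟩
            exact ⟨_, rfl, le_rfl⟩

theorem bestHead_steps (cap : ℝ) (items : List E) : ∀ (hs : List E) best,
    (bestHead I cap items hs best).steps ≤ hs.length * (60 * items.length + 22) + 1
  | [], best => by simp [bestHead]
  | h₀ :: hs, best => by
    have h1 := tryHead_steps I cap items h₀
    rw [bestHead]
    simp only [bind_steps, tick_steps, List.length_cons, Nat.add_mul, one_mul]
    rcases (tryHead I cap items h₀).val with _ | ⟨v, y⟩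
    · have h2 := bestHead_steps cap items hs best
      dsimp only
      omega
    · have h2 := bestHead_steps cap items hs (some (h₀, v, y))
      rcases best with _ | ⟨h', v', y'⟩
      · dsimp only
        omega
      · have h3 := bestHead_steps cap items hs (some (h', v', y'))
        simp only [bind_steps, lt]
        split <;> omega

/-- For `a = lo h` the test `a ≤ hi e` selects precisely the items outside `pred h`. In the
algorithm the start value `z` is the gap of `h` itself, which is among them. -/
theorem minGap_spec (a : ℝ) : ∀ (z : ℝ) (l : List E),
    ((minGap I a z l).val = z ∨ ∃ e ∈ l, a ≤ I.hi e ∧ (minGap I a z l).val = I.hi e - a) ∧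
    (minGap I a z l).val ≤ z ∧ ∀ e ∈ l, a ≤ I.hi e → (minGap I a z l).val ≤ I.hi e - a
  | z, [] => by simp [minGap]
  | z, e :: l => by
    by_cases h : a ≤ I.hi e
    · have heq : (minGap I a z (e :: l)).val = (minGap I a (min z (I.hi e - a)) l).val := by
        simp [minGap, h, le, read, sub, minNum]
      obtain ⟨h1, h2, h3⟩ := minGap_spec a (min z (I.hi e - a)) l
      rw [heq]
      refine ⟨?_, h2.trans (min_le_left _ _), fun e' he' h' => ?_⟩
      · rcases h1 with h1 | ⟨e', he', h1⟩
        · rcases min_choice z (I.hi e - a) with h4 | h4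
          · exact Or.inl (by rw [h1, h4])
          · exact Or.inr ⟨e, by simp, h, by rw [h1, h4]⟩
        · exact Or.inr ⟨e', by simp [he'], h1⟩
      · rcases List.mem_cons.1 he' with rfl | he'
        · exact h2.trans (min_le_right _ _)
        · exact h3 e' he' h'
    · have heq : (minGap I a z (e :: l)).val = (minGap I a z l).val := by
        simp [minGap, h, le, read]
      obtain ⟨h1, h2, h3⟩ := minGap_spec a z l
      rw [heq]
      refine ⟨?_, h2, fun e' he' h' => ?_⟩
      · rcases h1 with h1 | ⟨e', he', h1⟩
        · exact Or.inl h1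
        · exact Or.inr ⟨e', by simp [he'], h1⟩
      · rcases List.mem_cons.1 he' with rfl | he'
        · exact absurd h' h
        · exact h3 e' he' h'

theorem minGap_steps (a : ℝ) : ∀ (z : ℝ) (l : List E),
    (minGap I a z l).steps ≤ 5 * l.length + 1
  | z, [] => by simp [minGap]
  | z, e :: l => by
    have h1 := minGap_steps a z l
    have h2 := minGap_steps a (min z (I.hi e - a)) l
    rw [minGap]
    simp only [bind_steps, tick_steps, read, le, sub, minNum, List.length_cons]
    split
    · simp only [bind_steps]
      omega
    · omega

theorem scenario_val (a : ℝ) : ∀ l : List (E × ℝ), (scenario I a l).val =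
    l.map fun p => (p.1, if 1 ≤ p.2 then I.lo p.1 else if 0 < p.2 then a else I.hi p.1)
  | [] => rfl
  | (e, y) :: l => by
    simp only [scenario, bind_val, scenario_val a l, le, lt, read, List.map_cons, decide_eq_true_eq]
    split
    · rfl
    · split <;> rfl

theorem scenario_steps (a : ℝ) : ∀ l : List (E × ℝ), (scenario I a l).steps ≤ 4 * l.length + 1
  | [] => by simp [scenario]
  | (e, y) :: l => by
    have := scenario_steps a l
    rw [scenario]
    simp only [bind_steps, tick_steps, le, lt, List.length_cons]
    split
    · simp only [bind_steps, read, pure_steps]; omega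
    · split <;> simp only [bind_steps, read, pure_steps] <;> omega

variable {I}

theorem nodup_headList {items : List E} (hn : items.Nodup) (cap : ℝ) (h : E) :
    ((headList I cap items h).map Prod.fst).Nodup := by
  rw [headList_fst, List.nodup_append, List.nodup_append]
  refine ⟨⟨hn.filter _, hn.filter _, ?_⟩, hn.filter _, ?_⟩
  · intro a ha b hb hab
    subst hab
    rw [predList, List.mem_filter, isPred_val] at ha
    rw [incList, List.mem_filter, isInc_val] at hb
    exact absurd ha.2 (not_lt.2 hb.2.2)
  · intro a ha b hb hab
    subst hab
    rw [restList, List.mem_filter, isRest_val] at hb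
    rcases List.mem_append.1 ha with ha | ha
    · rw [predList, List.mem_filter, isPred_val] at ha
      exact hb.2.1 ha.2
    · rw [incList, List.mem_filter, isInc_val] at ha
      exact hb.2.2 ha.2

variable [DecidableEq E]

theorem toFinset_predList {items : List E} (hi : items.toFinset = I.Ef) (h : E) :
    (predList I items h).toFinset = I.pred h := by
  ext e
  rw [predList, List.mem_toFinset, List.mem_filter, isPred_val, Inst.mem_pred, ← hi,
    List.mem_toFinset]

theorem toFinset_incList {items : List E} (hi : items.toFinset = I.Ef) (h : E) :
    (incList I items h).toFinset = I.inc h := by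
  ext e
  rw [incList, List.mem_toFinset, List.mem_filter, isInc_val, Inst.mem_inc, ← hi,
    List.mem_toFinset]

theorem length_predList {items : List E} (hn : items.Nodup) (hi : items.toFinset = I.Ef) (h : E) :
    (predList I items h).length = (I.pred h).card := by
  have hnd : (predList I items h).Nodup := hn.filter _
  rw [← toFinset_predList hi, List.toFinset_card_of_nodup hnd]

theorem length_incList {items : List E} (hn : items.Nodup) (hi : items.toFinset = I.Ef) (h : E) :
    (incList I items h).length = (I.inc h).card := by
  have hnd : (incList I items h).Nodup := hn.filter _
  rw [← toFinset_incList hi, List.toFinset_card_of_nodup hnd]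

theorem toFinset_headList {items : List E} (hi : items.toFinset = I.Ef) (cap : ℝ) (h : E) :
    ((headList I cap items h).map Prod.fst).toFinset = I.Ef := by
  rw [headList_fst, ← hi]
  ext e
  simp only [List.toFinset_append, Finset.mem_union, List.mem_toFinset, predList, incList,
    restList, List.mem_filter, isPred_val, isInc_val, isRest_val]
  tauto

theorem length_headList {items : List E} (hn : items.Nodup) (hi : items.toFinset = I.Ef)
    (cap : ℝ) (h : E) : (headList I cap items h).length = I.Ef.card := by
  rw [← toFinset_headList hi cap h, List.toFinset_card_of_nodup (nodup_headList hn cap h),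
    List.length_map]

/-- Filtering preserves the order by nonincreasing leader's costs. One initial sorting thus makes
the greedy algorithm correct on `inc h` for every head. -/
theorem headSelection_headList {items : List E} (hn : items.Nodup) (hi : items.toFinset = I.Ef)
    (hs : items.Pairwise fun a b => I.c b ≤ I.c a) {cap : ℝ} {h : E}
    (hh : h ∈ I.adversaryHeads cap) : I.HeadSelection cap h (toVec (headList I cap items h)) := by
  obtain ⟨-, h1, h2⟩ := Inst.mem_adversaryHeads.1 hh
  have hnd := nodup_headList (I := I) hn cap h
  have hp : ∀ e ∈ I.pred h, toVec (headList I cap items h) e = 1 := by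
    intro e he
    rw [← toFinset_predList hi, List.mem_toFinset] at he
    refine toVec_of_mem hnd (e, 1) ?_
    simp [headList, he]
  have hr : ∀ e ∈ I.Ef \ (I.pred h ∪ I.inc h), toVec (headList I cap items h) e = 0 := by
    intro e he
    rw [Finset.mem_sdiff, Finset.mem_union, not_or, ← toFinset_predList hi,
      ← toFinset_incList hi, ← hi, List.mem_toFinset, List.mem_toFinset, List.mem_toFinset] at he
    refine toVec_of_mem hnd (e, 0) ?_
    have : e ∈ restList I items h := by
      rw [restList, List.mem_filter, isRest_val]
      refine ⟨he.1, fun h3 => he.2.1 ?_, fun h3 => he.2.2 ?_⟩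
      · rw [predList, List.mem_filter, isPred_val]; exact ⟨he.1, h3⟩
      · rw [incList, List.mem_filter, isInc_val]; exact ⟨he.1, h3⟩
    simp [headList, this]
  set r := cap - ((predList I items h).length : ℝ) with hrdef
  have hl := length_predList hn hi h
  have hl' := length_incList hn hi h
  have hin : (incList I items h).Nodup := hn.filter _
  have hm : ∀ e ∈ (incList I items h).toFinset,
      toVec (headList I cap items h) e = toVec (fill r (incList I items h)) e := by
    intro e he
    rw [List.mem_toFinset] at he
    refine toVec_of_mem hnd (e, _) ?_
    have := mem_fill hin r he
    rw [headList, ← hrdef]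
    exact List.mem_append_left _ (List.mem_append_right _ this)
  have hr0 : 0 ≤ r := by rw [hrdef, hl]; linarith
  have hr1 : r ≤ (incList I items h).length := by rw [hrdef, hl, hl']; exact h2
  have hsol := toVec_fill_solves (w := fun e => -I.c e) hin hr0 hr1
    ((hs.filter _).imp fun h => neg_le_neg h)
  have hfr := toVec_fill_fractional hin hr0
  refine ⟨hp, ?_, hr⟩
  rw [← hl, ← hrdef, ← toFinset_incList hi]
  refine ⟨⟨⟨fun e he => ?_, ?_⟩, fun y' h3 h4 => ?_⟩, ?_⟩
  · rw [hm e he]; exact hsol.1.1 e he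
  · rw [Finset.sum_congr rfl hm]; exact hsol.1.2
  · rw [Finset.sum_congr rfl fun e he => by rw [hm e he]]
    exact hsol.2 y' h3 h4
  · intro e₁ he₁ e₂ he₂
    rw [hm e₁ he₁, hm e₂ he₂]
    exact hfr e₁ he₁ e₂ he₂

theorem sum_headList {items : List E} (hn : items.Nodup) (hi : items.toFinset = I.Ef)
    (cap : ℝ) (h : E) : ((headList I cap items h).map fun p => I.c p.1 * p.2).sum =
      I.followerPart (toVec (headList I cap items h)) := by
  rw [← sum_toVec (nodup_headList hn cap h) fun e y => I.c e * y, toFinset_headList hi]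
  rfl

theorem tryHead_eq_some {items : List E} (hn : items.Nodup) (hi : items.toFinset = I.Ef)
    {cap : ℝ} {h : E} (hh : h ∈ I.adversaryHeads cap) : (tryHead I cap items h).val =
      some (I.followerPart (toVec (headList I cap items h)), headList I cap items h) := by
  obtain ⟨-, h1, h2⟩ := Inst.mem_adversaryHeads.1 hh
  rw [tryHead_val, length_predList hn hi, length_incList hn hi, if_pos ⟨h1, h2⟩,
    sum_headList hn hi]

theorem mem_adversaryHeads_of_tryHead {items : List E} (hn : items.Nodup)
    (hi : items.toFinset = I.Ef) {cap : ℝ} {h : E} (hh : h ∈ I.Ef) {r}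
    (hr : (tryHead I cap items h).val = some r) : h ∈ I.adversaryHeads cap := by
  rw [tryHead_val, length_predList hn hi, length_incList hn hi] at hr
  rw [Inst.mem_adversaryHeads]
  refine ⟨hh, ?_⟩
  by_contra hc
  rw [if_neg hc] at hr
  cases hr

/-- Feasibility of `x` guarantees a head that passes the test, so the default return value is never
reached. -/
theorem adversary_spec (hV : I.Valid) {x : E → ℝ} (hx : I.LeaderFeasible x) :
    I.AdversaryAlgorithm x (toVec (adversary I x).val) ∧
      ((adversary I x).steps : ℝ) ≤ 200 * (I.n : ℝ) ^ 2 := by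
  set cap : ℝ := I.b - ∑ e ∈ I.El, x e with hcap
  have hcap' : (I.b : ℝ) - (I.leaderItems.map x).sum = cap := by
    rw [hcap, Inst.El, List.sum_toFinset _ hV.nodup_leader]
  set items := (sort (geBy I.c) I.followerItems).val with hitems
  have hperm : items.Perm I.followerItems := sort_perm _ _
  have hn : items.Nodup := hperm.nodup_iff.2 hV.nodup_follower
  have hi : items.toFinset = I.Ef := List.toFinset_eq_of_perm _ _ hperm
  have hsort : items.Pairwise fun a b => I.c b ≤ I.c a := sort_geBy_pairwise _ _
  have hmemf : ∀ e, e ∈ I.followerItems ↔ e ∈ I.Ef := fun e => List.mem_toFinset.symm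
  obtain ⟨b1, b2⟩ := bestHead_spec I cap items I.followerItems none
  obtain ⟨h₁, hh₁⟩ := hV.adversaryHeads_nonempty (hV.leaderFeasible_iff.1 hx).2.1
    (hV.leaderFeasible_iff.1 hx).2.2
  have hval : ∃ h v y, (bestHead I cap items I.followerItems none).val = some (h, v, y) := by
    rcases hb : (bestHead I cap items I.followerItems none).val with _ | ⟨h, v, y⟩
    · have := (b1 hb).2 h₁ ((hmemf _).2 (Inst.mem_adversaryHeads.1 hh₁).1)
      rw [tryHead_eq_some hn hi hh₁] at this
      cases this
    · exact ⟨h, v, y, rfl⟩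
  obtain ⟨h, v, y, hb⟩ := hval
  obtain ⟨b3, b4, -⟩ := b2 h v y hb
  obtain ⟨b5, b6⟩ := b3.resolve_left (by simp)
  have hhf := (hmemf _).1 b5
  have hh := mem_adversaryHeads_of_tryHead hn hi hhf b6
  rw [tryHead_eq_some hn hi hh] at b6
  simp only [Option.some.injEq, Prod.mk.injEq] at b6
  obtain ⟨rfl, rfl⟩ := b6
  obtain ⟨g1, g2, g3⟩ := minGap_spec I (I.lo h) (I.hi h - I.lo h) I.followerItems
  set m := (minGap I (I.lo h) (I.hi h - I.lo h) I.followerItems).val with hm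
  have hd : (adversary I x).val = (headList I cap items h).map fun p =>
      (p.1, if 1 ≤ p.2 then I.lo p.1 else if 0 < p.2 then I.lo h + m / 2 else I.hi p.1) := by
    simp only [adversary, bind_val, sumOver_val, sub, hcap', ← hitems, hb, read, div, add, ← hm,
      scenario_val]
  have hnd := nodup_headList (I := I) hn cap h
  constructor
  · refine ⟨cap, rfl, fun h => toVec (headList I cap items h),
      fun h' hh' => headSelection_headList hn hi hsort hh', h, hh, fun h' hh' => ?_,
      m, 1 / 2 * m, ⟨?_, ?_⟩, rfl, fun e he => ?_⟩
    · exact b4 h' ((hmemf _).2 (Inst.mem_adversaryHeads.1 hh').1) _ _ (tryHead_eq_some hn hi hh')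
    · rcases g1 with g1 | ⟨e, he, hle, g1⟩
      · exact ⟨h, Finset.mem_sdiff.2 ⟨hhf, fun h3 =>
          absurd (Inst.mem_pred.1 h3).2 (not_lt.2 (hV.lo_le_hi h hhf))⟩, g1⟩
      · exact ⟨e, Finset.mem_sdiff.2 ⟨(hmemf _).1 he, fun h3 =>
          absurd (Inst.mem_pred.1 h3).2 (not_lt.2 hle)⟩, g1⟩
    · rintro r ⟨e, he, rfl⟩
      rw [Finset.mem_sdiff, Inst.mem_pred, not_and, not_lt] at he
      exact g3 e ((hmemf _).2 he.1) (he.2 he.1)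
    · have hmem : (e, toVec (headList I cap items h) e) ∈ headList I cap items h := by
        refine exists_mem_of_toVec hnd ?_
        rw [← List.mem_toFinset, toFinset_headList hi]
        exact he
      have hv : toVec (adversary I x).val e =
          if 1 ≤ toVec (headList I cap items h) e then I.lo e
          else if 0 < toVec (headList I cap items h) e then I.lo h + m / 2 else I.hi e := by
        rw [hd]
        refine toVec_of_mem ?_ (e, _) (List.mem_map.2 ⟨_, hmem, rfl⟩)
        rw [List.map_map]
        exact hnd
      rw [hv]
      refine ⟨fun h3 => ?_, fun h3 => ?_, fun h3 h4 => ?_⟩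
      · simp [h3]
      · simp [h3]
      · rw [if_neg (not_le.2 h4), if_pos h3]; ring
  · have hE : I.n = I.leaderItems.length + I.followerItems.length := by
      rw [Inst.n, Finset.card_union_of_disjoint hV.disjoint, Inst.El, Inst.Ef,
        List.toFinset_card_of_nodup hV.nodup_leader, List.toFinset_card_of_nodup hV.nodup_follower]
    have hf1 : 1 ≤ I.followerItems.length :=
      List.length_pos_of_mem b5
    have s1 := sort_steps (geBy I.c) (geBy_steps I.c) I.followerItems
    have s2 := bestHead_steps I cap items I.followerItems none
    have s3 := minGap_steps I (I.lo h) (I.hi h - I.lo h) I.followerItems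
    have s4 := scenario_steps I (I.lo h + m / 2) (headList I cap items h)
    have hlen : (headList I cap items h).length = I.followerItems.length := by
      rw [length_headList hn hi, Inst.Ef, List.toFinset_card_of_nodup hV.nodup_follower]
    rw [hlen] at s4
    rw [hperm.length_eq] at s2
    have hst : (adversary I x).steps ≤ 200 * I.n ^ 2 := by
      simp only [adversary, bind_steps, sumOver_val, sumOver_steps, sub, hcap',
        ← hitems, hb, read, div, add, ← hm, tick_steps]
      rw [hE]
      generalize (sort (geBy I.c) I.followerItems).steps = s₁ at s1 ⊢
      generalize (bestHead I cap items I.followerItems none).steps = s₂ at s2 ⊢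
      generalize (minGap I (I.lo h) (I.hi h - I.lo h) I.followerItems).steps = s₃ at s3 ⊢
      generalize (scenario I (I.lo h + m / 2) (headList I cap items h)).steps = s₄ at s4 ⊢
      generalize I.leaderItems.length = p at *
      generalize I.followerItems.length = q at *
      -- The crude bound suffices: sorting is done once, and the quadratic loop over the heads
      -- dominates. Linear terms are absorbed because there is at least one follower's item.
      have hclog : Nat.clog 2 q ≤ q := Nat.clog_le_of_le_pow (Nat.lt_two_pow_self).le
      have k1 : q * Nat.clog 2 q ≤ q * q := Nat.mul_le_mul_left _ hclog
      have k2 : q ≤ q * q := Nat.le_mul_of_pos_left q hf1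
      have k3 : p ≤ p * q := Nat.le_mul_of_pos_right p hf1
      have k4 : 200 * (p + q) ^ 2 = 200 * (p * p) + 400 * (p * q) + 200 * (q * q) := by ring
      have k5 : q * (60 * q + 22) = 60 * (q * q) + 22 * q := by ring
      rw [k4]
      rw [k5] at s2
      omega
    exact_mod_cast hst

end Adversary

end Prog

end RCBSP

namespace RCBSP

/-! ### Integral capacities and the exchange of heads. -/

section Selection

theorem pieces_natCast : ∀ (l : List ℝ) (j : ℕ), pieces l j = (l.take j).sum
  | [], j => by simp [pieces]
  | s :: ss, 0 => by
    rw [Nat.cast_zero, pieces_of_nonpos _ le_rfl]; simp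
  | s :: ss, j + 1 => by
    have h : (1 : ℝ) ≤ ((j + 1 : ℕ) : ℝ) := by push_cast; linarith [j.cast_nonneg (α := ℝ)]
    rw [pieces, min_eq_left h, max_eq_right zero_le_one, List.take_succ_cons, List.sum_cons,
      ← pieces_natCast ss j]
    push_cast
    rw [add_sub_cancel_right, mul_one]

theorem pieces_natCast_add : ∀ (l : List ℝ) (j : ℕ) {s : ℝ}, 0 ≤ s → s ≤ 1 →
    pieces l (j + s) = pieces l j + s * (pieces l (j + 1) - pieces l j)
  | [], j, s, _, _ => by simp [pieces]
  | a :: l, 0, s, h0, h1 => by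
    simp only [pieces, Nat.cast_zero, zero_add]
    rw [pieces_of_nonpos l (by linarith : s - 1 ≤ 0), pieces_of_nonpos l (by norm_num : 0 - 1 ≤ (0:ℝ)),
      pieces_of_nonpos l (by norm_num : 1 - 1 ≤ (0:ℝ)), min_eq_right h1, max_eq_right h0]
    norm_num
    ring
  | a :: l, j + 1, s, h0, h1 => by
    have hj := j.cast_nonneg (α := ℝ)
    have h := pieces_natCast_add l j h0 h1
    simp only [pieces]
    push_cast
    rw [min_eq_left (by linarith), min_eq_left (by linarith), min_eq_left (by linarith),
      show (j : ℝ) + 1 + s - 1 = j + s by ring, show (j : ℝ) + 1 - 1 = j by ring,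
      show (j : ℝ) + 1 + 1 - 1 = j + 1 by ring, h]
    ring

end Selection

namespace Inst

section Problem

variable {E : Type} [DecidableEq E] {I : Inst E ℝ}

/-- For integral capacities the selection of a head is a set of items. -/
theorem exists_set_of_mem_adversaryHeads {k : ℕ} {h : E} (hh : h ∈ I.adversaryHeads k) :
    ∃ S : Finset E, I.pred h ⊆ S ∧ S ⊆ I.pred h ∪ I.inc h ∧ S.card = k ∧
      ∑ e ∈ S, I.c e = I.headFun h (I.b - k) := by
  obtain ⟨-, h1, h2⟩ := mem_adversaryHeads.1 hh
  have h1' : (I.pred h).card ≤ k := by exact_mod_cast h1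
  obtain ⟨j, rfl⟩ := Nat.exists_eq_add_of_le h1'
  push_cast at h2
  rw [add_sub_cancel_left] at h2
  -- With an integral remaining capacity `j` the optimal choice on `inc h` consists of the `j` items
  -- with the largest leader's costs.
  obtain ⟨l, hl, hn, hs⟩ := exists_sorted_list (I.inc h) (fun e => -I.c e)
  have hA := toFinset_of_coe_eq hl
  have hc : (I.inc h).card = l.length := by rw [Finset.card_def, ← hl, Multiset.coe_card]
  have hj : j ≤ l.length := by rw [← hc]; exact_mod_cast h2
  have hsub : (l.take j).toFinset ⊆ I.inc h := by
    rw [← hA]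
    intro e he
    rw [List.mem_toFinset] at he ⊢
    exact List.mem_of_mem_take he
  have hnt : (l.take j).Nodup := hn.sublist (List.take_sublist _ _)
  have hdis : Disjoint (I.pred h) (l.take j).toFinset :=
    Finset.disjoint_of_subset_right hsub (disjoint_pred_inc h)
  refine ⟨I.pred h ∪ (l.take j).toFinset, Finset.subset_union_left,
    Finset.union_subset_union_right hsub, ?_, ?_⟩
  · rw [Finset.card_union_of_disjoint hdis, List.toFinset_card_of_nodup hnt, List.length_take,
      min_eq_left hj]
  · rw [Finset.sum_union hdis, headFun, plfBar, map_eq_sort_ge hl, List.sum_toFinset _ hnt]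
    · push_cast
      rw [show (I.b : ℝ) - (I.b - ((I.pred h).card + j) + (I.pred h).card) = j by ring,
        pieces_natCast, List.map_take, add_comm]
    · exact hs.imp fun {a b} (h : -I.c a ≤ -I.c b) => neg_le_neg_iff.1 h

theorem sum_le_headFun {h : E} (hh : h ∈ I.Ef) {S : Finset E} (h1 : I.pred h ⊆ S)
    (h2 : S ⊆ I.pred h ∪ I.inc h) :
    h ∈ I.adversaryHeads S.card ∧ ∑ e ∈ S, I.c e ≤ I.headFun h (I.b - S.card) := by
  have hS : S ⊆ I.Ef := h2.trans (pred_union_inc_subset h)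
  have hind : I.followerPart (fun e => if e ∈ S then 1 else 0) = ∑ e ∈ S, I.c e := by
    rw [followerPart, ← Finset.sum_subset hS]
    · exact Finset.sum_congr rfl fun e he => by simp [he]
    · intro e _ he
      simp [he]
  rw [← hind]
  refine followerPart_le_headFun hh (fun e _ => ?_) ?_ (fun e he => if_pos (h1 he)) fun e he => ?_
  · split <;> norm_num
  · rw [Finset.sum_ite_mem, Finset.inter_eq_right.2 hS]
    simp
  · exact if_neg fun h3 => (Finset.mem_sdiff.1 he).2 (h2 h3)

/-- The optimal set `S` of the head `h` is kept, and a head is found that admits `S` as well as `S`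
with one more item `e`; it is then defined for the capacities `k` and `k + 1`. The item `e` outside
`S` has minimal right endpoint, and `h'` has the largest left endpoint up to `hi e`. Minimality
gives `pred h' ⊆ S`. -/
theorem Valid.exists_head_right (hV : I.Valid) {k : ℕ} {h : E} (hh : h ∈ I.adversaryHeads k)
    (hk : k < I.Ef.card) : ∃ h' ∈ I.Ef, (I.pred h').card ≤ k ∧
      k + 1 ≤ (I.pred h').card + (I.inc h').card ∧
      I.headFun h (I.b - k) ≤ I.headFun h' (I.b - k) := by
  obtain ⟨S, h1, h2, rfl, hc⟩ := exists_set_of_mem_adversaryHeads hh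
  have hS : S ⊆ I.Ef := h2.trans (pred_union_inc_subset h)
  have hne : (I.Ef \ S).Nonempty := by
    rw [← Finset.card_pos, Finset.card_sdiff_of_subset hS]
    omega
  obtain ⟨e, he, hmin⟩ := Finset.exists_min_image (I.Ef \ S) I.hi hne
  rw [Finset.mem_sdiff] at he
  obtain ⟨h', hh', hle, hmax⟩ := exists_head ⟨e, he.1, hV.lo_le_hi e he.1⟩
  have hp : I.pred h' ⊆ S := by
    intro e' he'
    rw [mem_pred] at he'
    by_contra h3
    have := hmin e' (Finset.mem_sdiff.2 ⟨he'.1, h3⟩)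
    linarith
  -- Otherwise `e` would precede `h` and belong to `S`. Hence the left endpoints of all items of `S`
  -- are at most `hi e`, and so at most `lo h'`.
  have hlh : I.lo h ≤ I.hi e := by
    by_contra h3
    exact he.2 (h1 (mem_pred.2 ⟨he.1, not_le.1 h3⟩))
  have hi : S ⊆ I.pred h' ∪ I.inc h' := by
    intro e' he'
    have h3 := hV.mem_pred_union_inc.1 (h2 he')
    exact hV.mem_pred_union_inc.2 ⟨h3.1, hmax e' h3.1 (h3.2.trans hlh)⟩
  have hi' : insert e S ⊆ I.pred h' ∪ I.inc h' :=
    Finset.insert_subset (hV.mem_pred_union_inc.2 ⟨he.1, hmax e he.1 (hV.lo_le_hi e he.1)⟩) hi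
  refine ⟨h', hh', Finset.card_le_card hp, ?_, ?_⟩
  · have := Finset.card_le_card hi'
    rwa [Finset.card_insert_of_notMem he.2, Finset.card_union_of_disjoint (disjoint_pred_inc h')]
      at this
  · rw [← hc]
    exact (sum_le_headFun hh' hp hi).2

/-- The counterpart for the upper end of the capacity interval: take as head an item of `S` with the
largest left endpoint. It admits `S`, and it does not precede itself, so at most `k` items precede
it. -/
theorem Valid.exists_head_left (hV : I.Valid) {k : ℕ} {h : E}
    (hh : h ∈ I.adversaryHeads (k + 1 : ℕ)) : ∃ h' ∈ I.Ef, (I.pred h').card ≤ k ∧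
      k + 1 ≤ (I.pred h').card + (I.inc h').card ∧
      I.headFun h (I.b - (k + 1 : ℕ)) ≤ I.headFun h' (I.b - (k + 1 : ℕ)) := by
  obtain ⟨S, h1, h2, hS1, hc⟩ := exists_set_of_mem_adversaryHeads hh
  have hne : S.Nonempty := by
    rw [← Finset.card_pos]; omega
  obtain ⟨h', hh', hmax⟩ := Finset.exists_max_image S I.lo hne
  have hf := hV.mem_pred_union_inc.1 (h2 hh')
  have hp : I.pred h' ⊆ S.erase h' := by
    intro e he
    rw [mem_pred] at he
    refine Finset.mem_erase.2 ⟨?_, h1 (mem_pred.2 ⟨he.1, he.2.trans_le hf.2⟩)⟩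
    rintro rfl
    exact absurd he.2 (not_lt.2 (hV.lo_le_hi _ he.1))
  have hi : S ⊆ I.pred h' ∪ I.inc h' := fun e he =>
    hV.mem_pred_union_inc.2 ⟨(hV.mem_pred_union_inc.1 (h2 he)).1, hmax e he⟩
  refine ⟨h', hf.1, ?_, ?_, ?_⟩
  · have := Finset.card_le_card hp
    rw [Finset.card_erase_of_mem hh'] at this
    omega
  · have := Finset.card_le_card hi
    rwa [hS1, Finset.card_union_of_disjoint (disjoint_pred_inc h')] at this
  · have := (sum_le_headFun hf.1 (hp.trans (Finset.erase_subset _ _)) hi).2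
    rwa [hc, hS1] at this

end Problem

end Inst

namespace Prog

/-! ### Upper envelopes of linear pieces over a unit interval. -/

section Envelope

/-- The linear function on `[0, 1]` with the end values `p`. -/
noncomputable def lin (p : ℝ × ℝ) (s : ℝ) : ℝ := p.1 + s * (p.2 - p.1)

theorem evalPiece_val (p : ℝ × ℝ) (s : ℝ) : (evalPiece p s).val = lin p s := rfl

theorem evalPiece_steps (p : ℝ × ℝ) (s : ℝ) : (evalPiece p s).steps = 4 := rfl

/-- The list `k` of points, from right to left, starts at the abscissa `a`, ends at the abscissa `0`,
lies on the upper envelope of the pieces `P`, and consecutive points lie on a common piece. -/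
structure IsEnvelope (P k : List (ℝ × ℝ)) (a : ℝ) : Prop where
  head : ∃ v k', k = (a, v) :: k'
  last : ∀ x ∈ k.getLast?, x.1 = 0
  range : ∀ x ∈ k, 0 ≤ x.1 ∧ x.1 ≤ 1
  upper : ∀ x ∈ k, ∀ q ∈ P, lin q x.1 ≤ x.2
  attained : ∀ x ∈ k, ∃ q ∈ P, lin q x.1 = x.2
  chain : k.IsChain fun x x' => x'.1 ≤ x.1 ∧ ∃ q ∈ P, lin q x.1 = x.2 ∧ lin q x'.1 = x'.2

theorem IsEnvelope.tail {P k : List (ℝ × ℝ)} {a : ℝ} {x y : ℝ × ℝ}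
    (h : IsEnvelope P (x :: y :: k) a) : IsEnvelope P (y :: k) y.1 where
  head := ⟨_, _, rfl⟩
  last z hz := h.last z (by rw [List.getLast?_cons_cons]; exact hz)
  range z hz := h.range z (List.mem_cons_of_mem _ hz)
  upper z hz := h.upper z (List.mem_cons_of_mem _ hz)
  attained z hz := h.attained z (List.mem_cons_of_mem _ hz)
  chain := (List.isChain_cons_cons.1 h.chain).2

/-- Going left along the envelope, its values decrease at most as fast as those of the steeper piece
`p`. Once `p` is not above the envelope, it stays so; this is why the removal of vertices can stop
at the first one that is not below `p`. -/
theorem IsEnvelope.lin_le {P : List (ℝ × ℝ)} {p : ℝ × ℝ}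
    (hp : ∀ q ∈ P, q.2 - q.1 ≤ p.2 - p.1) : ∀ {k : List (ℝ × ℝ)} {s v : ℝ},
    IsEnvelope P ((s, v) :: k) s → lin p s ≤ v → ∀ x ∈ (s, v) :: k, lin p x.1 ≤ x.2
  | [], s, v, _, hs, x, hx => by
    rw [List.mem_singleton] at hx
    rw [hx]; exact hs
  | (s', v') :: k, s, v, h, hs, x, hx => by
    rcases List.mem_cons.1 hx with rfl | hx
    · exact hs
    · refine h.tail.lin_le hp ?_ x hx
      obtain ⟨h1, q, hq, h2, h3⟩ := (List.isChain_cons_cons.1 h.chain).1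
      have := hp q hq
      simp only [lin] at h1 h2 h3 hs ⊢
      nlinarith

theorem IsEnvelope.mono {P P' k : List (ℝ × ℝ)} {a : ℝ} (h : IsEnvelope P k a)
    (hP : ∀ q ∈ P, q ∈ P') (hu : ∀ x ∈ k, ∀ q ∈ P', lin q x.1 ≤ x.2) : IsEnvelope P' k a where
  head := h.head
  last := h.last
  range := h.range
  upper := hu
  attained x hx := by
    obtain ⟨q, hq, h'⟩ := h.attained x hx
    exact ⟨q, hP q hq, h'⟩
  chain := h.chain.imp fun _ _ ⟨h1, q, hq, h2⟩ => ⟨h1, q, hP q hq, h2⟩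

theorem IsEnvelope.cons {P k : List (ℝ × ℝ)} {a a' v : ℝ} (h : IsEnvelope P k a) (h1 : a' ≤ 1)
    (haa' : a ≤ a') (hu : ∀ q ∈ P, lin q a' ≤ v)
    (hq : ∃ q ∈ P, lin q a' = v ∧ ∀ x ∈ k.head?, lin q x.1 = x.2) :
    IsEnvelope P ((a', v) :: k) a' := by
  obtain ⟨w, k', rfl⟩ := h.head
  obtain ⟨q, hq, h2, h3⟩ := hq
  have ha := (h.range (a, w) (by simp)).1
  exact
    { head := ⟨_, _, rfl⟩
      last := fun z hz => h.last z (by rwa [List.getLast?_cons_cons] at hz)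
      range := by
        intro x hx
        rcases List.mem_cons.1 hx with rfl | hx
        · exact ⟨by simp only at ha ⊢; linarith, h1⟩
        · exact h.range x hx
      upper := by
        intro x hx
        rcases List.mem_cons.1 hx with rfl | hx
        · exact hu
        · exact h.upper x hx
      attained := by
        intro x hx
        rcases List.mem_cons.1 hx with rfl | hx
        · exact ⟨q, hq, h2⟩
        · exact h.attained x hx
      chain := List.isChain_cons_cons.2 ⟨⟨haa', q, hq, h2, h3 _ rfl⟩, h.chain⟩ }

/-- The situation after all vertices have been removed: one piece dominates at both ends. -/
theorem isEnvelope_singleton {P : List (ℝ × ℝ)} {p : ℝ × ℝ} (hp : p ∈ P)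
    (h : ∀ q ∈ P, q.1 ≤ p.1 ∧ q.2 ≤ p.2) : IsEnvelope P [(1, p.2), (0, p.1)] 1 := by
  have h0 : IsEnvelope P [(0, p.1)] 0 :=
    { head := ⟨_, _, rfl⟩
      last := by simp
      range := by simp
      upper := by
        intro x hx q hq
        rw [List.mem_singleton] at hx
        simp [hx, lin, (h q hq).1]
      attained := by
        intro x hx
        rw [List.mem_singleton] at hx
        exact ⟨p, hp, by simp [hx, lin]⟩
      chain := List.isChain_singleton _ }
  exact h0.cons le_rfl zero_le_one (fun q hq => by simp [lin, (h q hq).2])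
    ⟨p, hp, by simp [lin], by simp [lin]⟩

/-- Here `(s₁, v₁)` is the vertex removed last, so it lies strictly below `p`, and the list with
this vertex put back is still an envelope of the old pieces. -/
theorem pushPiece_some {P : List (ℝ × ℝ)} {p : ℝ × ℝ} (hp : ∀ q ∈ P, q.2 - q.1 ≤ p.2 - p.1) :
    ∀ {k : List (ℝ × ℝ)} {s₁ v₁ : ℝ}, IsEnvelope P ((s₁, v₁) :: k) s₁ → v₁ < lin p s₁ →
      IsEnvelope (p :: P) (pushPiece p (some (s₁, v₁)) k).val 1
  | [], s₁, v₁, h, hlt => by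
    have hs : s₁ = 0 := h.last (s₁, v₁) rfl
    subst hs
    simp only [pushPiece, bind_val, pure_val]
    refine isEnvelope_singleton (by simp) fun q hq => ?_
    rcases List.mem_cons.1 hq with rfl | hq
    · exact ⟨le_rfl, le_rfl⟩
    · have h1 := h.upper (0, v₁) (by simp) q hq
      have h2 := hp q hq
      simp only [lin, zero_mul, add_zero] at h1 hlt
      constructor <;> linarith
  | (s, v) :: k, s₁, v₁, h, hlt => by
    by_cases hv : v < lin p s
    · have : (pushPiece p (some (s₁, v₁)) ((s, v) :: k)).val = (pushPiece p (some (s, v)) k).val := by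
        rw [pushPiece]
        simp only [bind_val, lt, decide_eq_true_eq]
        rw [if_pos (show v < (evalPiece p s).val from hv)]
      rw [this]
      exact pushPiece_some hp h.tail hv
    · have hval : (pushPiece p (some (s₁, v₁)) ((s, v) :: k)).val =
          (1, p.2) :: (s + (s₁ - s) * (v - lin p s) / (v - lin p s + (lin p s₁ - v₁)),
            lin p (s + (s₁ - s) * (v - lin p s) / (v - lin p s + (lin p s₁ - v₁)))) ::
            (s, v) :: k := by
        rw [pushPiece]
        simp only [bind_val, lt, decide_eq_true_eq]
        rw [if_neg (show ¬v < (evalPiece p s).val from hv)]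
        rfl
      rw [hval]
      rw [not_lt] at hv
      obtain ⟨hss, q₀, hq₀, e1, e2⟩ := (List.isChain_cons_cons.1 h.chain).1
      simp only at hss e1 e2
      set δ := v - lin p s with hδ
      set δ₁ := lin p s₁ - v₁ with hδ₁
      have d0 : 0 ≤ δ := by linarith
      have d1 : 0 < δ₁ := by linarith
      -- The difference between `p` and the envelope is linear between `s` and `s₁`, from `-δ ≤ 0`
      -- to `δ₁ > 0`; it vanishes at the fraction `θ` of the way. Positivity of `δ₁` makes the
      -- denominator nonzero.
      set θ := δ / (δ + δ₁) with hθ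
      have hsum : 0 < δ + δ₁ := by linarith
      have θ0 : 0 ≤ θ := div_nonneg d0 hsum.le
      have θ1 : θ ≤ 1 := (div_le_one hsum).2 (by linarith)
      have hθm : θ * (δ + δ₁) = δ := div_mul_cancel₀ _ hsum.ne'
      have hs' : s + (s₁ - s) * δ / (δ + δ₁) = s + (s₁ - s) * θ := by
        rw [hθ, mul_div_assoc]
      rw [hs']
      have hs₁ := (h.range (s₁, v₁) (by simp)).2
      simp only at hs₁
      have hconv : ∀ q : ℝ × ℝ, lin q (s + (s₁ - s) * θ) = lin q s + θ * (lin q s₁ - lin q s) := by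
        intro q; simp only [lin]; ring
      -- At the new abscissa `p` meets the old edge from `(s, v)` to `(s₁, v₁)`, which lies on the
      -- piece `q₀`.
      have hcross : lin p (s + (s₁ - s) * θ) = v + θ * (v₁ - v) := by
        rw [hconv]
        nlinarith
      have ht : IsEnvelope (p :: P) ((s, v) :: k) s := by
        refine h.tail.mono (fun q hq => by simp [hq]) fun x hx q hq => ?_
        rcases List.mem_cons.1 hq with rfl | hq
        · exact h.tail.lin_le hp hv x hx
        · exact h.tail.upper x hx q hq
      have hs2 : s + (s₁ - s) * θ ≤ s₁ := by nlinarith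
      have hs3 : s ≤ s + (s₁ - s) * θ := by
        have : 0 ≤ (s₁ - s) * θ := mul_nonneg (by linarith) θ0
        linarith
      refine IsEnvelope.cons (IsEnvelope.cons ht (hs2.trans hs₁) hs3 ?_ ?_) le_rfl
        (hs2.trans hs₁) ?_ ?_
      · intro q hq
        rcases List.mem_cons.1 hq with rfl | hq
        · exact le_rfl
        · rw [hcross, hconv]
          have h1 := h.upper (s, v) (by simp) q hq
          have h2 := h.upper (s₁, v₁) (by simp) q hq
          simp only at h1 h2
          nlinarith
      · refine ⟨q₀, by simp [hq₀], ?_, ?_⟩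
        · rw [hcross, hconv, e1, e2]
        · intro x hx
          cases hx
          exact e2
      · intro q hq
        rcases List.mem_cons.1 hq with rfl | hq
        · simp [lin]
        · have h2 := h.upper (s₁, v₁) (by simp) q hq
          have h3 := hp q hq
          simp only [lin] at h2 hlt ⊢
          nlinarith
      · refine ⟨p, by simp, by simp [lin], ?_⟩
        intro x hx
        cases hx
        rfl

/-- If `p` is not above the envelope at `1`, it is nowhere above it and the list stays unchanged;
otherwise the vertex at `1` is the first one removed. -/
theorem pushPiece_none {P k : List (ℝ × ℝ)} {p : ℝ × ℝ} (hp : ∀ q ∈ P, q.2 - q.1 ≤ p.2 - p.1)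
    (h : IsEnvelope P k 1) : IsEnvelope (p :: P) (pushPiece p none k).val 1 := by
  obtain ⟨v, k', rfl⟩ := h.head
  rw [pushPiece]
  by_cases hv : v < lin p 1
  · simp only [bind_val, lt, decide_eq_true_eq]
    rw [if_pos (show v < (evalPiece p 1).val from hv)]
    exact pushPiece_some hp h hv
  · simp only [bind_val, lt, decide_eq_true_eq]
    rw [if_neg (show ¬v < (evalPiece p 1).val from hv)]
    refine h.mono (fun q hq => by simp [hq]) fun x hx q hq => ?_
    rcases List.mem_cons.1 hq with rfl | hq
    · exact h.lin_le hp (not_lt.1 hv) x hx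
    · exact h.upper x hx q hq

/-- Inserting by nondecreasing slopes keeps each new piece at least as steep as all pieces already
present. -/
theorem pushAll_spec : ∀ {ps P k : List (ℝ × ℝ)},
    ps.Pairwise (fun p p' => p.2 - p.1 ≤ p'.2 - p'.1) →
    (∀ q ∈ P, ∀ p ∈ ps, q.2 - q.1 ≤ p.2 - p.1) → IsEnvelope P k 1 →
    ∃ P' : List (ℝ × ℝ), (∀ q, q ∈ P' ↔ q ∈ ps ∨ q ∈ P) ∧ IsEnvelope P' (pushAll ps k).val 1
  | [], P, k, _, _, h => ⟨P, by simp, h⟩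
  | p :: ps, P, k, hs, hP, h => by
    rw [List.pairwise_cons] at hs
    obtain ⟨P', h1, h2⟩ := pushAll_spec (ps := ps) (P := p :: P) (k := (pushPiece p none k).val) hs.2
      (by
        intro q hq p' hp'
        rcases List.mem_cons.1 hq with rfl | hq
        · exact hs.1 p' hp'
        · exact hP q hq p' (by simp [hp']))
      (pushPiece_none (fun q hq => hP q hq p (by simp)) h)
    refine ⟨P', fun q => ?_, h2⟩
    rw [h1, List.mem_cons, List.mem_cons]
    tauto

theorem leSlope_val (p p' : ℝ × ℝ) :
    (leSlope p p').val = true ↔ p.2 - p.1 ≤ p'.2 - p'.1 := by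
  simp [leSlope, le, sub]

theorem leSlope_steps (p p' : ℝ × ℝ) : (leSlope p p').steps ≤ 4 := by
  simp [leSlope, le, sub]

theorem envelope_spec {ps : List (ℝ × ℝ)} (hne : ps ≠ []) :
    ∃ P k : List (ℝ × ℝ), (∀ q, q ∈ P ↔ q ∈ ps) ∧ IsEnvelope P k 1 ∧
      (envelope ps).val = k.reverse := by
  have hperm := sort_perm leSlope ps
  have hsort : (sort leSlope ps).val.Pairwise fun p p' => p.2 - p.1 ≤ p'.2 - p'.1 :=
    sort_pairwise _ _ leSlope_val (fun _ _ _ => le_trans) (fun _ _ => le_total _ _) ps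
  simp only [envelope, bind_val, revOnto_val, List.append_nil]
  rcases hq : (sort leSlope ps).val with _ | ⟨p, qs⟩
  · rw [hq] at hperm
    exact absurd hperm.symm.eq_nil hne
  rw [hq] at hperm hsort
  rw [List.pairwise_cons] at hsort
  have h1 : IsEnvelope [p] (pushPiece p none []).val 1 := by
    simp only [pushPiece, bind_val, pure_val]
    exact isEnvelope_singleton (by simp) (by simp)
  obtain ⟨P, hP, hE⟩ := pushAll_spec hsort.2 (by simpa using hsort.1) h1
  refine ⟨P, _, fun q => ?_, hE, rfl⟩
  rw [hP, ← hperm.mem_iff]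
  simp only [List.mem_cons, List.not_mem_nil, or_false]
  tauto

/-- Adding a linear function, the sum attains its minimum in a vertex of the envelope. -/
theorem IsEnvelope.exists_vertex_le {P : List (ℝ × ℝ)} (p : ℝ × ℝ) {s M : ℝ} (hs : 0 ≤ s)
    (hM : ∀ q ∈ P, lin q s ≤ M) : ∀ {k : List (ℝ × ℝ)} {a : ℝ}, IsEnvelope P k a → s ≤ a →
      ∃ x ∈ k, lin p x.1 + x.2 ≤ lin p s + M
  | [], a, h, _ => by
    obtain ⟨v, k', h⟩ := h.head
    cases h
  | [(a', v)], a, h, hsa => by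
    obtain ⟨w, k', h'⟩ := h.head
    cases h'
    have h0 : a' = 0 := h.last (a', v) rfl
    obtain ⟨q, hq, h1⟩ := h.attained (a', v) (by simp)
    have hsa' : s = a' := by linarith
    have h2 := hM q hq
    refine ⟨(a', v), by simp, ?_⟩
    rw [← h1, ← hsa']
    linarith
  | (a', v) :: (t, w) :: k, a, h, hsa => by
    obtain ⟨_, k', h'⟩ := h.head
    cases h'
    rcases le_or_gt s t with h1 | h1
    · obtain ⟨x, hx, hle⟩ := h.tail.exists_vertex_le p hs hM h1
      exact ⟨x, List.mem_cons_of_mem _ hx, hle⟩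
    -- Between neighbouring vertices the envelope lies on one piece `q`, so the sum with `p` is
    -- linear there and one of the two end values is at most the value at `s`.
    · obtain ⟨-, q, hq, e1, e2⟩ := (List.isChain_cons_cons.1 h.chain).1
      simp only at e1 e2
      have h2 := hM q hq
      by_contra! hc
      have c1 := hc (a', v) (by simp)
      have c2 := hc (t, w) (by simp)
      rw [← e1] at c1
      rw [← e2] at c2
      simp only [lin] at c1 c2 h2
      rcases le_total 0 ((p.2 - p.1) + (q.2 - q.1)) with h3 | h3 <;> nlinarith

end Envelope

end Prog

end RCBSP

namespace RCBSP

namespace Prog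

/-! ### Vertex lists of piecewise linear functions with integral break points. -/

section Nodes

/-- The points of the graph of `F` over the integers `a, …, a + m - 1`. -/
noncomputable def nodes (F : ℝ → ℝ) (a m : ℕ) : List (ℝ × ℝ) :=
  (List.range' a m).map fun i : ℕ => ((i : ℝ), F i)

theorem nodes_zero (F : ℝ → ℝ) (a : ℕ) : nodes F a 0 = [] := rfl

theorem nodes_succ (F : ℝ → ℝ) (a m : ℕ) :
    nodes F a (m + 1) = ((a : ℝ), F a) :: nodes F (a + 1) m := by
  simp [nodes, List.range'_succ]

theorem nodes_congr {F F' : ℝ → ℝ} {a m : ℕ} (h : ∀ i : ℕ, a ≤ i → F i = F' i) :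
    nodes F a m = nodes F' a m := by
  refine List.map_congr_left fun i hi => ?_
  rw [List.mem_range'_1] at hi
  rw [h i hi.1]

/-- The points of the graph of `F` over the integers in `[A, B]` that are at least `t`. -/
noncomputable def nodesFrom (F : ℝ → ℝ) (A B t : ℕ) : List (ℝ × ℝ) :=
  nodes F (max A t) (B + 1 - max A t)

theorem nodesFrom_of_lt (F : ℝ → ℝ) {A B t : ℕ} (h : B < t) : nodesFrom F A B t = [] := by
  rw [nodesFrom, show B + 1 - max A t = 0 by omega, nodes_zero]

theorem nodesFrom_of_le (F : ℝ → ℝ) {A B t : ℕ} (h : A ≤ t) (h' : t ≤ B) :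
    nodesFrom F A B t = ((t : ℝ), F t) :: nodesFrom F A B (t + 1) := by
  rw [nodesFrom, nodesFrom, max_eq_right h, max_eq_right (by omega : A ≤ t + 1),
    show B + 1 - t = B + 1 - (t + 1) + 1 by omega, nodes_succ]

theorem nodesFrom_succ (F : ℝ → ℝ) {A B t : ℕ} (h : t < A) :
    nodesFrom F A B (t + 1) = nodesFrom F A B t := by
  rw [nodesFrom, nodesFrom, max_eq_left h.le, max_eq_left (by omega : t + 1 ≤ A)]

theorem nodesFrom_of_gt (F : ℝ → ℝ) {A B t : ℕ} (h : t < A) (h' : A ≤ B) :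
    nodesFrom F A B t = ((A : ℝ), F A) :: nodes F (A + 1) (B - A) := by
  rw [nodesFrom, max_eq_left h.le, show B + 1 - A = B - A + 1 by omega, nodes_succ]

variable {ι : Type} (F : ι → ℝ → ℝ) (A B : ι → ℕ)

/-- A list contributes a segment only if it starts at `t` and has a second vertex. A domain that
ends or consists of one point at `t` is skipped, as is a domain that starts later. -/
theorem segments_val (t : ℕ) : ∀ hs : List ι, (∀ h ∈ hs, A h ≤ B h) →
    (segments (t : ℝ) (hs.map fun h => nodesFrom (F h) (A h) (B h) t)).val =
      (hs.filter fun h => decide (A h ≤ t ∧ t + 1 ≤ B h)).map fun h => (F h t, F h (t + 1))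
  | [], _ => rfl
  | h :: hs, hAB => by
    have ih := segments_val t hs fun h' hh' => hAB h' (by simp [hh'])
    have hle := hAB h (by simp)
    rw [List.map_cons, segments]
    simp only [bind_val, ih]
    rcases lt_or_ge (B h) t with h1 | h1
    · rw [nodesFrom_of_lt _ h1, List.filter_cons_of_neg (by simp; omega)]
      rfl
    rcases lt_or_ge t (A h) with h2 | h2
    · rw [nodesFrom_of_gt _ h2 hle, List.filter_cons_of_neg (by simp; omega)]
      rcases hm : B h - A h with _ | m
      · rw [nodes_zero]
        rfl
      · rw [nodes_succ]
        simp only [bind_val, le, decide_eq_true_eq, Nat.cast_le]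
        rw [if_neg (by omega)]
        rfl
    · rw [nodesFrom_of_le _ h2 h1]
      rcases h1.eq_or_lt with h3 | h3
      · rw [nodesFrom_of_lt _ (by omega), List.filter_cons_of_neg (by simp; omega)]
        rfl
      · rw [nodesFrom_of_le _ (by omega) h3, List.filter_cons_of_pos (by simp; omega)]
        simp only [bind_val, le, decide_eq_true_eq, le_refl, if_true, pure_val, List.map_cons]
        push_cast
        rfl

theorem advance_val (t : ℕ) : ∀ hs : List ι, (∀ h ∈ hs, A h ≤ B h) →
    (advance (t : ℝ) (hs.map fun h => nodesFrom (F h) (A h) (B h) t)).val =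
      (hs.filter fun h => decide (t ≤ B h)).map fun h => nodesFrom (F h) (A h) (B h) (t + 1)
  | [], _ => rfl
  | h :: hs, hAB => by
    have ih := advance_val t hs fun h' hh' => hAB h' (by simp [hh'])
    have hle := hAB h (by simp)
    rw [List.map_cons, advance]
    simp only [bind_val, ih]
    rcases lt_or_ge (B h) t with h1 | h1
    · rw [nodesFrom_of_lt _ h1, List.filter_cons_of_neg (by simp; omega)]
      rfl
    rw [List.filter_cons_of_pos (by simpa using h1), List.map_cons]
    rcases lt_or_ge t (A h) with h2 | h2
    · rw [nodesFrom_succ _ h2, nodesFrom_of_gt _ h2 hle]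
      simp only [bind_val, le, decide_eq_true_eq, Nat.cast_le]
      rw [if_neg (by omega)]
      rfl
    · rw [nodesFrom_of_le _ h2 h1]
      simp only [bind_val, le, decide_eq_true_eq, le_refl, if_true, pure_val]

theorem maxAt_spec (t : ℕ) : ∀ hs : List ι, (∀ h ∈ hs, A h ≤ B h) →
    ((maxAt (t : ℝ) (hs.map fun h => nodesFrom (F h) (A h) (B h) t)).val = [] ∧
      ∀ h ∈ hs, ¬(A h ≤ t ∧ t ≤ B h)) ∨
    ∃ M, (maxAt (t : ℝ) (hs.map fun h => nodesFrom (F h) (A h) (B h) t)).val = [((t : ℝ), M)] ∧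
      IsGreatest {v | ∃ h ∈ hs, (A h ≤ t ∧ t ≤ B h) ∧ v = F h t} M
  | [], _ => Or.inl ⟨rfl, by simp⟩
  | h :: hs, hAB => by
    have ih := maxAt_spec t hs fun h' hh' => hAB h' (by simp [hh'])
    have hle := hAB h (by simp)
    by_cases hin : A h ≤ t ∧ t ≤ B h
    · right
      rw [List.map_cons, maxAt, nodesFrom_of_le _ hin.1 hin.2]
      rcases ih with ⟨e, hn⟩ | ⟨M, e, ⟨h', hh', hin', hM⟩, hM'⟩
      · refine ⟨F h t, ?_, ⟨h, by simp, hin, rfl⟩, ?_⟩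
        · simp only [bind_val, e, le, decide_eq_true_eq, le_refl, if_true, pure_val]
        · rintro v ⟨h', hh', hin', rfl⟩
          rcases List.mem_cons.1 hh' with rfl | hh'
          · exact le_rfl
          · exact absurd hin' (hn h' hh')
      · refine ⟨max (F h t) M, ?_, ?_, ?_⟩
        · simp only [bind_val, e, le, decide_eq_true_eq, le_refl, if_true, pure_val, maxNum]
        · rcases max_choice (F h t) M with h1 | h1
          · exact ⟨h, by simp, hin, h1⟩
          · exact ⟨h', by simp [hh'], hin', h1.trans hM⟩
        · rintro v ⟨h'', hh'', hin'', rfl⟩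
          rcases List.mem_cons.1 hh'' with rfl | hh''
          · exact le_max_left _ _
          · exact (hM' ⟨h'', hh'', hin'', rfl⟩).trans (le_max_right _ _)
    · have heq : (maxAt (t : ℝ) ((h :: hs).map fun h => nodesFrom (F h) (A h) (B h) t)).val =
          (maxAt (t : ℝ) (hs.map fun h => nodesFrom (F h) (A h) (B h) t)).val := by
        rw [List.map_cons, maxAt]
        rcases lt_or_ge (B h) t with h1 | h1
        · rw [nodesFrom_of_lt _ h1]
          rfl
        · have h2 : t < A h := by omega
          rw [nodesFrom_of_gt _ h2 hle]
          simp only [bind_val, le, decide_eq_true_eq, Nat.cast_le]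
          rw [if_neg (by omega)]
          rfl
      rw [heq]
      rcases ih with ⟨e, hn⟩ | ⟨M, e, ⟨h', hh', hin', hM⟩, hM'⟩
      · refine Or.inl ⟨e, fun h' hh' => ?_⟩
        rcases List.mem_cons.1 hh' with rfl | hh'
        · exact hin
        · exact hn h' hh'
      · refine Or.inr ⟨M, e, ⟨h', by simp [hh'], hin', hM⟩, ?_⟩
        rintro v ⟨h'', hh'', hin'', rfl⟩
        rcases List.mem_cons.1 hh'' with rfl | hh''
        · exact absurd hin'' hin
        · exact hM' ⟨h'', hh'', hin'', rfl⟩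

theorem shift_val (a r : ℝ) (p : ℝ × ℝ) : (shift a r p).val = (p.1 + a, p.2 + r) := rfl

/-- The vertex list of the pointwise maximum consists of points of its graph, by nondecreasing
abscissas, and contains a minimum of its sum with any function that is linear between integers. -/
theorem pointwiseMax_spec (G Γ : ℝ → ℝ) : ∀ (m t : ℕ) (hs : List ι), (∀ h ∈ hs, A h ≤ B h) →
    (∀ h ∈ hs, ∀ i : ℕ, A h ≤ i → i + 1 ≤ B h → ∀ s : ℝ, 0 ≤ s → s ≤ 1 →
      F h (i + s) = lin (F h i, F h (i + 1)) s) →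
    (∀ i : ℕ, t ≤ i → i < t + m → ∀ s : ℝ, 0 ≤ s → s ≤ 1 →
      IsGreatest {v | ∃ h ∈ hs, (A h ≤ i ∧ i + 1 ≤ B h) ∧ v = F h (i + s)} (Γ (i + s))) →
    IsGreatest {v | ∃ h ∈ hs, (A h ≤ t + m ∧ t + m ≤ B h) ∧ v = F h (t + m : ℕ)}
      (Γ (t + m : ℕ)) →
    ∀ out, out = (pointwiseMax (nodes G t (m + 1))
        (hs.map fun h => nodesFrom (F h) (A h) (B h) t)).val →
      (∀ p ∈ out, (t : ℝ) ≤ p.1 ∧ p.1 ≤ (t + m : ℕ) ∧ p.2 = Γ p.1) ∧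
      out.Pairwise (fun p p' => p.1 ≤ p'.1) ∧
      (∀ i : ℕ, t ≤ i → i < t + m → ∀ (q : ℝ × ℝ) (s : ℝ), 0 ≤ s → s ≤ 1 →
        ∃ p ∈ out, (i : ℝ) ≤ p.1 ∧ p.1 ≤ i + 1 ∧ lin q (p.1 - i) + p.2 ≤ lin q s + Γ (i + s)) ∧
      ∃ p ∈ out, p.1 = (t + m : ℕ)
  | 0, t, hs, hAB, _, _, hend, out, hout => by
    rw [nodes_succ, nodes_zero] at hout
    simp only [pointwiseMax, bind_val] at hout
    rcases maxAt_spec F A B t hs hAB with ⟨-, hn⟩ | ⟨M, e, hM⟩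
    · obtain ⟨⟨h, hh, hin, -⟩, -⟩ := hend
      exact absurd hin (hn h hh)
    · rw [e] at hout
      subst hout
      have := hM.unique hend
      subst this
      refine ⟨?_, by simp, fun i h1 h2 => absurd h2 (by omega), ⟨_, List.mem_singleton_self _, rfl⟩⟩
      simp
  | m + 1, t, hs, hAB, hlin, hmax, hend, out, hout => by
    set ps := (hs.filter fun h => decide (A h ≤ t ∧ t + 1 ≤ B h)).map
      fun h => (F h t, F h (t + 1)) with hps
    set hs' := hs.filter fun h => decide (t ≤ B h) with hhs'
    have hmem : ∀ h, h ∈ hs' ↔ h ∈ hs ∧ t ≤ B h := fun h => by simp [hhs']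
    -- On the current section the target function is the maximum of the linear pieces collected in
    -- `ps`, so the vertices of their envelope are points of its graph.
    have hgr : ∀ s : ℝ, 0 ≤ s → s ≤ 1 →
        IsGreatest {v | ∃ q ∈ ps, v = lin q s} (Γ (t + s)) := by
      intro s s0 s1
      convert hmax t le_rfl (by omega) s s0 s1 using 1
      ext v
      simp only [Set.mem_ofPred_eq, hps, List.mem_map, List.mem_filter, decide_eq_true_eq]
      constructor
      · rintro ⟨q, ⟨h, ⟨hh, hin⟩, rfl⟩, rfl⟩
        exact ⟨h, hh, hin, (hlin h hh t hin.1 hin.2 s s0 s1).symm⟩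
      · rintro ⟨h, hh, hin, rfl⟩
        exact ⟨_, ⟨h, ⟨hh, hin⟩, rfl⟩, hlin h hh t hin.1 hin.2 s s0 s1⟩
    have hne : ps ≠ [] := by
      obtain ⟨⟨q, hq, -⟩, -⟩ := hgr 0 le_rfl zero_le_one
      exact List.ne_nil_of_mem hq
    obtain ⟨P, k, hP, hE, hk⟩ := envelope_spec hne
    obtain ⟨i1, i2, i3, i4⟩ := pointwiseMax_spec G Γ m (t + 1) hs'
      (fun h hh => hAB h ((hmem h).1 hh).1) (fun h hh => hlin h ((hmem h).1 hh).1)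
      (by
        intro i hi hi' s s0 s1
        convert hmax i (by omega) (by omega) s s0 s1 using 1
        ext v
        simp only [Set.mem_ofPred_eq, hmem]
        constructor
        · rintro ⟨h, ⟨hh, -⟩, hin, rfl⟩
          exact ⟨h, hh, hin, rfl⟩
        · rintro ⟨h, hh, hin, rfl⟩
          exact ⟨h, ⟨hh, by omega⟩, hin, rfl⟩)
      (by
        rw [show t + 1 + m = t + (m + 1) by omega]
        convert hend using 1
        ext v
        simp only [Set.mem_ofPred_eq, hmem]
        constructor
        · rintro ⟨h, ⟨hh, -⟩, hin, rfl⟩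
          exact ⟨h, hh, hin, rfl⟩
        · rintro ⟨h, hh, hin, rfl⟩
          exact ⟨h, ⟨hh, by omega⟩, hin, rfl⟩) _ rfl
    set rest := (pointwiseMax (nodes G (t + 1) (m + 1))
      (hs'.map fun h => nodesFrom (F h) (A h) (B h) (t + 1))).val with hrest
    have hout' : out = k.reverse.map (fun x => (x.1 + (t : ℝ), x.2 + 0)) ++ rest := by
      rw [hout, nodes_succ, nodes_succ, pointwiseMax]
      simp only [bind_val, segments_val F A B t hs hAB, advance_val F A B t hs hAB, append_val,
        map_val, shift_val]
      rw [← hps, ← hhs', hk, ← nodes_succ, ← hrest]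
    have hkmem : ∀ p, p ∈ k.reverse.map (fun x => (x.1 + (t : ℝ), x.2 + 0)) ↔
        ∃ x ∈ k, p = (t + x.1, x.2) := by
      intro p
      simp only [List.mem_map, List.mem_reverse, add_zero, add_comm _ (t : ℝ), eq_comm]
    have hkΓ : ∀ x ∈ k, x.2 = Γ (t + x.1) := by
      intro x hx
      obtain ⟨r0, r1⟩ := hE.range x hx
      refine IsGreatest.unique (s := {v | ∃ q ∈ ps, v = lin q x.1}) ⟨?_, ?_⟩ (hgr x.1 r0 r1)
      · obtain ⟨q, hq, h1⟩ := hE.attained x hx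
        exact ⟨q, (hP q).1 hq, h1.symm⟩
      · rintro v ⟨q, hq, rfl⟩
        exact hE.upper x hx q ((hP q).2 hq)
    push_cast at i1
    subst hout'
    refine ⟨fun p hp => ?_, ?_, fun i hi hi' q s s0 s1 => ?_, ?_⟩
    · push_cast
      rcases List.mem_append.1 hp with hp | hp
      · obtain ⟨x, hx, rfl⟩ := (hkmem p).1 hp
        obtain ⟨r0, r1⟩ := hE.range x hx
        have := m.cast_nonneg (α := ℝ)
        exact ⟨by simp only; linarith, by simp only; linarith, hkΓ x hx⟩
      · obtain ⟨j1, j2, j3⟩ := i1 p hp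
        exact ⟨by linarith, by linarith, j3⟩
    · rw [List.pairwise_append]
      refine ⟨?_, i2, fun p hp p' hp' => ?_⟩
      · rw [List.pairwise_map, List.pairwise_reverse]
        have htr : k.Pairwise fun x x' => x'.1 ≤ x.1 := by
          have : Trans (fun x x' : ℝ × ℝ => x'.1 ≤ x.1) (fun x x' : ℝ × ℝ => x'.1 ≤ x.1)
              (fun x x' : ℝ × ℝ => x'.1 ≤ x.1) := ⟨fun h h' => le_trans h' h⟩
          exact List.isChain_iff_pairwise.1 (hE.chain.imp fun _ _ h => h.1)
        exact htr.imp fun h => by linarith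
      · obtain ⟨x, hx, rfl⟩ := (hkmem p).1 hp
        obtain ⟨r0, r1⟩ := hE.range x hx
        have := (i1 p' hp').1
        simp only
        linarith
    -- The current section is settled by the vertex property of its envelope, all later ones by the
    -- induction hypothesis.
    · rcases hi.eq_or_lt with rfl | hlt
      · obtain ⟨x, hx, hle⟩ := hE.exists_vertex_le q s0
          (fun q' hq' => (hgr s s0 s1).2 ⟨q', (hP q').1 hq', rfl⟩) s1
        obtain ⟨r0, r1⟩ := hE.range x hx
        refine ⟨_, List.mem_append_left _ ((hkmem _).2 ⟨x, hx, rfl⟩), ?_, ?_, ?_⟩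
        · simp only; linarith
        · simp only; linarith
        · simpa only [add_sub_cancel_left] using hle
      · obtain ⟨p, hp, h1⟩ := i3 i hlt (by omega) q s s0 s1
        exact ⟨p, List.mem_append_right _ hp, h1⟩
    · obtain ⟨p, hp, h1⟩ := i4
      refine ⟨p, List.mem_append_right _ hp, ?_⟩
      rw [h1]
      congr 1
      omega

/-- The sorting of `l` justifies the single pass: an edge of `G` is left behind only when all
remaining abscissas lie to its right. -/
theorem addFun_val {G : ℝ → ℝ} (hG : ∀ (i : ℕ) (s : ℝ), 0 ≤ s → s ≤ 1 →
      G (i + s) = lin (G i, G (i + 1)) s) :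
    ∀ (m a : ℕ) (l : List (ℝ × ℝ)), l.Pairwise (fun p p' => p.1 ≤ p'.1) →
      (∀ p ∈ l, (a : ℝ) ≤ p.1 ∧ p.1 ≤ (a + m : ℕ)) →
      (addFun (nodes G a (m + 1)) l).val = l.map fun p => (p.1, G p.1 + p.2)
  | m, a, [], _, _ => by
    rw [nodes_succ]
    simp [addFun]
  | 0, a, (t, v) :: k, hs, hr => by
    have ih := addFun_val hG 0 a k (List.pairwise_cons.1 hs).2 fun p hp => hr p (by simp [hp])
    have h1 := hr (t, v) (by simp)
    have h2 : t = a := le_antisymm (by simpa using h1.2) h1.1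
    rw [nodes_succ, nodes_zero] at ih ⊢
    rw [addFun]
    simp only [bind_val, ih, add, pure_val, List.map_cons, h2]
  | m + 1, a, (t, v) :: k, hs, hr => by
    have h1 := hr (t, v) (by simp)
    simp only at h1
    by_cases ht : t ≤ ((a + 1 : ℕ) : ℝ)
    · have ih := addFun_val hG (m + 1) a k (List.pairwise_cons.1 hs).2
        fun p hp => hr p (by simp [hp])
      rw [nodes_succ, nodes_succ] at ih ⊢
      rw [addFun]
      simp only [bind_val, le, decide_eq_true_eq]
      rw [if_pos ht]
      simp only [bind_val, ih, add, sub, evalPiece_val, pure_val, List.map_cons]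
      push_cast at ht ⊢
      rw [← hG a (t - a) (by linarith) (by linarith), add_sub_cancel]
    · have ih := addFun_val hG m (a + 1) ((t, v) :: k) hs (by
        intro p hp
        rw [show a + 1 + m = a + (m + 1) by omega]
        refine ⟨?_, (hr p hp).2⟩
        rcases List.mem_cons.1 hp with rfl | hp
        · exact (not_le.1 ht).le
        · exact (not_le.1 ht).le.trans ((List.pairwise_cons.1 hs).1 p hp))
      rw [nodes_succ] at ih
      rw [nodes_succ, nodes_succ, addFun]
      simp only [bind_val, le, decide_eq_true_eq]
      rw [if_neg ht, ih]

theorem argmin_spec : ∀ (p : ℝ × ℝ) (l : List (ℝ × ℝ)),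
    (argmin p l).val ∈ p :: l ∧ ∀ q ∈ p :: l, (argmin p l).val.2 ≤ q.2
  | p, [] => by simp [argmin]
  | p, q :: l => by
    rw [argmin]
    simp only [bind_val, lt, decide_eq_true_eq]
    split
    · rename_i h
      obtain ⟨h1, h2⟩ := argmin_spec q l
      refine ⟨List.mem_cons_of_mem _ h1, fun r hr => ?_⟩
      rcases List.mem_cons.1 hr with rfl | hr
      · exact (h2 q (by simp)).trans h.le
      · exact h2 r hr
    · rename_i h
      obtain ⟨h1, h2⟩ := argmin_spec p l
      refine ⟨?_, fun r hr => ?_⟩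
      · rcases List.mem_cons.1 h1 with h1 | h1
        · rw [h1]; simp
        · simp [h1]
      · rcases List.mem_cons.1 hr with rfl | hr
        · exact h2 r (by simp)
        · rcases List.mem_cons.1 hr with rfl | hr
          · exact (h2 p (by simp)).trans (not_lt.1 h)
          · exact h2 r (by simp [hr])

/-- At integers the partial sums of the slopes are values of `pieces`; in the induction the first
slope is moved into the start value. -/
theorem vertices_val : ∀ (ss : List ℝ) (a : ℕ) (v : ℝ),
    (vertices (a : ℝ) v ss).val = nodes (fun x => v + pieces ss (x - a)) a (ss.length + 1)
  | [], a, v => by simp [vertices, nodes_succ, nodes_zero, pieces]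
  | s :: ss, a, v => by
    have ih := vertices_val ss (a + 1) (v + s)
    push_cast at ih
    rw [vertices, List.length_cons, nodes_succ]
    simp only [bind_val, add, ih, pure_val]
    congr 1
    · rw [sub_self, pieces_of_nonpos _ le_rfl, add_zero]
    · refine nodes_congr fun i hi => ?_
      have : (a : ℝ) + 1 ≤ i := by exact_mod_cast hi
      rw [pieces, min_eq_left (by linarith), max_eq_right zero_le_one,
        show (i : ℝ) - a - 1 = i - (a + 1) by ring]
      ring

theorem eq_of_pairwise_lt {l l' : List ℕ} (h : l.Pairwise (· < ·)) (h' : l'.Pairwise (· < ·))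
    (hm : ∀ i, i ∈ l ↔ i ∈ l') : l = l' := by
  refine List.Perm.eq_of_pairwise' (r := (· ≤ ·)) (h.imp le_of_lt) (h'.imp le_of_lt) ?_
  exact (List.perm_ext_iff_of_nodup (h.imp ne_of_lt) (h'.imp ne_of_lt)).2 hm

theorem plfVertices_val {α : Type} (c : α → ℝ) (items : List α) {a a' : ℕ}
    (h : a' ≤ items.length) : (plfVertices c items (a : ℝ) (a' : ℝ)).val =
      nodes (pieces (items.map c)) a (a' + 1 - a) := by
  have h1 := vertices_val (items.map c) 0 0
  rw [Nat.cast_zero] at h1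
  simp only [plfVertices, bind_val, map_val, read, filter_val]
  rw [h1]
  simp only [zero_add, sub_zero, nodes, List.filter_map]
  congr 1
  refine eq_of_pairwise_lt (List.Pairwise.filter _ List.pairwise_lt_range') List.pairwise_lt_range' fun i => ?_
  simp only [List.mem_filter, List.mem_range'_1, Function.comp, inRange, bind_val, le, pure_val,
    Nat.cast_le, Bool.and_eq_true, decide_eq_true_eq, List.length_map]
  omega

end Nodes

end Prog

end RCBSP

namespace RCBSP

/-! ### The leader's objective function over sections between integers. -/

theorem natCast_tsub (a b : ℕ) : ((a - b : ℕ) : ℝ) = max 0 ((a : ℝ) - b) := by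
  rcases le_total b a with h | h
  · rw [Nat.cast_sub h, max_eq_right (sub_nonneg.2 (by exact_mod_cast h))]
  · rw [Nat.sub_eq_zero_of_le h, Nat.cast_zero, max_eq_left (sub_nonpos.2 (by exact_mod_cast h))]

namespace Inst

section Problem

variable {E : Type} [DecidableEq E] {I : Inst E ℝ}

/-- First integer of the domain of the function of the head `h`. -/
noncomputable def domMin (I : Inst E ℝ) (h : E) : ℕ :=
  I.b - (I.pred h).card - min (min I.b I.Ef.card - (I.pred h).card) (I.inc h).card

/-- Last integer of the domain of the function of the head `h`. -/
noncomputable def domMax (I : Inst E ℝ) (h : E) : ℕ :=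
  I.b - (I.pred h).card - (I.b - I.El.card - (I.pred h).card)

theorem blMin_eq : I.blMin = ((I.b - I.Ef.card : ℕ) : ℝ) := by
  rw [natCast_tsub]; rfl

theorem blMax_eq : I.blMax = ((min I.b I.El.card : ℕ) : ℝ) := by
  push_cast; rfl

theorem bfMax_eq : I.bfMax = ((min I.b I.Ef.card : ℕ) : ℝ) := by
  rw [bfMax, blMin_eq, ← Nat.cast_sub (Nat.sub_le _ _)]
  congr 1
  omega

theorem bfMin_eq : I.bfMin = ((I.b - I.El.card : ℕ) : ℝ) := by
  rw [bfMin, blMax_eq, ← Nat.cast_sub (min_le_left _ _)]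
  congr 1
  omega

theorem Valid.b_le_add (hV : I.Valid) : I.b ≤ I.El.card + I.Ef.card := by
  rw [← Finset.card_union_of_disjoint hV.disjoint]
  exact hV.b_le

theorem mem_leaderHeads {h : E} : h ∈ I.leaderHeads ↔ h ∈ I.Ef ∧
    (I.pred h).card ≤ min I.b I.Ef.card ∧
      I.b - I.El.card ≤ (I.pred h).card + (I.inc h).card := by
  rw [leaderHeads, Finset.mem_filter, bfMax_eq, bfMin_eq, Nat.cast_le, sub_le_iff_le_add',
    ← Nat.cast_add, Nat.cast_le]

theorem capMin_eq (h : E) :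
    I.capMin h = ((I.b - I.El.card - (I.pred h).card : ℕ) : ℝ) := by
  rw [capMin, bfMin_eq, natCast_tsub (I.b - I.El.card)]

theorem capMax_eq {h : E} (hh : h ∈ I.leaderHeads) : I.capMax h =
    ((min (min I.b I.Ef.card - (I.pred h).card) (I.inc h).card : ℕ) : ℝ) := by
  rw [capMax, bfMax_eq, ← Nat.cast_sub (mem_leaderHeads.1 hh).2.1]
  push_cast
  rfl

theorem Valid.domMin_le_domMax (hV : I.Valid) {h : E} (hh : h ∈ I.leaderHeads) :
    I.domMin h ≤ I.domMax h := by
  have h1 := mem_leaderHeads.1 hh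
  have h2 := hV.b_le_add
  rw [domMin, domMax]
  omega

theorem Valid.le_domMin (hV : I.Valid) {h : E} (hh : h ∈ I.leaderHeads) :
    I.b - I.Ef.card ≤ I.domMin h := by
  have h1 := mem_leaderHeads.1 hh
  have h2 := hV.b_le_add
  rw [domMin]
  omega

/-- The function of the head `h` is defined on `[i, i + 1]`. -/
theorem Valid.mem_section_iff (hV : I.Valid) {i : ℕ} (h0 : I.b - I.Ef.card ≤ i)
    (h1 : i < min I.b I.El.card) {h : E} :
    h ∈ I.leaderHeads ∧ I.domMin h ≤ i ∧ i + 1 ≤ I.domMax h ↔ h ∈ I.Ef ∧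
      (I.pred h).card ≤ I.b - i - 1 ∧ I.b - i - 1 + 1 ≤ (I.pred h).card + (I.inc h).card := by
  have h2 := hV.b_le_add
  rw [mem_leaderHeads, domMin, domMax, and_assoc]
  refine and_congr_right fun _ => ?_
  omega

/-- On a closed section it suffices to consider heads defined on all of it. In the interior this is
automatic, because domains have integral ends; at the two ends a maximizing head may have to be
exchanged. -/
theorem isGreatest_section (hV : I.Valid) {i : ℕ} (h0 : I.b - I.Ef.card ≤ i)
    (h1 : i < min I.b I.El.card) {s : ℝ} (s0 : 0 ≤ s) (s1 : s ≤ 1) :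
    IsGreatest {v | ∃ h ∈ I.leaderHeads, (I.domMin h ≤ i ∧ i + 1 ≤ I.domMax h) ∧
      v = I.headFun h (i + s)} (I.gf (i + s)) := by
  have hb : i + 1 ≤ I.b := by omega
  obtain ⟨k, hk⟩ : ∃ k, I.b = i + k + 1 := ⟨I.b - i - 1, by omega⟩
  have hk' : I.b - i - 1 = k := by omega
  have hkf : k < I.Ef.card := by omega
  have ht : (i : ℝ) + s ∈ Set.Icc I.blMin I.blMax := by
    rw [blMin_eq, blMax_eq]
    constructor
    · have : ((I.b - I.Ef.card : ℕ) : ℝ) ≤ i := by exact_mod_cast h0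
      linarith
    · have : ((i + 1 : ℕ) : ℝ) ≤ (min I.b I.El.card : ℕ) := by exact_mod_cast h1
      push_cast at this ⊢
      linarith
  have hβ : (I.b : ℝ) - (i + s) = k + (1 - s) := by
    rw [hk]; push_cast; ring
  have hg := hV.isGreatest_gf ht
  rw [headValues_eq ht, hβ] at hg
  have hset : {v | ∃ h ∈ I.leaderHeads, (I.domMin h ≤ i ∧ i + 1 ≤ I.domMax h) ∧
      v = I.headFun h (i + s)} = {v | ∃ h ∈ I.Ef, ((I.pred h).card ≤ k ∧
        k + 1 ≤ (I.pred h).card + (I.inc h).card) ∧ v = I.headFun h (i + s)} := by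
    ext v
    simp only [Set.mem_ofPred_eq]
    refine exists_congr fun h => ?_
    have := hV.mem_section_iff h0 h1 (h := h)
    rw [hk'] at this
    tauto
  rw [hset]
  have hup : ∀ h ∈ I.Ef, (I.pred h).card ≤ k → k + 1 ≤ (I.pred h).card + (I.inc h).card →
      I.headFun h (i + s) ≤ I.gf (i + s) := by
    intro h hh h2 h3
    refine hg.2 ⟨h, mem_adversaryHeads.2 ⟨hh, ?_, ?_⟩, rfl⟩
    · have : ((I.pred h).card : ℝ) ≤ k := by exact_mod_cast h2
      linarith
    · have : (k : ℝ) + 1 ≤ (I.pred h).card + (I.inc h).card := by exact_mod_cast h3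
      linarith
  refine ⟨?_, ?_⟩
  · obtain ⟨h, hh, hv⟩ := hg.1
    have hdom : ∃ h' ∈ I.Ef, (I.pred h').card ≤ k ∧ k + 1 ≤ (I.pred h').card + (I.inc h').card ∧
        I.headFun h (i + s) ≤ I.headFun h' (i + s) := by
      -- The follower's capacity is `k + (1 - s)`, so the left end `s = 0` of the section is the
      -- upper capacity `k + 1`, and the right end is the capacity `k`.
      rcases s0.eq_or_lt with rfl | s0
      · have e1 : (k : ℝ) + (1 - 0) = (k + 1 : ℕ) := by push_cast; ring
        have e2 : (i : ℝ) + 0 = I.b - (k + 1 : ℕ) := by rw [hk]; push_cast; ring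
        rw [e1] at hh
        rw [e2]
        exact hV.exists_head_left hh
      rcases s1.eq_or_lt with rfl | s1
      · have e1 : (k : ℝ) + (1 - 1) = k := by ring
        have e2 : (i : ℝ) + 1 = I.b - k := by rw [hk]; push_cast; ring
        rw [e1] at hh
        rw [e2]
        exact hV.exists_head_right hh hkf
      · obtain ⟨h2, h3, h4⟩ := mem_adversaryHeads.1 hh
        refine ⟨h, h2, ?_, ?_, le_rfl⟩
        · have : ((I.pred h).card : ℝ) < (k + 1 : ℕ) := by push_cast; linarith
          have := Nat.cast_lt.1 this
          omega
        · have : (k : ℝ) < ((I.pred h).card + (I.inc h).card : ℕ) := by push_cast; linarith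
          exact Nat.cast_lt.1 this
    obtain ⟨h', hh', h2, h3, h4⟩ := hdom
    exact ⟨h', hh', ⟨h2, h3⟩, le_antisymm (hv.trans_le h4) (hup h' hh' h2 h3)⟩
  · rintro v ⟨h, hh, ⟨h2, h3⟩, rfl⟩
    exact hup h hh h2 h3

/-- At the last abscissa no section follows, so all heads defined at this point enter the maximum.
-/
theorem isGreatest_end (hV : I.Valid) :
    IsGreatest {v | ∃ h ∈ I.leaderHeads,
      (I.domMin h ≤ min I.b I.El.card ∧ min I.b I.El.card ≤ I.domMax h) ∧
      v = I.headFun h (min I.b I.El.card : ℕ)} (I.gf (min I.b I.El.card : ℕ)) := by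
  have h2 := hV.b_le_add
  have ht : ((min I.b I.El.card : ℕ) : ℝ) ∈ Set.Icc I.blMin I.blMax := by
    rw [blMin_eq, blMax_eq]
    refine ⟨?_, le_rfl⟩
    exact_mod_cast (by omega : I.b - I.Ef.card ≤ min I.b I.El.card)
  convert hV.isGreatest_gf ht using 1
  rw [headValues_eq ht]
  ext v
  simp only [Set.mem_ofPred_eq, ← mem_leaderHeads_iff ht, and_assoc]
  refine exists_congr fun h => and_congr_right fun hh => ?_
  have h3 := mem_leaderHeads.1 hh
  rw [← and_assoc, headDomain, Set.mem_ofPred_eq, Set.mem_Icc, capMin_eq, capMax_eq hh,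
    sub_le_iff_le_add, le_sub_iff_add_le, ← Nat.cast_add, ← Nat.cast_add, ← Nat.cast_add,
    Nat.cast_le, Nat.cast_le, domMin, domMax]
  refine and_congr ?_ Iff.rfl
  omega

/-- The bound on `i + 1` makes the mirrored argument range over `[j, j + 1]` for a natural number
`j`, where `pieces` has a single slope. -/
theorem headFun_linear {h : E} {i : ℕ} (hi : i + 1 ≤ I.domMax h) {s : ℝ}
    (s0 : 0 ≤ s) (s1 : s ≤ 1) :
    I.headFun h (i + s) = Prog.lin (I.headFun h i, I.headFun h (i + 1)) s := by
  have h1 : i + 1 + (I.pred h).card ≤ I.b := by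
    rw [domMax] at hi
    omega
  obtain ⟨j, hj⟩ := Nat.exists_eq_add_of_le h1
  simp only [headFun, plfBar, Prog.lin]
  rw [show (I.b : ℝ) - (i + s + (I.pred h).card) = j + (1 - s) by rw [hj]; push_cast; ring,
    show (I.b : ℝ) - (i + (I.pred h).card) = j + 1 by rw [hj]; push_cast; ring,
    show (I.b : ℝ) - (i + 1 + (I.pred h).card) = j by rw [hj]; push_cast; ring,
    pieces_natCast_add _ _ (by linarith) (by linarith)]
  ring

theorem gl_linear (i : ℕ) {s : ℝ} (s0 : 0 ≤ s) (s1 : s ≤ 1) :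
    I.gl (i + s) = Prog.lin (I.gl i, I.gl (i + 1)) s := by
  simp only [gl, plf, Prog.lin]
  rw [pieces_natCast_add _ _ s0 s1]

end Problem

end Inst

namespace Prog

/-! ### Correctness of the leader's implementation. -/

section Leader

variable {E : Type} [DecidableEq E] {I : Inst E ℝ}

theorem headVertices_val (hV : I.Valid) {h : E} (hf : h ∈ I.Ef) :
    (headVertices I I.bfMin I.bfMax h).val =
      if h ∈ I.leaderHeads then
        some (nodesFrom (I.headFun h) (I.domMin h) (I.domMax h) (I.b - I.Ef.card))
      else none := by
  have hn := hV.nodup_follower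
  have hp : (predList I I.followerItems h).length = (I.pred h).card := length_predList hn rfl h
  have hq : (incList I I.followerItems h).length = (I.inc h).card := length_incList hn rfl h
  simp only [headVertices, bind_val, filter_val, count_val, le, sub]
  rw [← predList, ← incList, hp, hq]
  have hiff : (decide (((I.pred h).card : ℝ) ≤ I.bfMax) &&
      decide (I.bfMin - ((I.pred h).card : ℝ) ≤ (I.inc h).card)) = true ↔ h ∈ I.leaderHeads := by
    rw [Bool.and_eq_true, decide_eq_true_eq, decide_eq_true_eq, Inst.leaderHeads,
      Finset.mem_filter]
    simp [hf]
  by_cases hh : h ∈ I.leaderHeads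
  swap
  · rw [if_neg hh, if_neg (hiff.not.2 hh)]
    rfl
  rw [if_pos hh, if_pos (hiff.2 hh)]
  simp only [bind_val, maxNum, minNum, map_val, mirror, shift, add, sub, revOnto_val, sumOver_val,
    pure_val, List.append_nil]
  congr 1
  rw [← Inst.capMin, ← Inst.capMax, Inst.capMin_eq, Inst.capMax_eq hh]
  set sorted := (sort (geBy I.c) (incList I I.followerItems h)).val with hs
  have hperm : sorted.Perm (incList I I.followerItems h) := sort_perm _ _
  have hlen : sorted.length = (I.inc h).card := hperm.length_eq.trans hq
  rw [plfVertices_val _ _ (by rw [hlen]; exact min_le_right _ _)]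
  have hnp : (predList I I.followerItems h).Nodup := hn.filter _
  have hni : (incList I I.followerItems h).Nodup := hn.filter _
  have hval : (sorted : Multiset E) = (I.inc h).val := by
    rw [← toFinset_incList rfl h, List.toFinset_val, List.dedup_eq_self.2 hni,
      Multiset.coe_eq_coe]
    exact hperm
  have hz : ((predList I I.followerItems h).map I.c).sum = ∑ e ∈ I.pred h, I.c e := by
    rw [← toFinset_predList rfl h, List.sum_toFinset _ hnp]
  rw [hz]
  obtain ⟨-, h1, h2⟩ := Inst.mem_leaderHeads.1 hh
  have h3 := hV.b_le_add
  have h4 := hV.le_domMin hh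
  rw [nodesFrom, max_eq_left h4, nodes, nodes, List.map_map, ← List.map_reverse, List.map_map]
  -- Mirroring and shifting turn a capacity `i` into the abscissa `b - |pred h| - i`; this reverses
  -- the order, and the program's list reversal restores it.
  have hlist : List.range' (I.domMin h) (I.domMax h + 1 - I.domMin h) =
      (List.range' (I.b - I.El.card - (I.pred h).card)
        (min (min I.b I.Ef.card - (I.pred h).card) (I.inc h).card + 1 -
          (I.b - I.El.card - (I.pred h).card))).reverse.map
        fun i => I.b - (I.pred h).card - i := by
    refine eq_of_pairwise_lt List.pairwise_lt_range' ?_ fun i => ?_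
    · rw [List.pairwise_map, List.pairwise_reverse]
      refine List.Pairwise.imp_of_mem (fun {a b} ha hb hab => ?_) List.pairwise_lt_range'
      rw [List.mem_range'_1] at ha hb
      omega
    · simp only [List.mem_map, List.mem_reverse, List.mem_range'_1, Inst.domMin, Inst.domMax]
      constructor
      · intro hi
        exact ⟨I.b - (I.pred h).card - i, by omega, by omega⟩
      · rintro ⟨j, hj, rfl⟩
        omega
  rw [hlist, List.map_map]
  refine List.map_congr_left fun i hi => ?_
  rw [List.mem_reverse, List.mem_range'_1] at hi
  have hc : ((I.b - (I.pred h).card - i : ℕ) : ℝ) = I.b - (I.pred h).card - i := by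
    rw [Nat.cast_sub (by omega), Nat.cast_sub (by omega)]
  simp only [Function.comp, hc]
  rw [Inst.headFun, plfBar, map_eq_sort_ge hval (sort_geBy_pairwise _ _)]
  ring_nf

theorem allHeads_val (hV : I.Valid) : ∀ hs : List E, (∀ h ∈ hs, h ∈ I.Ef) →
    (allHeads I I.bfMin I.bfMax hs).val = (hs.filter fun h => decide (h ∈ I.leaderHeads)).map
      fun h => nodesFrom (I.headFun h) (I.domMin h) (I.domMax h) (I.b - I.Ef.card)
  | [], _ => rfl
  | h :: hs, hf => by
    have ih := allHeads_val hV hs fun h' hh' => hf h' (by simp [hh'])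
    rw [allHeads]
    simp only [bind_val, ih, headVertices_val hV (hf h (by simp))]
    by_cases hh : h ∈ I.leaderHeads
    · rw [if_pos hh, List.filter_cons_of_pos (by simpa using hh)]
      rfl
    · rw [if_neg hh, List.filter_cons_of_neg (by simpa using hh)]
      rfl

/-- The vertices produced by `pointwiseMax` are points of the graph of `gf`; adding `gl` and
comparing values yields a global minimizer of `g`, because every other argument is matched by a
vertex with no larger value. -/
theorem leader_spec (hV : I.Valid) : I.LeaderAlgorithm (toVec (leader I).val) := by
  have hnl : I.leaderItems.length = I.El.card :=
    (List.toFinset_card_of_nodup hV.nodup_leader).symm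
  have hnf : I.followerItems.length = I.Ef.card :=
    (List.toFinset_card_of_nodup hV.nodup_follower).symm
  set items := (sort (leBy I.c) I.leaderItems).val with hitems
  have hperm : items.Perm I.leaderItems := sort_perm _ _
  have hn : items.Nodup := hperm.nodup_iff.2 hV.nodup_leader
  have hEl : items.toFinset = I.El := List.toFinset_eq_of_perm _ _ hperm
  have hlen : items.length = I.El.card := hperm.length_eq.trans hnl
  have hsort : items.Pairwise fun a b => I.c a ≤ I.c b := sort_leBy_pairwise _ _
  have hval : (items : Multiset E) = I.El.val := by
    rw [← hEl, List.toFinset_val, List.dedup_eq_self.2 hn]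
  have hgl : pieces (items.map I.c) = I.gl := by
    funext t
    rw [Inst.gl, plf, map_eq_sort_le hval hsort]
  set hs := I.followerItems.filter fun h => decide (h ∈ I.leaderHeads) with hhs
  have hmem : ∀ h, h ∈ hs ↔ h ∈ I.leaderHeads := by
    intro h
    simp only [hhs, List.mem_filter, decide_eq_true_eq, and_iff_right_iff_imp]
    exact fun hh => List.mem_toFinset.1 (Inst.mem_leaderHeads.1 hh).1
  have hble := hV.b_le_add
  set t₀ := I.b - I.Ef.card with ht₀
  obtain ⟨m, hm⟩ := Nat.exists_eq_add_of_le (by omega : t₀ ≤ min I.b I.El.card)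
  obtain ⟨p1, p2, p3, p4⟩ := pointwiseMax_spec (fun h => I.headFun h) I.domMin I.domMax I.gl I.gf
    m t₀ hs (fun h hh => hV.domMin_le_domMax ((hmem h).1 hh))
    (fun h _ i _ hi s s0 s1 => Inst.headFun_linear hi s0 s1)
    (by
      intro i hi hi' s s0 s1
      simp only [hmem]
      exact Inst.isGreatest_section hV hi (by omega) s0 s1)
    (by
      simp only [hmem, ← hm]
      exact Inst.isGreatest_end hV) _ rfl
  set gf := (pointwiseMax (nodes I.gl t₀ (m + 1))
    (hs.map fun h => nodesFrom (I.headFun h) (I.domMin h) (I.domMax h) t₀)).val with hgf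
  have hadd := addFun_val (G := I.gl) (fun i s s0 s1 => Inst.gl_linear i s0 s1) m t₀ gf p2
    fun p hp => ⟨(p1 p hp).1, (p1 p hp).2.1⟩
  have hg : ∃ p l, gf.map (fun p => (p.1, I.gl p.1 + p.2)) = p :: l := by
    obtain ⟨p, hp, -⟩ := p4
    rcases gf with _ | ⟨q, l⟩
    · simp at hp
    · exact ⟨_, _, rfl⟩
  obtain ⟨p, l, hpl⟩ := hg
  obtain ⟨a1, a2⟩ := argmin_spec p l
  have hv : (leader I).val = fill (argmin p l).val.1 items := by
    simp only [leader, bind_val, count_val, sub, maxNum, minNum, hnl, hnf]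
    rw [← Inst.blMin, ← Inst.blMax, ← Inst.bfMin, ← Inst.bfMax,
      allHeads_val hV _ fun h hh => List.mem_toFinset.2 hh, ← hitems, ← hhs, Inst.blMin_eq,
      Inst.blMax_eq, plfVertices_val _ _ (by rw [hlen]; exact min_le_right _ _), ← ht₀, hgl, hm,
      show t₀ + m + 1 - t₀ = m + 1 by omega, ← hgf, hadd, hpl]
    simp only [bind_val, greedy_val]
  rw [hv]
  set q := (argmin p l).val with hq
  rw [← hpl] at a1 a2
  obtain ⟨x, hx, hxq⟩ := List.mem_map.1 a1
  obtain ⟨x1, x2, x3⟩ := p1 x hx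
  have hq1 : q.1 = x.1 := by rw [← hxq]
  have hq2 : q.2 = I.g q.1 := by rw [← hxq, Inst.g, x3]
  have hIcc : q.1 ∈ Set.Icc I.blMin I.blMax := by
    rw [Inst.blMin_eq, Inst.blMax_eq, hq1, ← ht₀, hm]
    exact ⟨x1, x2⟩
  have hmin : ∀ y ∈ gf, I.g q.1 ≤ I.gl y.1 + y.2 := by
    intro y hy
    rw [← hq2]
    exact a2 _ (List.mem_map_of_mem hy)
  refine ⟨q.1, hIcc, fun t' ht' => ?_, ?_⟩
  · rw [Inst.blMin_eq, Inst.blMax_eq, hm] at ht'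
    obtain ⟨ht1, ht2⟩ := ht'
    -- The right end is treated separately, since the section starting at its integer part lies
    -- outside the range; the output contains a vertex there.
    rcases ht2.eq_or_lt with heq | hlt
    · obtain ⟨y, hy, hy1⟩ := p4
      have := hmin y hy
      rw [(p1 y hy).2.2, hy1, ← heq] at this
      exact this
    · have ht0 : 0 ≤ t' := le_trans (Nat.cast_nonneg _) ht1
      -- On the section containing `t'` the function `gl` is linear and serves as the linear
      -- function added to the envelope.
      obtain ⟨y, hy, y1, y2, y3⟩ := p3 ⌊t'⌋₊ (Nat.le_floor ht1) ((Nat.floor_lt ht0).2 hlt)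
        (I.gl ⌊t'⌋₊, I.gl (⌊t'⌋₊ + 1)) (t' - ⌊t'⌋₊) (sub_nonneg.2 (Nat.floor_le ht0))
        (by linarith [Nat.lt_floor_add_one t'])
      have h1 := hmin y hy
      rw [← Inst.gl_linear _ (sub_nonneg.2 y1) (by linarith),
        ← Inst.gl_linear _ (sub_nonneg.2 (Nat.floor_le ht0))
          (by linarith [Nat.lt_floor_add_one t']), add_sub_cancel, add_sub_cancel] at y3
      exact h1.trans y3
  · obtain ⟨⟨h0, h1⟩, -⟩ := Inst.Valid.mem_Icc_iff.1 hIcc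
    rw [← hEl]
    exact toVec_fill_solves hn h0 (by rw [hlen]; exact h1) hsort

end Leader

end Prog

end RCBSP

namespace RCBSP

namespace Prog

/-! ### The running time of the leader's implementation. -/

section LeaderSteps

theorem vertices_steps : ∀ (ss : List ℝ) (t v : ℝ), (vertices t v ss).steps = 3 * ss.length + 1
  | [], t, v => by simp [vertices]
  | s :: ss, t, v => by
    simp only [vertices, bind_steps, vertices_steps ss, add, tick_steps, pure_steps,
      List.length_cons]
    omega

theorem vertices_length : ∀ (ss : List ℝ) (t v : ℝ),
    (vertices t v ss).val.length = ss.length + 1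
  | [], t, v => by simp [vertices]
  | s :: ss, t, v => by
    simp only [vertices, bind_val, pure_val, List.length_cons, vertices_length ss]

theorem plfVertices_length {α : Type} (c : α → ℝ) (items : List α) (a a' : ℝ) :
    (plfVertices c items a a').val.length ≤ items.length + 1 := by
  simp only [plfVertices, bind_val, filter_val]
  refine (List.length_filter_le _ _).trans ?_
  rw [vertices_length, map_val, List.length_map]

theorem plfVertices_steps {α : Type} (c : α → ℝ) (items : List α) (a a' : ℝ) :
    (plfVertices c items a a').steps ≤ 9 * items.length + 8 := by
  have h1 := map_steps (read c) (k := 1) (fun _ => le_rfl) items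
  have h2 := vertices_steps (map (read c) items).val 0 0
  have h3 := filter_steps (inRange a a') (k := 3) (fun p => by simp [inRange, le])
    (vertices 0 0 (map (read c) items).val).val
  rw [vertices_length, map_val, List.length_map] at h3
  rw [map_val, List.length_map] at h2
  simp only [plfVertices, bind_steps, tick_steps, map_val] at h2 h3 ⊢
  linarith

theorem mirror_steps (b : ℝ) (p : ℝ × ℝ) : (mirror b p).steps ≤ 2 := by simp [mirror, sub]

theorem shift_steps (a r : ℝ) (p : ℝ × ℝ) : (shift a r p).steps ≤ 3 := by simp [shift, add]

theorem headVertices_steps {E : Type} (I : Inst E ℝ) (fMin fMax : ℝ) (h : E) :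
    (headVertices I fMin fMax h).steps ≤
      8 * (I.followerItems.length * Nat.clog 2 I.followerItems.length) +
        50 * I.followerItems.length + 50 := by
  have f1 := filter_steps (isPred I h) (isPred_steps I h) I.followerItems
  have f2 := filter_steps (isInc I h) (isInc_steps I h) I.followerItems
  have l1 : (filter (isPred I h) I.followerItems).val.length ≤ I.followerItems.length := by
    rw [filter_val]; exact List.length_filter_le _ _
  have l2 : (filter (isInc I h) I.followerItems).val.length ≤ I.followerItems.length := by
    rw [filter_val]; exact List.length_filter_le _ _
  rw [headVertices]
  simp only [bind_steps, tick_steps, count_steps, sub, le]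
  generalize (filter (isPred I h) I.followerItems).steps = s₁ at f1 ⊢
  generalize (filter (isInc I h) I.followerItems).steps = s₂ at f2 ⊢
  generalize (filter (isPred I h) I.followerItems).val = before at l1 ⊢
  generalize (filter (isInc I h) I.followerItems).val = mid at l2 ⊢
  split
  · simp only [bind_steps, maxNum, minNum, revOnto_steps, sumOver_steps, pure_steps]
    have t1 := sort_steps (geBy I.c) (geBy_steps I.c) mid
    have l3 := (sort_perm (geBy I.c) mid).length_eq
    have hm : mid.length * Nat.clog 2 mid.length ≤
        I.followerItems.length * Nat.clog 2 I.followerItems.length :=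
      Nat.mul_le_mul l2 (Nat.clog_mono_right 2 l2)
    generalize (sort (geBy I.c) mid).steps = s₃ at t1 ⊢
    generalize (sort (geBy I.c) mid).val = sorted at l3 ⊢
    have t2 := plfVertices_steps I.c sorted (max 0 (fMin - (count before : Timed ℝ).val))
      (min (fMax - (count before : Timed ℝ).val) (count mid : Timed ℝ).val)
    have l4 := plfVertices_length I.c sorted (max 0 (fMin - (count before : Timed ℝ).val))
      (min (fMax - (count before : Timed ℝ).val) (count mid : Timed ℝ).val)
    generalize plfVertices I.c sorted (max 0 (fMin - (count before : Timed ℝ).val))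
      (min (fMax - (count before : Timed ℝ).val) (count mid : Timed ℝ).val) = k at t2 l4 ⊢
    have t3 := map_steps (mirror (I.b : ℝ)) (mirror_steps _) k.val
    have l5 : (map (mirror (I.b : ℝ)) k.val).val.length = k.val.length := by
      rw [map_val, List.length_map]
    generalize map (mirror (I.b : ℝ)) k.val = k₁ at t3 l5 ⊢
    have l6 : (revOnto k₁.val []).val.length = k₁.val.length := by
      rw [revOnto_val, List.append_nil, List.length_reverse]
    generalize (revOnto k₁.val []).val = k₂ at l6 ⊢
    have t4 := map_steps (shift (0 - (count before : Timed ℝ).val) (sumOver I.c before).val)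
      (shift_steps _ _) k₂
    generalize (map (shift (0 - (count before : Timed ℝ).val) (sumOver I.c before).val) k₂).steps
      = s₄ at t4 ⊢
    linarith
  · simp only [pure_steps]
    linarith [Nat.zero_le (I.followerItems.length * Nat.clog 2 I.followerItems.length)]

theorem allHeads_steps {E : Type} (I : Inst E ℝ) (fMin fMax : ℝ) : ∀ hs : List E,
    (allHeads I fMin fMax hs).steps ≤ hs.length *
      (8 * (I.followerItems.length * Nat.clog 2 I.followerItems.length) +
        50 * I.followerItems.length + 51) + 1
  | [] => by simp [allHeads]
  | h :: hs => by
    have h1 := headVertices_steps I fMin fMax h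
    have h2 := allHeads_steps I fMin fMax hs
    rw [allHeads]
    simp only [bind_steps, tick_steps, List.length_cons, Nat.add_mul hs.length, one_mul]
    split <;> simp only [pure_steps] <;> linarith

theorem allHeads_length {E : Type} (I : Inst E ℝ) (fMin fMax : ℝ) : ∀ hs : List E,
    (allHeads I fMin fMax hs).val.length ≤ hs.length
  | [] => by simp [allHeads]
  | h :: hs => by
    have h2 := allHeads_length I fMin fMax hs
    rw [allHeads]
    simp only [bind_val]
    split <;> simp only [pure_val, List.length_cons] <;> omega

theorem segments_bounds (t : ℝ) : ∀ fs : List (List (ℝ × ℝ)),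
    (segments t fs).steps ≤ 2 * fs.length + 1 ∧ (segments t fs).val.length ≤ fs.length
  | [] => by simp [segments]
  | f :: fs => by
    obtain ⟨h1, h2⟩ := segments_bounds t fs
    rw [segments]
    simp only [bind_steps, bind_val, tick_steps, List.length_cons]
    split
    · simp only [bind_steps, bind_val, le]
      split <;> simp only [pure_steps, pure_val, List.length_cons] <;> constructor <;> linarith
    · simp only [pure_steps, pure_val]
      constructor <;> linarith

theorem advance_bounds (t : ℝ) : ∀ fs : List (List (ℝ × ℝ)),
    (advance t fs).steps ≤ 2 * fs.length + 1 ∧ (advance t fs).val.length ≤ fs.length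
  | [] => by simp [advance]
  | f :: fs => by
    obtain ⟨h1, h2⟩ := advance_bounds t fs
    rw [advance]
    simp only [bind_steps, bind_val, tick_steps, List.length_cons]
    split
    · simp only [pure_steps, pure_val]
      constructor <;> linarith
    · simp only [bind_steps, bind_val, le]
      split <;> simp only [pure_steps, pure_val, List.length_cons] <;> constructor <;> linarith

theorem maxAt_bounds (t : ℝ) : ∀ fs : List (List (ℝ × ℝ)),
    (maxAt t fs).steps ≤ 3 * fs.length + 1 ∧ (maxAt t fs).val.length ≤ 1
  | [] => by simp [maxAt]
  | f :: fs => by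
    obtain ⟨h1, h2⟩ := maxAt_bounds t fs
    rw [maxAt]
    simp only [bind_steps, bind_val, tick_steps, List.length_cons]
    rcases f with _ | ⟨⟨a, u⟩, f⟩
    · simp only [pure_steps, pure_val]
      exact ⟨by linarith, h2⟩
    · simp only [bind_steps, bind_val, le]
      split
      · rcases (maxAt t fs).val with _ | ⟨⟨w, v⟩, r⟩
        · simp only [pure_steps, pure_val, List.length_singleton]
          exact ⟨by linarith, le_rfl⟩
        · simp only [bind_steps, bind_val, maxNum, pure_steps, pure_val, List.length_singleton]
          exact ⟨by linarith, le_rfl⟩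
      · simp only [pure_steps, pure_val]
        exact ⟨by linarith, h2⟩

/-- Amortization with a potential of `6` per vertex: removing a vertex costs six steps, which its
potential pays. The last call takes at most `21` steps and creates at most two more vertices, and
`33 = 21 + 2 * 6`. -/
theorem pushPiece_bound (p : ℝ × ℝ) : ∀ (last : Option (ℝ × ℝ)) (k : List (ℝ × ℝ)),
    (pushPiece p last k).steps + 6 * (pushPiece p last k).val.length ≤ 6 * k.length + 33
  | last, [] => by simp [pushPiece]
  | last, (s, v) :: k => by
    have ih := pushPiece_bound p (some (s, v)) k
    rw [pushPiece]
    simp only [bind_steps, bind_val, tick_steps, evalPiece_steps, lt, List.length_cons]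
    split
    · linarith
    · rcases last with _ | ⟨s₁, v₁⟩
      · simp only [pure_steps, pure_val, List.length_cons]
        linarith
      · simp only [bind_steps, bind_val, evalPiece_steps, sub, add, mul, div, pure_steps, pure_val,
          List.length_cons]
        linarith

theorem pushAll_bound : ∀ ps k : List (ℝ × ℝ),
    (pushAll ps k).steps + 6 * (pushAll ps k).val.length ≤ 6 * k.length + 34 * ps.length + 1
  | [], k => by simp [pushAll]; omega
  | p :: ps, k => by
    have h1 := pushPiece_bound p none k
    have h2 := pushAll_bound ps (pushPiece p none k).val
    rw [pushAll]
    simp only [bind_steps, bind_val, tick_steps, List.length_cons]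
    linarith

theorem envelope_bounds (ps : List (ℝ × ℝ)) :
    (envelope ps).steps ≤ 8 * (ps.length * Nat.clog 2 ps.length) + 41 * ps.length + 7 ∧
      (envelope ps).val.length ≤ 6 * ps.length + 1 := by
  have h1 := sort_steps leSlope leSlope_steps ps
  have h2 := (sort_perm leSlope ps).length_eq
  have h3 := pushAll_bound (sort leSlope ps).val []
  rw [h2, List.length_nil] at h3
  -- The amortized bound also limits the number of vertices of the envelope.
  have h4 : 6 * (pushAll (sort leSlope ps).val []).val.length ≤ 34 * ps.length + 1 := by linarith
  have h5 := revOnto_steps (pushAll (sort leSlope ps).val []).val []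
  simp only [envelope, bind_steps, bind_val, tick_steps, revOnto_val, List.append_nil,
    List.length_reverse]
  constructor <;> linarith

theorem pointwiseMax_bounds : ∀ (l : List (ℝ × ℝ)) (fs : List (List (ℝ × ℝ))) (N : ℕ),
    fs.length ≤ N →
    (pointwiseMax l fs).steps ≤ l.length * (8 * (N * Nat.clog 2 N) + 80 * N + 25) + 1 ∧
      (pointwiseMax l fs).val.length ≤ l.length * (6 * N + 1)
  | [], fs, N, _ => by simp [pointwiseMax]
  | [(t, u)], fs, N, h => by
    obtain ⟨h1, h2⟩ := maxAt_bounds t fs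
    rw [pointwiseMax]
    simp only [bind_steps, bind_val, tick_steps, List.length_singleton, one_mul]
    constructor
    · linarith [Nat.zero_le (N * Nat.clog 2 N)]
    · linarith
  | (t, u) :: q :: l, fs, N, h => by
    obtain ⟨a1, a2⟩ := segments_bounds t fs
    obtain ⟨b1, b2⟩ := envelope_bounds (segments t fs).val
    have c1 := map_steps (shift t 0) (shift_steps t 0) (envelope (segments t fs).val).val
    have c2 : (map (shift t 0) (envelope (segments t fs).val).val).val.length =
        (envelope (segments t fs).val).val.length := by rw [map_val, List.length_map]
    obtain ⟨d1, d2⟩ := advance_bounds t fs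
    obtain ⟨e1, e2⟩ := pointwiseMax_bounds (q :: l) (advance t fs).val N (d2.trans h)
    have hN := a2.trans h
    have hm : (segments t fs).val.length * Nat.clog 2 (segments t fs).val.length ≤
        N * Nat.clog 2 N := Nat.mul_le_mul hN (Nat.clog_mono_right 2 hN)
    rw [pointwiseMax]
    simp only [bind_steps, bind_val, tick_steps, append_val, append_steps, List.length_append]
    rw [List.length_cons, Nat.add_mul, Nat.add_mul (q :: l).length, one_mul, one_mul]
    constructor <;> linarith

theorem addFun_bounds : ∀ l k : List (ℝ × ℝ),
    (addFun l k).steps ≤ 8 * (l.length + k.length) + 1 ∧ (addFun l k).val.length ≤ k.length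
  | [], _ => by simp [addFun]
  | _ :: _, [] => by simp [addFun]
  | [(a, u)], (t, v) :: k => by
    obtain ⟨h1, h2⟩ := addFun_bounds [(a, u)] k
    rw [addFun]
    simp only [bind_steps, bind_val, tick_steps, add, pure_steps, pure_val, List.length_cons,
      List.length_nil] at h1 h2 ⊢
    constructor <;> linarith
  | (a, u) :: (a', u') :: l, (t, v) :: k => by
    obtain ⟨h1, h2⟩ := addFun_bounds ((a, u) :: (a', u') :: l) k
    obtain ⟨h3, h4⟩ := addFun_bounds ((a', u') :: l) ((t, v) :: k)
    rw [addFun]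
    simp only [bind_steps, bind_val, tick_steps, le]
    split
    · simp only [bind_steps, bind_val, evalPiece_steps, sub, add, pure_steps, pure_val,
        List.length_cons] at h1 h2 ⊢
      constructor <;> linarith
    · simp only [List.length_cons] at h3 h4 ⊢
      constructor <;> linarith
  termination_by l k => l.length + k.length

theorem argmin_steps : ∀ (p : ℝ × ℝ) (l : List (ℝ × ℝ)), (argmin p l).steps ≤ 2 * l.length + 1
  | p, [] => by simp [argmin]
  | p, q :: l => by
    have h1 := argmin_steps p l
    have h2 := argmin_steps q l
    rw [argmin]
    simp only [bind_steps, tick_steps, lt, List.length_cons]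
    split <;> linarith

/-- The parameter `N` bounds both the number of heads and the number of vertices of `gl`, which is
at most the number of leader's items plus one. Constructing the head functions and the envelopes
takes `O(N² G)` steps; the rest is quadratic or less and is absorbed using `1 ≤ G`. -/
theorem leader_steps_le {E : Type} (I : Inst E ℝ) {p q N G : ℕ}
    (hp : I.leaderItems.length = p) (hq : I.followerItems.length = q) (hpN : p + 1 ≤ N)
    (hqN : q ≤ N) (hG : Nat.clog 2 N ≤ G) (hG1 : 1 ≤ G) :
    (leader I).steps ≤ 700 * (N ^ 2 * G) := by
  have s1 := sort_steps (leBy I.c) (leBy_steps I.c) I.leaderItems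
  have l1 := (sort_perm (leBy I.c) I.leaderItems).length_eq
  have hN : 1 ≤ N := by omega
  have hpG : p * Nat.clog 2 p ≤ N * G :=
    Nat.mul_le_mul (by omega) ((Nat.clog_mono_right 2 (by omega)).trans hG)
  have hqG : q * Nat.clog 2 q ≤ N * G :=
    Nat.mul_le_mul hqN ((Nat.clog_mono_right 2 hqN).trans hG)
  have hNG : N * Nat.clog 2 N ≤ N * G := Nat.mul_le_mul le_rfl hG
  have k1 : N * G ≤ N ^ 2 * G := Nat.mul_le_mul_right G (by nlinarith)
  have k2 : N ^ 2 ≤ N ^ 2 * G := Nat.le_mul_of_pos_right _ hG1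
  have k3 : N ≤ N ^ 2 := by nlinarith
  rw [leader]
  simp only [bind_steps, tick_steps, count_steps, sub, maxNum, minNum]
  generalize (count I.leaderItems : Timed ℝ).val = nl
  generalize (count I.followerItems : Timed ℝ).val = nf
  rw [hp] at s1 l1 ⊢
  generalize (sort (leBy I.c) I.leaderItems).steps = t₁ at s1 ⊢
  generalize (sort (leBy I.c) I.leaderItems).val = items at l1 ⊢
  generalize max 0 ((I.b : ℝ) - nf) = lMin
  generalize min (I.b : ℝ) nl = lMax
  have s2 := plfVertices_steps I.c items lMin lMax
  have l2 := plfVertices_length I.c items lMin lMax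
  generalize plfVertices I.c items lMin lMax = gl at s2 l2 ⊢
  have s3 := allHeads_steps I (I.b - lMax) (I.b - lMin) I.followerItems
  have l3 := allHeads_length I (I.b - lMax) (I.b - lMin) I.followerItems
  generalize allHeads I (I.b - lMax) (I.b - lMin) I.followerItems = fs at s3 l3 ⊢
  rw [hq] at s3 l3 ⊢
  obtain ⟨s4, l4⟩ := pointwiseMax_bounds gl.val fs.val N (l3.trans hqN)
  generalize pointwiseMax gl.val fs.val = gf at s4 l4 ⊢
  obtain ⟨s5, l5⟩ := addFun_bounds gl.val gf.val
  generalize addFun gl.val gf.val = g at s5 l5 ⊢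
  have hglN : gl.val.length ≤ N := by omega
  have m3 : q * (8 * (q * Nat.clog 2 q) + 50 * q + 51) ≤ N * (8 * (N * G) + 50 * N + 51) :=
    Nat.mul_le_mul hqN (by omega)
  have m4 : gl.val.length * (8 * (N * Nat.clog 2 N) + 80 * N + 25) ≤
      N * (8 * (N * G) + 80 * N + 25) := Nat.mul_le_mul hglN (by omega)
  have m5 : gl.val.length * (6 * N + 1) ≤ N * (6 * N + 1) := Nat.mul_le_mul_right _ hglN
  have e3 : N * (8 * (N * G) + 50 * N + 51) = 8 * (N ^ 2 * G) + 50 * N ^ 2 + 51 * N := by ring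
  have e4 : N * (8 * (N * G) + 80 * N + 25) = 8 * (N ^ 2 * G) + 80 * N ^ 2 + 25 * N := by ring
  have e5 : N * (6 * N + 1) = 6 * N ^ 2 + N := by ring
  rcases hg : g.val with _ | ⟨x, l⟩
  · simp only [pure_steps]
    linarith
  · have s6 := argmin_steps x l
    have l6 : g.val.length = l.length + 1 := by rw [hg, List.length_cons]
    simp only [bind_steps, greedy_steps]
    linarith

/-- If `g + 1` is the rounded-up binary logarithm, then `g * log 2 < log n`, and `log 2 ≤ log n`
pays for the additional one. The constant is `2 / log 2 < 3`. -/
theorem clog_le_three_mul_log {n : ℕ} (hn : 2 ≤ n) : (Nat.clog 2 n : ℝ) ≤ 3 * Real.log n := by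
  have h1 : 2 ^ (Nat.clog 2 n).pred < n := Nat.pow_pred_clog_lt_self one_lt_two (by omega)
  have h2 : 0 < Nat.clog 2 n := Nat.clog_pos one_lt_two hn
  obtain ⟨g, hg⟩ := Nat.exists_eq_add_one.2 h2
  rw [hg, Nat.pred_succ] at h1
  rw [hg]
  have h3 : (2 : ℝ) ^ g < n := by exact_mod_cast h1
  have h4 := Real.log_le_log (by positivity) h3.le
  rw [Real.log_pow] at h4
  have h5 : Real.log 2 ≤ Real.log n := Real.log_le_log two_pos (by exact_mod_cast hn)
  have h6 := Real.log_two_gt_d9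
  have h7 := (Nat.cast_nonneg g : (0 : ℝ) ≤ g)
  push_cast
  nlinarith

theorem leader_steps {E : Type} [DecidableEq E] {I : Inst E ℝ} (hV : I.Valid) (hn : 2 ≤ I.n) :
    ((leader I).steps : ℝ) ≤ 2100 * ((I.n : ℝ) ^ 2 * Real.log I.n) := by
  have hE : I.n = I.leaderItems.length + I.followerItems.length := by
    rw [Inst.n, Finset.card_union_of_disjoint hV.disjoint, Inst.El, Inst.Ef,
      List.toFinset_card_of_nodup hV.nodup_leader, List.toFinset_card_of_nodup hV.nodup_follower]
  have hq : 1 ≤ I.followerItems.length := by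
    obtain ⟨e, he⟩ := hV.follower_nonempty
    exact List.length_pos_of_mem (List.mem_toFinset.1 he)
  -- Since there is a follower's item, the number of leader's items plus one is at most `n`.
  have h1 := leader_steps_le I (N := I.n) rfl rfl (by omega) (by omega) le_rfl
    (Nat.clog_pos one_lt_two hn)
  have h2 : ((leader I).steps : ℝ) ≤ 700 * ((I.n : ℝ) ^ 2 * Nat.clog 2 I.n) := by
    exact_mod_cast h1
  have h3 := mul_le_mul_of_nonneg_left (clog_le_three_mul_log hn) (sq_nonneg (I.n : ℝ))
  linarith

end LeaderSteps

end Prog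

end RCBSP

theorem mainTheorem10 :
    ∃ C : ℝ, 0 < C ∧
      ∀ (E : Type) [DecidableEq E] (I : RCBSP.Inst E ℝ), I.Valid →
        -- the implementation of the leader's algorithm
        I.LeaderAlgorithm (RCBSP.Prog.toVec (RCBSP.Prog.leader I).val) ∧
        (2 ≤ I.n →
          ((RCBSP.Prog.leader I).steps : ℝ) ≤ C * ((I.n : ℝ) ^ 2 * Real.log (I.n : ℝ))) ∧
        -- the implementation of the adversary's algorithm
        (∀ x : E → ℝ, I.LeaderFeasible x →
          I.AdversaryAlgorithm x (RCBSP.Prog.toVec (RCBSP.Prog.adversary I x).val) ∧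
          ((RCBSP.Prog.adversary I x).steps : ℝ) ≤ C * (I.n : ℝ) ^ 2) ∧
        -- rational intervals lead to rational adversary's solutions
        ((∀ e ∈ I.Ef, I.lo e ∈ Set.range ((↑) : ℚ → ℝ) ∧ I.hi e ∈ Set.range ((↑) : ℚ → ℝ)) →
          ∀ x : E → ℝ, I.LeaderFeasible x → ∀ d : E → ℝ, I.AdversaryAlgorithm x d →
            ∀ e ∈ I.Ef, d e ∈ Set.range ((↑) : ℚ → ℝ)) ∧
        ∀ s : RCBSP.Setting,
          -- the function that the leader's algorithm minimizes is the leader's objective function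
          (∀ t ∈ Set.Icc I.blMin I.blMax,
            IsGreatest (I.headValues t) (I.gf t) ∧
            IsLeast {v | ∃ x : E → ℝ, I.LeaderFeasible x ∧ ∑ e ∈ I.El, x e = t ∧
              v = I.worstCost s x} (I.gl t + I.gf t)) ∧
          -- correctness of the leader's algorithm
          (∀ x : E → ℝ, I.LeaderAlgorithm x → I.OptimalLeader s x) ∧
          -- correctness of the adversary's algorithm
          (∀ x : E → ℝ, I.LeaderFeasible x → ∀ d : E → ℝ, I.AdversaryAlgorithm x d →
            I.OptimalAdversary s x d) := by
  -- The constant is `3 * 700` from the leader's bound; it exceeds the `200` of the adversary's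
  -- bound.
  refine ⟨2100, by norm_num, fun E _ I hV => ⟨RCBSP.Prog.leader_spec hV,
    RCBSP.Prog.leader_steps hV, fun x hx => ?_, fun hq x _ d hd => hd.mem_range_ratCast hq,
    fun s => ⟨fun t ht => ⟨hV.isGreatest_gf ht, hV.isLeast_g s ht⟩,
      fun x hx => hV.optimalLeader s hx, fun x _ d hd => hV.optimalAdversary s hd⟩⟩⟩
  obtain ⟨h1, h2⟩ := RCBSP.Prog.adversary_spec hV hx
  exact ⟨h1, h2.trans (by nlinarith [sq_nonneg (I.n : ℝ)])⟩
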